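/- Let $r\ge 1$ and let $\gamma_1,\dots,\gamma_r\in\mathbb C$ with $\Re\gamma_j>0$ for $1\le j\le r$. (1) Multiple zeta-function. In the region $\mathcal D_r=\{(s_j)\in\mathbb C^r:\ \Re(s_{r-k+1}+\cdots+s_r)>k\ (1\le k\le r)\}$ let $$\zeta_r(s_1,\dots,s_r;(\gamma_j))=\sum_{m_1=1}^\infty\cdots\sum_{m_r=1}^\infty\ \prod_{j=1}^r(m_1\gamma_1+\cdots+m_j\gamma_j)^{-s_j}$$ (principal branch). This series converges absolutely in $\mathcal D_r$, and the function has a meromorphic continuation to $\mathbb C^r$, denoted by the same symbol. (2) Desingularized function. Let $\mathcal C$ be the Hankel contour: it comes in from $+\infty$ along the top side of the positive real axis ($\arg t=0$), turns once counterclockwise around $0$ on the circle $|t|=\varepsilon$, and returns to $+\infty$ along the bottom side ($\arg t=2\pi$), with $\varepsilon>0$ sufficiently small. For real $c\ne1$ put $$\widetilde{\mathfrak H}_r((t_j);(\gamma_j);c)=\prod_{j=1}^r\Bigl(\frac{1}{\exp(\gamma_j\sum_{k=j}^rt_k)-1}-\frac{c}{\exp(c\gamma_j\sum_{k=j}^rt_k)-1}\Bigr),$$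 with the removable singularities at $\sum_{k=j}^r t_k=0$ removed. There is a unique entire function $\zeta_r^{\rm des}(\,\cdot\,;(\gamma_j))$ on $\mathbb C^r$ such that $$\zeta_r^{\rm des}((s_j);(\gamma_j))=\lim_{c\to1,\ c\in\mathbb R\setminus\{1\}}\frac{(-1)^r}{(c-1)^r}\prod_{k=1}^r\frac{1}{(e^{2\pi is_k}-1)\Gamma(s_k)}\int_{\mathcal C^r}\widetilde{\mathfrak H}_r((t_j);(\gamma_j);c)\prod_{k=1}^rt_k^{s_k-1}\,dt_k$$ for every $(s_j)\in\mathbb C^r$ with no $s_k$ a positive integer; here $1/((e^{2\pi is}-1)\Gamma(s))$ is extended by its limit to $s=0,-1,-2,\dots$, and the integral converges absolutely for $c$ close to $1$. (3) Coefficients. For indeterminates $u_j,v_j$ $(1\le j\le r)$ and with the convention $v_0^{-1}=0$, define integers $a_{\boldsymbol l,\boldsymbol m}$ $(\boldsymbol l\in\mathbb Z_{\ge 0}^r,\ \boldsymbol m\in\mathbb Z^r)$, finitely many of them non-zero, by $$\mathcal G=\prod_{j=1}^r\Bigl(1-(u_jv_j+\cdots+u_rv_r)(v_j^{-1}-v_{j-1}^{-1})\Bigr)=\sum_{\boldsymbol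 l,\boldsymbol m}a_{\boldsymbol l,\boldsymbol m}\prod_{j=1}^ru_j^{l_j}v_j^{m_j}.$$ Theorem. If $a_{\boldsymbol l,\boldsymbol m}\neq0$, then $\sum_{j=1}^rm_j=0$. Moreover, as an identity of meromorphic functions of $(s_j)$ on the whole of $\mathbb C^r$, $$\zeta_r^{\rm des}((s_j);(\gamma_j))=\sum_{\boldsymbol l,\boldsymbol m}a_{\boldsymbol l,\boldsymbol m}\Bigl(\prod_{j=1}^r(s_j)_{l_j}\Bigr)\zeta_r(s_1+m_1,\dots,s_r+m_r;(\gamma_j)),$$ where $(s)_0=1$ and $(s)_k=s(s+1)\cdots(s+k-1)$. That is, the two sides agree at every point at which all the shifted zeta-functions with $a_{\boldsymbol l,\boldsymbol m}\ne0$ are holomorphic, and these points are dense in $\mathbb C^r$; since the left-hand side is entire, all singularities of the terms on the right cancel in the sum. -/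

import Mathlib

open Filter Topology MeasureTheory

noncomputable section

/-! ### Holomorphic and meromorphic functions of several complex variables -/

/-- `f` is holomorphic in a neighbourhood of the point `p` of `ℂ^r`. -/
def HolomorphicNear {r : ℕ} (f : (Fin r → ℂ) → ℂ) (p : Fin r → ℂ) : Prop :=
  ∀ᶠ z in 𝓝 p, DifferentiableAt ℂ f z

/-- `f` is meromorphic at `p`: near `p` it is a quotient `g / h` of holomorphic functions, where
`h` does not vanish identically near `p`. The values of `f` on the zero set of `h` are
arbitrary. -/
def MeromorphicNear {r : ℕ} (f : (Fin r → ℂ) → ℂ) (p : Fin r → ℂ) : Prop :=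
  ∃ g h : (Fin r → ℂ) → ℂ, HolomorphicNear g p ∧ HolomorphicNear h p ∧
    (∃ᶠ z in 𝓝 p, h z ≠ 0) ∧ ∀ᶠ z in 𝓝 p, h z ≠ 0 → f z = g z / h z

/-! ### The multiple zeta-function of generalized Euler-Zagier type -/

/-- The general term `∏_j (m_1 γ_1 + ⋯ + m_j γ_j)^{-s_j}`; the summation indices `m_i ≥ 1` are
written as `m i + 1` with `m i : ℕ`. -/
def ezTerm {r : ℕ} (γ s : Fin r → ℂ) (m : Fin r → ℕ) : ℂ :=
  ∏ j, (∑ i ∈ Finset.Iic j, ((m i : ℂ) + 1) * γ i) ^ (-s j)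

/-- The region of absolute convergence: `Re (s_{r-k+1} + ⋯ + s_r) > k` for `1 ≤ k ≤ r`.
With zero-based indices, the sum that starts at the index `j` has `k = r - j` terms. -/
def ezRegion (r : ℕ) : Set (Fin r → ℂ) :=
  {s | ∀ j : Fin r, (r : ℝ) - (j : ℝ) < (∑ i ∈ Finset.Ici j, s i).re}

/-- `F` is the meromorphic continuation to `ℂ^r` of `s ↦ ζ_r(s; γ)`: it is meromorphic on `ℂ^r`,
and in the region of convergence it is the sum of the (absolutely convergent) series. -/
def IsMultipleZeta {r : ℕ} (γ : Fin r → ℂ) (F : (Fin r → ℂ) → ℂ) : Prop :=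
  (∀ p, MeromorphicNear F p) ∧ ∀ s ∈ ezRegion r, HasSum (ezTerm γ s) (F s)

/-! ### The Hankel contour

The contour comes in from `+∞` along the top side of the positive real axis (where `arg t = 0`)
to `ε`, runs once counterclockwise along the circle of radius `ε`, and goes back to `+∞` along the
bottom side of the axis (where `arg t = 2π`). It is parametrized by `u : ℝ`. -/

/-- The point of the contour at the parameter `u`. -/
def hankelPath (ε u : ℝ) : ℂ :=
  if u < 0 then ((ε - u : ℝ) : ℂ)
  else if u ≤ 2 * Real.pi then (ε : ℂ) * Complex.exp (Complex.I * u)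
  else ((ε + (u - 2 * Real.pi) : ℝ) : ℂ)

/-- The continuous branch of `log t` along the contour. -/
def hankelLog (ε u : ℝ) : ℂ :=
  if u < 0 then ((Real.log (ε - u) : ℝ) : ℂ)
  else if u ≤ 2 * Real.pi then ((Real.log ε : ℝ) : ℂ) + Complex.I * u
  else ((Real.log (ε + (u - 2 * Real.pi)) : ℝ) : ℂ) + 2 * Real.pi * Complex.I

/-- The velocity `dt / du` of the contour (away from its two corners). -/
def hankelVelocity (ε u : ℝ) : ℂ :=
  if u < 0 then -1
  else if u ≤ 2 * Real.pi then Complex.I * ε * Complex.exp (Complex.I * u)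
  else 1

/-! ### The desingularized multiple zeta-function -/

/-- The function `1 / (e^y - 1) - c / (e^{cy} - 1)`, with its removable singularity at `y = 0`
removed: its value there is `(1 - c) B_1 = (c - 1) / 2`. -/
def desKernel (c : ℝ) (y : ℂ) : ℂ :=
  if y = 0 then ((c : ℂ) - 1) / 2
  else 1 / (Complex.exp y - 1) - c / (Complex.exp (c * y) - 1)

/-- The integrand of the integral over the `r`-th power of the Hankel contour, that is
`∏_j desKernel c (γ_j (t_j + ⋯ + t_r)) ∏_k t_k^{s_k - 1} dt_k`, in terms of the parameters `u_k`
of the points `t_k`. -/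
def desIntegrand {r : ℕ} (γ s : Fin r → ℂ) (ε c : ℝ) (u : Fin r → ℝ) : ℂ :=
  (∏ j, desKernel c (γ j * ∑ k ∈ Finset.Ici j, hankelPath ε (u k))) *
    ∏ k, (Complex.exp ((s k - 1) * hankelLog ε (u k)) * hankelVelocity ε (u k))

/-- The factor `1 / ((e^{2πis} - 1) Γ(s))`. It is given by a limit because at `s = 0, -1, -2, …`,
where it has removable singularities, the plain expression is `0 · ∞`. -/
def hankelFactor (s : ℂ) : ℂ :=
  limUnder (𝓝[≠] s) fun w : ℂ =>
    1 / ((Complex.exp (2 * Real.pi * Complex.I * w) - 1) * Complex.Gamma w)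

/-- The expression whose limit as `c → 1` is the desingularized multiple zeta-function. -/
def desApprox {r : ℕ} (γ s : Fin r → ℂ) (ε c : ℝ) : ℂ :=
  (-1) ^ r / ((c : ℂ) - 1) ^ r * (∏ k, hankelFactor (s k)) *
    ∫ u : Fin r → ℝ, desIntegrand γ s ε c u

/-- `Z` is the desingularized multiple zeta-function `s ↦ ζ_r^des(s; γ)`: the entire function on
`ℂ^r` which, for every contour of sufficiently small radius `ε`, is given by the limit as `c → 1`
(`c` real, `c ≠ 1`) at all points `s` where the factors `1 / ((e^{2πi s_k} - 1) Γ(s_k))` are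
finite, that is, where no `s_k` is a positive integer. -/
def IsDesingularizedZeta {r : ℕ} (γ : Fin r → ℂ) (Z : (Fin r → ℂ) → ℂ) : Prop :=
  Differentiable ℂ Z ∧
    ∀ᶠ ε in 𝓝[>] (0 : ℝ), ∀ s : Fin r → ℂ, (∀ k, ∀ n : ℕ, s k ≠ (n : ℂ) + 1) →
      (∀ᶠ c in 𝓝[≠] (1 : ℝ), Integrable (desIntegrand γ s ε c)) ∧
      Tendsto (fun c : ℝ => desApprox γ s ε c) (𝓝[≠] 1) (𝓝 (Z s))

/-! ### The polynomial `𝒢` -/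

/-- The ring `ℤ[u_1, …, u_r, v_1^{±1}, …, v_r^{±1}]`; the exponent pair `(l, m)` stands for the
monomial `∏_j u_j^{l_j} v_j^{m_j}`. -/
abbrev ULaurent (r : ℕ) : Type := AddMonoidAlgebra ℤ ((Fin r → ℕ) × (Fin r → ℤ))

/-- The indeterminate `u_j`. -/
def uVar {r : ℕ} (j : Fin r) : ULaurent r := AddMonoidAlgebra.single (Pi.single j 1, 0) 1

/-- The indeterminate `v_j`. -/
def vVar {r : ℕ} (j : Fin r) : ULaurent r := AddMonoidAlgebra.single (0, Pi.single j 1) 1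

/-- The inverse `v_j^{-1}`. -/
def vInv {r : ℕ} (j : Fin r) : ULaurent r := AddMonoidAlgebra.single (0, Pi.single j (-1)) 1

/-- The inverse `v_{j-1}^{-1}` of the preceding indeterminate, which is `0` for the first
index. -/
def vInvPrev {r : ℕ} (j : Fin r) : ULaurent r :=
  if (j : ℕ) = 0 then 0 else vInv ⟨(j : ℕ) - 1, lt_of_le_of_lt (Nat.sub_le _ _) j.isLt⟩

/-- `𝒢 = ∏_j (1 - (u_j v_j + ⋯ + u_r v_r)(v_j^{-1} - v_{j-1}^{-1}))`. -/
def desPoly (r : ℕ) : ULaurent r :=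
  ∏ j : Fin r, (1 - (∑ k ∈ Finset.Ici j, uVar k * vVar k) * (vInv j - vInvPrev j))

/-- The coefficients `a_{l,m}` of `𝒢`, a finitely supported family of integers. -/
def desCoeff (r : ℕ) : ((Fin r → ℕ) × (Fin r → ℤ)) →₀ ℤ := (desPoly r).coeff

end

/-! Put B(y) = y/(e^y - 1). The kernel with parameter c equals (B(y) - B(cy))/y, so after division
by 1 - c it tends to B'(y) as c → 1. Unlike 1/(e^y - 1), the function B' is holomorphic at 0, and it
still decays exponentially near the half-line. The limit of the Hankel integrals is therefore the
normalised Hankel transform of Φ(t) = ∏_j B'(γ_j(t_j + ⋯ + t_r)). Dominated convergence applies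
because the mean value inequality bounds each kernel by |c - 1| times a decaying exponential,
uniformly in c (`exists_desKernel_bound`, `KernelDecay.integrable_and_tendsto_desApprox`). Where Re
s_k > 0, the k-th Hankel contour may be collapsed onto the half-line with density t^{s_k-1}/Γ(s_k).
Using the Hankel contour in some variables and the half-line in the others covers ℂ^r, and the
pieces glue to an entire function (`StripDecay.differentiable_entireIntegral`).

On the half-lines B'(y) = ∑_{m≥1} (1 - my)e^{-my}. With N_k = m_1γ_1 + ⋯ + m_kγ_k the exponentials
multiply to ∏ e^{-t_kN_k}. Since m_jγ_j = N_j - N_{j-1}, the polynomial factors multiply to ∏_j (1 -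
(t_j + ⋯ + t_r)(N_j - N_{j-1})), which is 𝒢 at u_k = t_kN_k, v_k = N_k⁻¹. A monomial of 𝒢 thus
contributes (t_kN_k)^{l_k} N_k^{-m_k} in the variable t_k, and its normalised Mellin transform is
(s_k)_{l_k} N_k^{-s_k-m_k}. Summing over the m_j gives the asserted combination of shifted
zeta-functions wherever everything converges absolutely (`ctrIntegral_kerLimit_eq`). The identity
theorem for meromorphic functions extends it to ℂ^r
(`eq_zero_of_meromorphicNear_of_eq_zero_on_open`).

The continuation of ζ_r is obtained by induction on r. Summing over the last index and inserting K
Taylor terms of B into the Mellin integral expresses ζ_{r+1} through ζ_r at (s_1, …, s_{r-1}, s_r +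
s_{r+1} - 1 + j), j < K. The remainder series converges in a region that exhausts ℂ^{r+1} as K grows
(`emValue_succ`, `exists_isMultipleZeta_succ`). -/

/-! ### Holomorphic dependence of integrals and sums on parameters -/

theorem norm_fderiv_le_of_bounded_on_ball {r : ℕ} {f : (Fin r → ℂ) → ℂ} {p : Fin r → ℂ} {ρ C : ℝ}
    (hρ : 0 < ρ) (hC : 0 ≤ C) (hf : ∀ s ∈ Metric.ball p ρ, DifferentiableAt ℂ f s)
    (hb : ∀ s ∈ Metric.ball p ρ, ‖f s‖ ≤ C) {s : Fin r → ℂ} (hs : s ∈ Metric.ball p (ρ / 2)) :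
    ‖fderiv ℂ f s‖ ≤ C / (ρ / 4) := by
  have hball : ∀ v : Fin r → ℂ, ‖v‖ ≤ ρ / 4 → s + v ∈ Metric.ball p ρ := by
    intro v hv
    rw [Metric.mem_ball, dist_eq_norm] at hs ⊢
    have : s + v - p = (s - p) + v := by abel
    rw [this]
    linarith [norm_add_le (s - p) v]
  refine ContinuousLinearMap.opNorm_le_bound _ (by positivity) fun v => ?_
  rcases eq_or_ne v 0 with rfl | hv
  · simp
  have hv' : 0 < ‖v‖ := norm_pos_iff.2 hv
  have hsp : ∀ z : ℂ, ‖z‖ ≤ ρ / 4 / ‖v‖ → s + z • v ∈ Metric.ball p ρ := by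
    intro z hz
    apply hball
    rw [norm_smul]
    rwa [le_div_iff₀ hv'] at hz
  have hd : ∀ z : ℂ, ‖z‖ ≤ ρ / 4 / ‖v‖ → HasDerivAt (fun z : ℂ => f (s + z • v))
      (fderiv ℂ f (s + z • v) v) z := by
    intro z hz
    have h1 : HasDerivAt (fun z : ℂ => s + z • v) v z := by
      simpa using ((hasDerivAt_id z).smul_const v).const_add s
    exact (hf _ (hsp z hz)).hasFDerivAt.comp_hasDerivAt z h1
  have hR : 0 < ρ / 4 / ‖v‖ := by positivity
  -- Cauchy's estimate on the complex line through s in the direction v. The disc has radius ρ/4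
  -- measured along v, so it stays in the ball because ρ/2 + ρ/4 < ρ.
  have h := Complex.norm_deriv_le_of_forall_mem_sphere_norm_le (c := 0) (C := C)
    (f := fun z : ℂ => f (s + z • v)) hR ?_ ?_
  · rw [(hd 0 (by simpa using hR.le)).deriv] at h
    simp only [zero_smul, add_zero] at h
    refine h.trans (le_of_eq ?_)
    field_simp
  · apply DifferentiableOn.diffContOnCl
    rw [closure_ball _ hR.ne']
    intro z hz
    exact (hd z (by simpa using hz)).differentiableAt.differentiableWithinAt
  · intro z hz
    exact hb _ (hsp z (by simpa using hz.le))

theorem tendsto_ofReal_one_div_add_one :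
    Tendsto (fun n : ℕ => ((1 / ((n : ℝ) + 1) : ℝ) : ℂ)) atTop (𝓝 0) :=
  (Complex.continuous_ofReal.tendsto' 0 0 Complex.ofReal_zero).comp
    (tendsto_one_div_add_atTop_nhds_zero_nat (𝕜 := ℝ))

/-- No bound on derivatives is needed: Cauchy's estimate turns the majorant g of the integrand into
the majorant g/(ρ/4) of its derivative, and dominated differentiation applies. -/
theorem differentiableAt_integral_of_bounded {r : ℕ} {X : Type*} [MeasurableSpace X]
    {μ : Measure X} {G : (Fin r → ℂ) → X → ℂ} {p : Fin r → ℂ} {ρ : ℝ} (hρ : 0 < ρ) {g : X → ℝ}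
    (hmeas : ∀ s ∈ Metric.ball p ρ, AEStronglyMeasurable (G s) μ)
    (hg : Integrable g μ) (hb : ∀ x, ∀ s ∈ Metric.ball p ρ, ‖G s x‖ ≤ g x)
    (hd : ∀ x, ∀ s ∈ Metric.ball p ρ, DifferentiableAt ℂ (fun s => G s x) s) :
    DifferentiableAt ℂ (fun s => ∫ x, G s x ∂μ) p := by
  have hp : p ∈ Metric.ball p ρ := Metric.mem_ball_self hρ
  have hint : ∀ s ∈ Metric.ball p ρ, Integrable (G s) μ := fun s hs =>
    hg.mono' (hmeas s hs) (Eventually.of_forall fun x => hb x s hs)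
  have hg0 : ∀ x, 0 ≤ g x := fun x => (norm_nonneg _).trans (hb x p hp)
  have hF' : AEStronglyMeasurable (fun x => fderiv ℂ (fun s => G s x) p) μ := by
    have key : ∀ v : Fin r → ℂ,
        AEStronglyMeasurable (fun x => fderiv ℂ (fun s => G s x) p v) μ := by
      intro v
      -- The derivative in the direction v is a pointwise limit of difference quotients with steps
      -- 1/(n+1), hence measurable. The offset n0 discards the steps that leave the ball.
      have hcont : Tendsto (fun n : ℕ => p + ((1 / ((n : ℝ) + 1) : ℝ) : ℂ) • v) atTop (𝓝 p) := by
        simpa only [zero_smul, add_zero] using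
          (tendsto_ofReal_one_div_add_one.smul_const v).const_add p
      obtain ⟨n0, hn0⟩ := eventually_atTop.1 (hcont.eventually (Metric.ball_mem_nhds p hρ))
      refine aestronglyMeasurable_of_tendsto_ae atTop
        (f := fun (n : ℕ) x => ((n + n0 : ℕ) + 1 : ℂ) •
          (G (p + ((1 / (((n + n0 : ℕ) : ℝ) + 1) : ℝ) : ℂ) • v) x - G p x)) ?_ ?_
      · intro n
        exact ((hmeas _ (hn0 (n + n0) (by omega))).sub (hmeas p hp)).const_smul (((n + n0 : ℕ) : ℂ) + 1)
      · refine Eventually.of_forall fun x => ?_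
        have h1 : HasDerivAt (fun z : ℂ => G (p + z • v) x)
            (fderiv ℂ (fun s => G s x) p v) 0 := by
          have h2 : HasDerivAt (fun z : ℂ => p + z • v) v 0 := by
            simpa using ((hasDerivAt_id (0 : ℂ)).smul_const v).const_add p
          have h3 : DifferentiableAt ℂ (fun s => G s x) (p + (0 : ℂ) • v) := by
            simpa using hd x p hp
          have := h3.hasFDerivAt.comp_hasDerivAt (0 : ℂ) h2
          simpa using! this
        have h4 : Tendsto (fun n : ℕ => ((1 / ((n : ℝ) + 1) : ℝ) : ℂ)) atTop (𝓝[≠] 0) := by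
          refine tendsto_nhdsWithin_iff.2
            ⟨tendsto_ofReal_one_div_add_one, Eventually.of_forall fun n => ?_⟩
          · have : ((n : ℝ) + 1) ≠ 0 := by positivity
            simp only [Set.mem_compl_iff, Set.mem_singleton_iff]
            exact_mod_cast one_div_ne_zero this
        have h5 := (h1.tendsto_slope.comp h4).comp (tendsto_add_atTop_nat n0)
        refine h5.congr fun n => ?_
        simp [slope, vsub_eq_sub]
    have hsum : (fun x => fderiv ℂ (fun s => G s x) p) = fun x =>
        ∑ i, (fderiv ℂ (fun s => G s x) p (Pi.single i 1)) •
          (ContinuousLinearMap.proj i : (Fin r → ℂ) →L[ℂ] ℂ) := by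
      funext x
      ext v
      conv_lhs => rw [pi_eq_sum_univ' v, map_sum]
      simp only [map_smul, smul_eq_mul, sum_apply,
        smul_apply, ContinuousLinearMap.proj_apply]
      exact Finset.sum_congr rfl fun i _ => by
        rw [mul_comm]
    rw [hsum]
    refine Finset.aestronglyMeasurable_fun_sum _ fun i _ => ?_
    exact (key _).smul_const _
  exact (hasFDerivAt_integral_of_dominated_of_fderiv_le (μ := μ)
    (F' := fun s x => fderiv ℂ (fun s => G s x) s)
    (bound := fun x => g x / (ρ / 4)) (Metric.ball_mem_nhds p (half_pos hρ))
    (by filter_upwards [Metric.ball_mem_nhds p hρ] with s hs using hmeas s hs) (hint p hp) hF'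
    (Eventually.of_forall fun x s hs =>
      norm_fderiv_le_of_bounded_on_ball hρ (hg0 x) (hd x) (hb x) hs)
    (hg.div_const _)
    (Eventually.of_forall fun x s hs =>
      (hd x s (Metric.ball_subset_ball (by linarith) hs)).hasFDerivAt)).differentiableAt

/-- A series is an integral against counting measure, and for the σ-algebra of all subsets
measurability is automatic. -/
theorem differentiableAt_tsum_of_bounded {r : ℕ} {ι : Type*} [Countable ι]
    {G : (Fin r → ℂ) → ι → ℂ} {p : Fin r → ℂ} {ρ : ℝ} (hρ : 0 < ρ) {g : ι → ℝ}
    (hg : Summable g) (hb : ∀ x, ∀ s ∈ Metric.ball p ρ, ‖G s x‖ ≤ g x)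
    (hd : ∀ x, ∀ s ∈ Metric.ball p ρ, DifferentiableAt ℂ (fun s => G s x) s) :
    DifferentiableAt ℂ (fun s => ∑' x, G s x) p := by
  let _ : MeasurableSpace ι := ⊤
  have hp : p ∈ Metric.ball p ρ := Metric.mem_ball_self hρ
  have hg' : Integrable g (Measure.count : Measure ι) := by
    rw [integrable_count_iff]
    simpa only [Real.norm_of_nonneg ((norm_nonneg _).trans (hb _ p hp))] using! hg
  have h := differentiableAt_integral_of_bounded (μ := (Measure.count : Measure ι)) hρ
    (fun s _ => (measurable_from_top (f := G s)).aestronglyMeasurable) hg' hb hd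
  refine h.congr_of_eventuallyEq ?_
  filter_upwards [Metric.ball_mem_nhds p hρ] with s hs
  rw [integral_countable (hg'.mono' (measurable_from_top (f := G s)).aestronglyMeasurable
    (Eventually.of_forall fun x => hb x s hs))]
  simp [Measure.real]

/-! ### The identity theorem -/

/-- Restrict h to the complex line through v and z. The parameters that land in the ball form a
convex set, so the one-variable identity theorem carries the vanishing from v to z. -/
theorem eq_zero_on_ball_of_eq_zero_on_open {r : ℕ} {h : (Fin r → ℂ) → ℂ} {p : Fin r → ℂ} {ρ : ℝ}
    (hd : ∀ s ∈ Metric.ball p ρ, DifferentiableAt ℂ h s) {v : Fin r → ℂ}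
    (hv : v ∈ Metric.ball p ρ) (h0 : ∀ᶠ z in 𝓝 v, h z = 0) :
    ∀ z ∈ Metric.ball p ρ, h z = 0 := by
  intro z hz
  set φ : ℂ → Fin r → ℂ := fun t => v + t • (z - v) with hφ
  have hφd : Differentiable ℂ φ := by fun_prop
  set U : Set ℂ := φ ⁻¹' Metric.ball p ρ with hU
  have hUo : IsOpen U := Metric.isOpen_ball.preimage hφd.continuous
  have hUc : Convex ℝ U := by
    have hb := convex_ball p ρ
    intro a ha b hb' s t hs ht hst
    have : φ (s • a + t • b) = s • φ a + t • φ b := by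
      have hst' : (s : ℂ) + t = 1 := by exact_mod_cast hst
      funext i
      simp only [hφ, Pi.add_apply, Pi.smul_apply, Pi.sub_apply, smul_eq_mul, Complex.real_smul]
      linear_combination (-(v i)) * hst'
    show φ (s • a + t • b) ∈ Metric.ball p ρ
    rw [this]
    exact hb ha hb' hs ht hst
  have hdiff : DifferentiableOn ℂ (fun t => h (φ t)) U := fun t ht =>
    ((hd _ ht).comp t hφd.differentiableAt).differentiableWithinAt
  have han := hdiff.analyticOnNhd hUo
  have h0U : (0 : ℂ) ∈ U := by simpa [hU, hφ] using hv
  have h1U : (1 : ℂ) ∈ U := by simpa [hU, hφ] using hz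
  have hev : (fun t => h (φ t)) =ᶠ[𝓝 0] 0 := by
    have : Tendsto φ (𝓝 0) (𝓝 v) := by
      have := hφd.continuous.tendsto 0
      simpa [hφ] using this
    exact this.eventually h0
  have := han.eqOn_zero_of_preconnected_of_eventuallyEq_zero hUc.isPreconnected h0U hev h1U
  simpa [hφ] using this

/-! ### Meromorphic functions of several variables -/

/-- The denominator is not identically zero near any point of the ball: vanishing on an open piece
would spread to the centre. -/
theorem MeromorphicNear.exists_ball {r : ℕ} {f : (Fin r → ℂ) → ℂ} {p : Fin r → ℂ}
    (hf : MeromorphicNear f p) : ∃ ρ > 0, ∃ g h : (Fin r → ℂ) → ℂ,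
      (∀ s ∈ Metric.ball p ρ, DifferentiableAt ℂ g s) ∧
      (∀ s ∈ Metric.ball p ρ, DifferentiableAt ℂ h s) ∧
      (∀ s ∈ Metric.ball p ρ, h s ≠ 0 → f s = g s / h s) ∧
      ∀ s ∈ Metric.ball p ρ, ∃ᶠ z in 𝓝 s, h z ≠ 0 := by
  obtain ⟨g, h, hg, hh, hne, heq⟩ := hf
  obtain ⟨ρ, hρ, H⟩ := Metric.eventually_nhds_iff_ball.1 (hg.and (hh.and heq))
  refine ⟨ρ, hρ, g, h, fun s hs => (H s hs).1, fun s hs => (H s hs).2.1,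
    fun s hs => (H s hs).2.2, fun s hs hcon => ?_⟩
  have h0 : ∀ᶠ z in 𝓝 s, h z = 0 := by
    filter_upwards [hcon] with z hz using not_not.1 hz
  have := eq_zero_on_ball_of_eq_zero_on_open (fun s hs => (H s hs).2.1) hs h0
  apply hne
  filter_upwards [Metric.ball_mem_nhds p hρ] with z hz
  exact not_not.2 (this z hz)

theorem HolomorphicNear.meromorphicNear {r : ℕ} {f : (Fin r → ℂ) → ℂ} {p : Fin r → ℂ}
    (hf : HolomorphicNear f p) : MeromorphicNear f p :=
  ⟨f, fun _ => 1, hf, Eventually.of_forall fun _ => differentiableAt_const _,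
    Eventually.frequently (Eventually.of_forall fun _ => one_ne_zero),
    Eventually.of_forall fun _ _ => by simp⟩

/-- The non-zero sets of two holomorphic functions that do not vanish identically meet. -/
theorem frequently_mul_ne_zero {r : ℕ} {h₁ h₂ : (Fin r → ℂ) → ℂ} {p : Fin r → ℂ}
    (hd₁ : HolomorphicNear h₁ p) (hd₂ : HolomorphicNear h₂ p) (hne₁ : ∃ᶠ z in 𝓝 p, h₁ z ≠ 0)
    (hne₂ : ∃ᶠ z in 𝓝 p, h₂ z ≠ 0) : ∃ᶠ z in 𝓝 p, h₁ z * h₂ z ≠ 0 := by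
  obtain ⟨ρ, hρ, H⟩ := Metric.eventually_nhds_iff_ball.1 (hd₁.and hd₂)
  intro hcon
  obtain ⟨ρ', hρ', H'⟩ := Metric.eventually_nhds_iff_ball.1 hcon
  obtain ⟨z, hz1, hz2⟩ := (hne₁.and_eventually
    (Metric.ball_mem_nhds p (lt_min hρ hρ'))).exists
  have hzρ : z ∈ Metric.ball p ρ := Metric.ball_subset_ball (min_le_left _ _) hz2
  have h0 : ∀ᶠ w in 𝓝 z, h₂ w = 0 := by
    have hc : ContinuousAt h₁ z := (H z hzρ).1.continuousAt
    filter_upwards [hc.eventually_ne hz1, Metric.isOpen_ball.mem_nhds hz2] with w hw hw2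
    have := H' w (Metric.ball_subset_ball (min_le_right _ _) hw2)
    rw [not_not, mul_eq_zero] at this
    exact this.resolve_left hw
  have := eq_zero_on_ball_of_eq_zero_on_open (fun s hs => (H s hs).2) hzρ h0
  apply hne₂
  filter_upwards [Metric.ball_mem_nhds p hρ] with z hz using not_not.2 (this z hz)

theorem HolomorphicNear.mul {r : ℕ} {f g : (Fin r → ℂ) → ℂ} {p : Fin r → ℂ}
    (hf : HolomorphicNear f p) (hg : HolomorphicNear g p) :
    HolomorphicNear (fun z => f z * g z) p := by
  filter_upwards [hf, hg] with z h1 h2 using h1.mul h2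

theorem HolomorphicNear.add {r : ℕ} {f g : (Fin r → ℂ) → ℂ} {p : Fin r → ℂ}
    (hf : HolomorphicNear f p) (hg : HolomorphicNear g p) :
    HolomorphicNear (fun z => f z + g z) p := by
  filter_upwards [hf, hg] with z h1 h2 using h1.add h2

theorem MeromorphicNear.mul {r : ℕ} {f₁ f₂ : (Fin r → ℂ) → ℂ} {p : Fin r → ℂ}
    (hf₁ : MeromorphicNear f₁ p) (hf₂ : MeromorphicNear f₂ p) :
    MeromorphicNear (fun z => f₁ z * f₂ z) p := by
  obtain ⟨g₁, h₁, hg₁, hh₁, hn₁, he₁⟩ := hf₁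
  obtain ⟨g₂, h₂, hg₂, hh₂, hn₂, he₂⟩ := hf₂
  refine ⟨_, _, hg₁.mul hg₂, hh₁.mul hh₂, frequently_mul_ne_zero hh₁ hh₂ hn₁ hn₂, ?_⟩
  filter_upwards [he₁, he₂] with z e1 e2 hz
  rw [e1 (left_ne_zero_of_mul hz), e2 (right_ne_zero_of_mul hz), div_mul_div_comm]

theorem MeromorphicNear.add {r : ℕ} {f₁ f₂ : (Fin r → ℂ) → ℂ} {p : Fin r → ℂ}
    (hf₁ : MeromorphicNear f₁ p) (hf₂ : MeromorphicNear f₂ p) :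
    MeromorphicNear (fun z => f₁ z + f₂ z) p := by
  obtain ⟨g₁, h₁, hg₁, hh₁, hn₁, he₁⟩ := hf₁
  obtain ⟨g₂, h₂, hg₂, hh₂, hn₂, he₂⟩ := hf₂
  refine ⟨_, _, (hg₁.mul hh₂).add (hh₁.mul hg₂), hh₁.mul hh₂,
    frequently_mul_ne_zero hh₁ hh₂ hn₁ hn₂, ?_⟩
  filter_upwards [he₁, he₂] with z e1 e2 hz
  rw [e1 (left_ne_zero_of_mul hz), e2 (right_ne_zero_of_mul hz),
    div_add_div _ _ (left_ne_zero_of_mul hz) (right_ne_zero_of_mul hz)]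

theorem MeromorphicNear.sum {r : ℕ} {ι : Type*} (t : Finset ι) {f : ι → (Fin r → ℂ) → ℂ}
    {p : Fin r → ℂ} (hf : ∀ i ∈ t, MeromorphicNear (f i) p) :
    MeromorphicNear (fun z => ∑ i ∈ t, f i z) p := by
  classical
  induction t using Finset.induction_on with
  | empty =>
    simp only [Finset.sum_empty]
    exact HolomorphicNear.meromorphicNear (Eventually.of_forall fun _ => differentiableAt_const _)
  | insert a t ha ih =>
    simp only [Finset.sum_insert ha]
    exact (hf a (Finset.mem_insert_self _ _)).add
      (ih fun i hi => hf i (Finset.mem_insert_of_mem hi))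

theorem MeromorphicNear.congr {r : ℕ} {f g : (Fin r → ℂ) → ℂ} {p : Fin r → ℂ}
    (hf : MeromorphicNear f p) (h : f =ᶠ[𝓝 p] g) : MeromorphicNear g p := by
  obtain ⟨g₁, h₁, hg₁, hh₁, hn₁, he₁⟩ := hf
  refine ⟨g₁, h₁, hg₁, hh₁, hn₁, ?_⟩
  filter_upwards [he₁, h] with z e1 e2 hz
  rw [← e2, e1 hz]

/-- Openness of L is what prevents the pulled-back denominator from vanishing identically. -/
theorem MeromorphicNear.comp {r n : ℕ} {f : (Fin r → ℂ) → ℂ} {L : (Fin n → ℂ) → Fin r → ℂ}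
    {p : Fin n → ℂ} (hf : MeromorphicNear f (L p)) (hL : Differentiable ℂ L) (ho : IsOpenMap L) :
    MeromorphicNear (fun z => f (L z)) p := by
  obtain ⟨g₁, h₁, hg₁, hh₁, hn₁, he₁⟩ := hf
  have ht : Tendsto L (𝓝 p) (𝓝 (L p)) := hL.continuous.tendsto p
  refine ⟨fun z => g₁ (L z), fun z => h₁ (L z), ?_, ?_, ?_, ht.eventually he₁⟩
  · filter_upwards [ht.eventually hg₁] with z hz using hz.comp z (hL z)
  · filter_upwards [ht.eventually hh₁] with z hz using hz.comp z (hL z)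
  · have := hn₁.filter_mono (ho.nhds_le p)
    exact this

theorem isOpen_setOf_holomorphicNear {r : ℕ} (f : (Fin r → ℂ) → ℂ) :
    IsOpen {p | HolomorphicNear f p} := by
  rw [isOpen_iff_mem_nhds]
  intro p hp
  exact (eventually_eventually_nhds.2 hp)

theorem dense_setOf_holomorphicNear {r : ℕ} {f : (Fin r → ℂ) → ℂ}
    (hf : ∀ p, MeromorphicNear f p) : Dense {p | HolomorphicNear f p} := by
  intro p
  rw [mem_closure_iff_frequently]
  obtain ⟨g, h, hg, hh, hn, he⟩ := hf p
  refine (hn.and_eventually ((hg.and hh).and he).eventually_nhds).mono ?_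
  rintro z ⟨hz, hev⟩
  have hc : ContinuousAt h z := hev.self_of_nhds.1.2.continuousAt
  have h1 : ∀ᶠ w in 𝓝 z, f w = g w / h w := by
    filter_upwards [hev, hc.eventually_ne hz] with w hw hne using hw.2 hne
  show ∀ᶠ w in 𝓝 z, DifferentiableAt ℂ f w
  filter_upwards [hev, hc.eventually_ne hz, h1.eventually_nhds] with w hw hne heq
  exact (hw.1.1.mul (hw.1.2.inv hne)).congr_of_eventuallyEq heq

/-- Let W be the set of points near which Q vanishes. Its closure is open: near a limit point of W
write Q = g/h; then g vanishes on an open piece, hence on the whole ball, and Q vanishes near each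
point with h ≠ 0, a dense set. So the closure is everything, and continuity at s concludes. The
closure is used because Q is arbitrary on the zeros of h, so W itself need not be closed. -/
theorem eq_zero_of_meromorphicNear_of_eq_zero_on_open {r : ℕ} {Q : (Fin r → ℂ) → ℂ}
    (hQ : ∀ p, MeromorphicNear Q p) {v : Fin r → ℂ} (hv : ∀ᶠ z in 𝓝 v, Q z = 0)
    {s : Fin r → ℂ} (hs : HolomorphicNear Q s) : Q s = 0 := by
  set W : Set (Fin r → ℂ) := {p | ∀ᶠ z in 𝓝 p, Q z = 0} with hW
  have hopen : IsOpen (closure W) := by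
    rw [isOpen_iff_mem_nhds]
    intro p hp
    obtain ⟨ρ, hρ, g, h, hg, hh, heq, hne⟩ := (hQ p).exists_ball
    have hdense : ∀ z ∈ Metric.ball p ρ, h z ≠ 0 →
        ∀ᶠ w in 𝓝 z, h w ≠ 0 ∧ w ∈ Metric.ball p ρ := by
      intro z hz hz0
      exact ((hh z hz).continuousAt.eventually_ne hz0).and (Metric.isOpen_ball.mem_nhds hz)
    obtain ⟨w, hwW, hwB⟩ : ∃ w ∈ W, w ∈ Metric.ball p ρ := by
      obtain ⟨w, hw, hd⟩ := Metric.mem_closure_iff.1 hp ρ hρ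
      exact ⟨w, hw, by rwa [Metric.mem_ball, dist_comm]⟩
    have hg0 : ∀ z ∈ Metric.ball p ρ, g z = 0 := by
      obtain ⟨w', hw'0, hw'⟩ := ((hne w hwB).and_eventually
        ((show ∀ᶠ z in 𝓝 w, Q z = 0 from hwW).eventually_nhds.and
          (Metric.isOpen_ball.mem_nhds hwB))).exists
      refine eq_zero_on_ball_of_eq_zero_on_open hg hw'.2 ?_
      filter_upwards [hdense w' hw'.2 hw'0, hw'.1] with z hz hQz
      have := heq z hz.2 hz.1
      rw [hQz, eq_comm, div_eq_zero_iff] at this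
      exact this.resolve_right hz.1
    filter_upwards [Metric.ball_mem_nhds p hρ] with z hz
    rw [mem_closure_iff_frequently]
    refine ((hne z hz).and_eventually (Metric.isOpen_ball.mem_nhds hz)).mono ?_
    rintro w ⟨hw0, hwB⟩
    show ∀ᶠ y in 𝓝 w, Q y = 0
    filter_upwards [hdense w hwB hw0] with y hy
    rw [heq y hy.2 hy.1, hg0 y hy.2, zero_div]
  have huniv : closure W = Set.univ :=
    IsClopen.eq_univ ⟨isClosed_closure, hopen⟩ ⟨v, subset_closure hv⟩
  have hsW : s ∈ closure W := by rw [huniv]; trivial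
  by_contra hne
  have hc : ContinuousAt Q s := hs.self_of_nhds.continuousAt
  rw [mem_closure_iff_frequently] at hsW
  obtain ⟨z, hz, hz'⟩ := (hsW.and_eventually (hc.eventually_ne hne)).exists
  exact hz' (show ∀ᶠ y in 𝓝 z, Q y = 0 from hz).self_of_nhds

theorem Differentiable.eq_of_eventuallyEq {r : ℕ} {f g : (Fin r → ℂ) → ℂ}
    (hf : Differentiable ℂ f) (hg : Differentiable ℂ g) {v : Fin r → ℂ} (hv : f =ᶠ[𝓝 v] g) :
    f = g := by
  funext s
  have hd : ∀ p, HolomorphicNear (fun z => f z - g z) p := fun p =>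
    Eventually.of_forall fun z => (hf z).sub (hg z)
  have := eq_zero_of_meromorphicNear_of_eq_zero_on_open (fun p => (hd p).meromorphicNear)
    (v := v) (by filter_upwards [hv] with z hz using sub_eq_zero.2 hz) (hd s)
  exact sub_eq_zero.1 this

/-! ### Sums over `ℕ^r` -/

theorem summable_norm_and_hasSum_pi_prod {𝕜 : Type*} [NormedField 𝕜] [CompleteSpace 𝕜] {r : ℕ}
    (f : Fin r → ℕ → 𝕜) (hf : ∀ j, Summable fun n => ‖f j n‖) :
    (Summable fun m : Fin r → ℕ => ‖∏ j, f j (m j)‖) ∧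
      HasSum (fun m : Fin r → ℕ => ∏ j, f j (m j)) (∏ j, ∑' n, f j n) := by
  induction r with
  | zero =>
    simp only [Finset.univ_eq_empty, Finset.prod_empty]
    exact ⟨Summable.of_finite, by simp⟩
  | succ r ih =>
    obtain ⟨h1, h2⟩ := ih (fun j => f j.succ) fun j => hf j.succ
    have hprod : ∀ x : ℕ × (Fin r → ℕ),
        ∏ j, f j (Fin.consEquiv (fun _ => ℕ) x j) = f 0 x.1 * ∏ j : Fin r, f j.succ (x.2 j) := by
      intro x
      rw [Fin.prod_univ_succ]
      rfl
    have hs := (hf 0).mul_norm h1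
    have h3 := (hf 0).of_norm.hasSum.mul h2 hs.of_norm
    rw [← Fin.prod_univ_succ (fun j => ∑' n, f j n)] at h3
    simp only [← hprod] at hs h3
    exact ⟨(Fin.consEquiv (fun _ : Fin (r + 1) => ℕ)).summable_iff.1 hs,
      (Fin.consEquiv (fun _ : Fin (r + 1) => ℕ)).hasSum_iff.1 h3⟩

/-! ### Tail sums and absolute convergence of the zeta series -/

theorem sum_Ici_succ {M : Type*} [AddCommMonoid M] {r : ℕ} (f : Fin (r + 1) → M) (j : Fin r) :
    ∑ i ∈ Finset.Ici j.succ, f i = ∑ i ∈ Finset.Ici j, f i.succ := by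
  simp only [← Finset.filter_le_eq_Ici, Finset.sum_filter, Fin.sum_univ_succ, Fin.succ_le_succ_iff]
  simp

theorem sum_Ici_zero {M : Type*} [AddCommMonoid M] {r : ℕ} (f : Fin (r + 1) → M) :
    ∑ i ∈ Finset.Ici 0, f i = ∑ i, f i := by
  simp only [← Finset.filter_le_eq_Ici, Finset.sum_filter]
  simp

/-- Summation by parts: the sum combines the tail sums of a with the non-negative increments of L.
The induction splits off the smallest value L 0, which multiplies the full sum. -/
theorem sum_mul_nonneg_of_monotone {r : ℕ} {a L : Fin r → ℝ} (hL : Monotone L)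
    (hL0 : ∀ j, 0 ≤ L j) (ha : ∀ j, 0 ≤ ∑ i ∈ Finset.Ici j, a i) : 0 ≤ ∑ i, a i * L i := by
  induction r with
  | zero => simp
  | succ r ih =>
    have h1 := ih (a := fun i => a i.succ) (L := fun i => L i.succ - L 0)
      (fun i j hij => sub_le_sub_right (hL (Fin.succ_le_succ_iff.2 hij)) _)
      (fun j => sub_nonneg.2 (hL (Fin.zero_le _)))
      (fun j => by rw [← sum_Ici_succ]; exact ha _)
    have h2 := ha 0
    rw [sum_Ici_zero, Fin.sum_univ_succ] at h2
    have h3 := mul_nonneg h2 (hL0 0)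
    rw [Fin.sum_univ_succ]
    have h4 : ∑ i : Fin r, a i.succ * (L i.succ - L 0)
        = ∑ i : Fin r, a i.succ * L i.succ - (∑ i : Fin r, a i.succ) * L 0 := by
      rw [Finset.sum_mul, ← Finset.sum_sub_distrib]
      exact Finset.sum_congr rfl fun i _ => by ring
    rw [h4] at h1
    linarith

/-- `m_1 + ⋯ + m_j`, where the `m_i ≥ 1` are written as `m i + 1`. -/
noncomputable def indexSum {r : ℕ} (m : Fin r → ℕ) (j : Fin r) : ℝ :=
  ∑ i ∈ Finset.Iic j, ((m i : ℝ) + 1)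

/-- `m_1 γ_1 + ⋯ + m_j γ_j`, where the `m_i ≥ 1` are written as `m i + 1`. -/
noncomputable def ezSum {r : ℕ} (γ : Fin r → ℂ) (m : Fin r → ℕ) (j : Fin r) : ℂ :=
  ∑ i ∈ Finset.Iic j, ((m i : ℂ) + 1) * γ i

/-- The real majorant `∏_j (m_1 + ⋯ + m_j)^{-σ_j}`. -/
noncomputable def ezWeight {r : ℕ} (σ : Fin r → ℝ) (m : Fin r → ℕ) : ℝ :=
  ∏ j, indexSum m j ^ (-σ j)

theorem le_indexSum {r : ℕ} (m : Fin r → ℕ) (j : Fin r) : (m j : ℝ) + 1 ≤ indexSum m j :=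
  Finset.single_le_sum (f := fun i => (m i : ℝ) + 1) (fun i _ => by positivity)
    (Finset.mem_Iic.2 le_rfl)

theorem one_le_indexSum {r : ℕ} (m : Fin r → ℕ) (j : Fin r) : 1 ≤ indexSum m j :=
  (le_add_of_nonneg_left (Nat.cast_nonneg _)).trans (le_indexSum m j)

theorem indexSum_pos {r : ℕ} (m : Fin r → ℕ) (j : Fin r) : 0 < indexSum m j :=
  one_pos.trans_le (one_le_indexSum m j)

theorem indexSum_mono {r : ℕ} (m : Fin r → ℕ) : Monotone (indexSum m) := fun _ _ hij =>
  Finset.sum_le_sum_of_subset_of_nonneg (Finset.Iic_subset_Iic.2 hij) fun _ _ _ => by positivity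

theorem ezWeight_nonneg {r : ℕ} (σ : Fin r → ℝ) (m : Fin r → ℕ) : 0 ≤ ezWeight σ m :=
  Finset.prod_nonneg fun j _ => Real.rpow_nonneg (indexSum_pos m j).le _

theorem ezWeight_le_ezWeight {r : ℕ} {σ τ : Fin r → ℝ} (h : ∀ j, τ j ≤ σ j) (m : Fin r → ℕ) :
    ezWeight σ m ≤ ezWeight τ m :=
  Finset.prod_le_prod (fun j _ => Real.rpow_nonneg (indexSum_pos m j).le _) fun j _ =>
    Real.rpow_le_rpow_of_exponent_le (one_le_indexSum m j) (neg_le_neg (h j))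

theorem card_Ici_fin {r : ℕ} (j : Fin r) : ((Finset.Ici j).card : ℝ) = r - j := by
  rw [Fin.card_Ici, Nat.cast_sub j.isLt.le]

/-- The strict inequalities leave room for a δ such that every tail sum of σ dominates that of the
constant exponent 1 + δ. Summation by parts against the increasing sequence log(m_1 + ⋯ + m_j)
replaces σ by 1 + δ, and m_1 + ⋯ + m_j ≥ m_j then separates the variables. -/
theorem summable_ezWeight {r : ℕ} {σ : Fin r → ℝ}
    (hσ : ∀ j : Fin r, (r : ℝ) - j < ∑ i ∈ Finset.Ici j, σ i) : Summable (ezWeight σ) := by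
  obtain ⟨δ, hδ, hδ'⟩ : ∃ δ > 0, ∀ j : Fin r, ((r : ℝ) - j) * (1 + δ) ≤ ∑ i ∈ Finset.Ici j, σ i := by
    have h1 : ∀ᶠ δ in 𝓝[>] (0 : ℝ),
        ∀ j : Fin r, ((r : ℝ) - j) * (1 + δ) < ∑ i ∈ Finset.Ici j, σ i := by
      rw [eventually_all]
      intro j
      have hc : Tendsto (fun δ : ℝ => ((r : ℝ) - j) * (1 + δ)) (𝓝[>] 0) (𝓝 ((r : ℝ) - j)) := by
        have : Continuous fun δ : ℝ => ((r : ℝ) - j) * (1 + δ) := by fun_prop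
        simpa using (this.tendsto 0).mono_left nhdsWithin_le_nhds
      exact hc.eventually (gt_mem_nhds (hσ j))
    obtain ⟨δ, h2, h3⟩ := (h1.and self_mem_nhdsWithin).exists
    exact ⟨δ, h3, fun j => (h2 j).le⟩
  have hs : Summable fun n : ℕ => ‖((n : ℝ) + 1) ^ (-(1 + δ))‖ := by
    have := (summable_nat_add_iff 1).2 (Real.summable_nat_rpow (p := -(1 + δ)) |>.2 (by linarith))
    refine this.congr fun n => ?_
    rw [Real.norm_of_nonneg (by positivity)]
    push_cast
    rfl
  refine Summable.of_nonneg_of_le (ezWeight_nonneg σ) (fun m => ?_)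
    (summable_norm_and_hasSum_pi_prod (fun (_ : Fin r) n => ((n : ℝ) + 1) ^ (-(1 + δ)))
      fun _ => hs).1
  rw [Real.norm_of_nonneg (Finset.prod_nonneg fun j _ => by positivity)]
  have h1 : ezWeight σ m ≤ ezWeight (fun _ => 1 + δ) m := by
    have key := sum_mul_nonneg_of_monotone (a := fun j => σ j - (1 + δ))
      (L := fun j => Real.log (indexSum m j))
      (fun i j hij => Real.log_le_log (indexSum_pos m i) (indexSum_mono m hij))
      (fun j => Real.log_nonneg (one_le_indexSum m j)) (fun j => by
        rw [Finset.sum_sub_distrib, Finset.sum_const, nsmul_eq_mul, card_Ici_fin]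
        exact sub_nonneg.2 (hδ' j))
    simp only [ezWeight, Real.rpow_def_of_pos (indexSum_pos m _), ← Real.exp_sum]
    rw [Real.exp_le_exp, ← sub_nonneg, ← Finset.sum_sub_distrib]
    refine key.trans (le_of_eq (Finset.sum_congr rfl fun j _ => by ring))
  refine h1.trans (Finset.prod_le_prod
    (fun j _ => Real.rpow_nonneg (indexSum_pos m j).le _) fun j _ => ?_)
  exact Real.rpow_le_rpow_of_nonpos (by positivity) (le_indexSum m j) (by linarith)

/-- As Re γ_j > 0, the sums m_1γ_1 + ⋯ + m_jγ_j, in real part and in modulus, are comparable with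
m_1 + ⋯ + m_j. This reduces convergence to the real majorant `ezWeight`. -/
theorem exists_ezSum_bounds {r : ℕ} {γ : Fin r → ℂ} (hγ : ∀ j, 0 < (γ j).re) :
    ∃ C : ℝ, 1 ≤ C ∧ ∀ m j, indexSum m j / C ≤ (ezSum γ m j).re ∧
      ‖ezSum γ m j‖ ≤ C * indexSum m j := by
  obtain ⟨C₁, hC₁⟩ := (Set.finite_range fun j => ‖γ j‖).bddAbove
  obtain ⟨C₂, hC₂⟩ := (Set.finite_range fun j => (γ j).re⁻¹).bddAbove
  set C := max 1 (max C₁ C₂) with hC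
  have hC1 : (1 : ℝ) ≤ C := le_max_left _ _
  have hC0 : 0 < C := one_pos.trans_le hC1
  refine ⟨C, hC1, fun m j => ⟨?_, ?_⟩⟩
  · rw [ezSum, indexSum, Complex.re_sum, Finset.sum_div]
    refine Finset.sum_le_sum fun i _ => ?_
    have h1 : (γ i).re⁻¹ ≤ C :=
      (hC₂ ⟨i, rfl⟩).trans ((le_max_right _ _).trans (le_max_right _ _))
    have h2 : C⁻¹ ≤ (γ i).re := inv_le_of_inv_le₀ (hγ i) h1
    have h3 : (((m i : ℂ) + 1) * γ i).re = ((m i : ℝ) + 1) * (γ i).re := by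
      have := Complex.re_ofReal_mul ((m i : ℝ) + 1) (γ i)
      push_cast at this
      exact this
    rw [h3, div_eq_mul_inv]
    gcongr
  · rw [ezSum, indexSum, Finset.mul_sum]
    refine (norm_sum_le _ _).trans (Finset.sum_le_sum fun i _ => ?_)
    have h1 : ‖γ i‖ ≤ C := (hC₁ ⟨i, rfl⟩).trans ((le_max_left _ _).trans (le_max_right _ _))
    have h3 : ‖(m i : ℂ) + 1‖ = (m i : ℝ) + 1 := by
      have := Complex.norm_of_nonneg (r := (m i : ℝ) + 1) (by positivity)
      push_cast at this
      exact this
    rw [norm_mul, h3, mul_comm]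
    gcongr

theorem ezSum_re_pos {r : ℕ} {γ : Fin r → ℂ} (hγ : ∀ j, 0 < (γ j).re) (m : Fin r → ℕ)
    (j : Fin r) : 0 < (ezSum γ m j).re := by
  obtain ⟨C, hC, h⟩ := exists_ezSum_bounds hγ
  exact (div_pos (indexSum_pos m j) (one_pos.trans_le hC)).trans_le (h m j).1

theorem rpow_neg_le_of_comparable {x M C σ A : ℝ} (hC : 1 ≤ C) (hM : 0 < M) (h1 : M / C ≤ x)
    (h2 : x ≤ C * M) (hσ : |σ| ≤ A) : x ^ (-σ) ≤ C ^ A * M ^ (-σ) := by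
  have hC0 : 0 < C := one_pos.trans_le hC
  have hx : 0 < x := (div_pos hM hC0).trans_le h1
  have h3 : (x / M) ^ (-σ) ≤ C ^ A := by
    rcases le_or_gt 0 σ with h | h
    · rw [abs_of_nonneg h] at hσ
      rw [← inv_inv (x / M), Real.inv_rpow (by positivity), Real.rpow_neg (by positivity), inv_inv]
      refine (Real.rpow_le_rpow (by positivity) ?_ h).trans
        (Real.rpow_le_rpow_of_exponent_le hC hσ)
      rw [inv_div, div_le_iff₀ hx]
      rw [div_le_iff₀ hC0] at h1
      linarith
    · rw [abs_of_neg h] at hσ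
      refine (Real.rpow_le_rpow (by positivity) ?_ (by linarith)).trans
        (Real.rpow_le_rpow_of_exponent_le hC hσ)
      rwa [div_le_iff₀ hM]
  rw [Real.div_rpow hx.le hM.le, div_le_iff₀ (Real.rpow_pos_of_pos hM _)] at h3
  exact h3

theorem exists_norm_ezSum_cpow_le {r : ℕ} {γ : Fin r → ℂ} (hγ : ∀ j, 0 < (γ j).re) (A : ℝ) :
    ∃ C : ℝ, 0 < C ∧ ∀ m j, ∀ z : ℂ, ‖z‖ ≤ A →
      ‖ezSum γ m j ^ (-z)‖ ≤ C * indexSum m j ^ (-z.re) := by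
  obtain ⟨C, hC, h⟩ := exists_ezSum_bounds hγ
  have hC0 : 0 < C := one_pos.trans_le hC
  refine ⟨C ^ A * Real.exp (Real.pi * A), by positivity, fun m j z hz => ?_⟩
  have h1 := Complex.norm_cpow_le (ezSum γ m j) (-z)
  have h2 := rpow_neg_le_of_comparable hC (indexSum_pos m j)
    ((h m j).1.trans (Complex.re_le_norm _)) (h m j).2 ((Complex.abs_re_le_norm z).trans hz)
  rw [div_eq_mul_inv, ← Real.exp_neg] at h1
  -- The modulus of a complex power has the extra factor e^{-arg · Im}, at most e^{πA} for the
  -- principal argument.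
  have h3 : -((ezSum γ m j).arg * (-z).im) ≤ Real.pi * A := by
    refine (le_abs_self _).trans ?_
    rw [abs_neg, abs_mul, Complex.neg_im, abs_neg]
    exact mul_le_mul (Complex.abs_arg_le_pi _) ((Complex.abs_im_le_norm z).trans hz)
      (abs_nonneg _) Real.pi_pos.le
  calc _ ≤ _ := h1
    _ ≤ (C ^ A * indexSum m j ^ (-z.re)) * Real.exp (Real.pi * A) := by
      rw [Complex.neg_re]
      exact mul_le_mul h2 (Real.exp_le_exp.2 h3) (Real.exp_pos _).le
        (mul_nonneg (by positivity) (Real.rpow_nonneg (indexSum_pos m j).le _))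
    _ = _ := by ring

theorem exists_norm_ezTerm_le {r : ℕ} {γ : Fin r → ℂ} (hγ : ∀ j, 0 < (γ j).re) (A : ℝ) :
    ∃ C : ℝ, 0 < C ∧ ∀ s m, (∀ j, ‖s j‖ ≤ A) →
      ‖ezTerm γ s m‖ ≤ C * ezWeight (fun j => (s j).re) m := by
  obtain ⟨C, hC, h⟩ := exists_norm_ezSum_cpow_le hγ A
  refine ⟨C ^ r, by positivity, fun s m hs => ?_⟩
  calc ‖ezTerm γ s m‖ = ∏ j, ‖ezSum γ m j ^ (-s j)‖ := norm_prod _ _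
    _ ≤ ∏ j, (C * indexSum m j ^ (-(s j).re)) :=
      Finset.prod_le_prod (fun _ _ => norm_nonneg _) fun j _ => h m j _ (hs j)
    _ = _ := by simp [Finset.prod_mul_distrib, ezWeight]

theorem summable_norm_ezTerm {r : ℕ} {γ : Fin r → ℂ} (hγ : ∀ j, 0 < (γ j).re) {s : Fin r → ℂ}
    (hs : s ∈ ezRegion r) : Summable fun m => ‖ezTerm γ s m‖ := by
  obtain ⟨C, hC, h⟩ := exists_norm_ezTerm_le hγ ‖s‖
  refine Summable.of_nonneg_of_le (fun _ => norm_nonneg _)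
    (fun m => h s m fun j => norm_le_pi_norm s j) (Summable.mul_left _ (summable_ezWeight ?_))
  intro j
  have := hs j
  rwa [Complex.re_sum] at this

/-! ### The generating function of the Bernoulli numbers -/

/-- The entire function `(e^z - 1) / z`. -/
noncomputable def expQuot : ℂ → ℂ := dslope Complex.exp 0

/-- The generating function `z / (e^z - 1)` of the Bernoulli numbers. -/
noncomputable def bernGen (z : ℂ) : ℂ := (expQuot z)⁻¹

/-- The limit `d/dz (z / (e^z - 1))` of the kernels, up to sign. -/
noncomputable def limKernel : ℂ → ℂ := deriv bernGen

theorem expQuot_of_ne {z : ℂ} (hz : z ≠ 0) : expQuot z = (Complex.exp z - 1) / z := by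
  rw [expQuot, dslope_of_ne _ hz, slope_def_field]
  simp

theorem expQuot_zero : expQuot 0 = 1 := by
  rw [expQuot, dslope_same]
  simp [Complex.deriv_exp]

theorem expQuot_mul (z : ℂ) : z * expQuot z = Complex.exp z - 1 := by
  rcases eq_or_ne z 0 with rfl | hz
  · simp
  · rw [expQuot_of_ne hz, mul_div_cancel₀ _ hz]

theorem differentiable_expQuot : Differentiable ℂ expQuot := by
  rw [← differentiableOn_univ]
  exact (Complex.differentiableOn_dslope univ_mem).2 Complex.differentiable_exp.differentiableOn

theorem bernGen_of_ne {z : ℂ} (hz : z ≠ 0) : bernGen z = z / (Complex.exp z - 1) := by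
  rw [bernGen, expQuot_of_ne hz, inv_div]

theorem isOpen_expQuot_ne_zero : IsOpen {z | expQuot z ≠ 0} :=
  isOpen_ne.preimage differentiable_expQuot.continuous

theorem differentiableOn_bernGen : DifferentiableOn ℂ bernGen {z | expQuot z ≠ 0} := fun z hz =>
  ((differentiable_expQuot z).inv hz).differentiableWithinAt

theorem hasDerivAt_bernGen {z : ℂ} (hz : expQuot z ≠ 0) : HasDerivAt bernGen (limKernel z) z :=
  (differentiableOn_bernGen.differentiableAt (isOpen_expQuot_ne_zero.mem_nhds hz)).hasDerivAt

theorem differentiableAt_limKernel {z : ℂ} (hz : expQuot z ≠ 0) :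
    DifferentiableAt ℂ limKernel z :=
  (differentiableOn_bernGen.deriv isOpen_expQuot_ne_zero).differentiableAt
    (isOpen_expQuot_ne_zero.mem_nhds hz)

theorem expQuot_ne_zero_of_ne {z : ℂ} (hz : Complex.exp z ≠ 1) : expQuot z ≠ 0 := by
  intro h
  have := expQuot_mul z
  rw [h, mul_zero, eq_comm, sub_eq_zero] at this
  exact hz this

theorem exp_ne_one_of_re_pos {z : ℂ} (hz : 0 < z.re) : Complex.exp z ≠ 1 := by
  intro h
  have := congrArg norm h
  rw [Complex.norm_exp, norm_one, Real.exp_eq_one_iff] at this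
  exact hz.ne' this

theorem expQuot_ne_zero_of_norm_lt {z : ℂ} (hz : ‖z‖ < 2 * Real.pi) : expQuot z ≠ 0 := by
  rcases eq_or_ne z 0 with rfl | h0
  · rw [expQuot_zero]; exact one_ne_zero
  refine expQuot_ne_zero_of_ne fun h => ?_
  obtain ⟨n, hn⟩ := Complex.exp_eq_one_iff.1 h
  rcases eq_or_ne n 0 with rfl | hn0
  · simp at hn; exact h0 hn
  have h1 : (1 : ℝ) ≤ |(n : ℝ)| := by exact_mod_cast Int.one_le_abs hn0
  have h2 : ‖z‖ = |(n : ℝ)| * (2 * Real.pi) := by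
    rw [hn]
    simp [abs_of_pos Real.pi_pos]
  nlinarith [Real.pi_pos]

theorem limKernel_of_ne {z : ℂ} (hz : z ≠ 0) (hz' : Complex.exp z ≠ 1) :
    limKernel z = 1 / (Complex.exp z - 1) - z * Complex.exp z / (Complex.exp z - 1) ^ 2 := by
  have h0 : Complex.exp z - 1 ≠ 0 := sub_ne_zero.2 hz'
  have h1 : HasDerivAt (fun z => z / (Complex.exp z - 1))
      ((1 * (Complex.exp z - 1) - z * Complex.exp z) / (Complex.exp z - 1) ^ 2) z :=
    (hasDerivAt_id z).div ((Complex.hasDerivAt_exp z).sub_const 1) h0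
  have h2 : bernGen =ᶠ[𝓝 z] fun z => z / (Complex.exp z - 1) := by
    filter_upwards [isOpen_ne.mem_nhds hz] with w hw using bernGen_of_ne hw
  rw [limKernel, h2.deriv_eq, h1.deriv]
  field_simp

/-- This is the value prescribed for the kernel at 0: (c - 1)/2 divided by 1 - c is also -1/2, so
the limit c → 1 needs no exception at y = 0. -/
theorem limKernel_zero : limKernel 0 = -1 / 2 := by
  have hd := differentiable_expQuot
  have hd' : Differentiable ℂ (deriv expQuot) := by
    rw [← differentiableOn_univ]
    exact hd.differentiableOn.deriv isOpen_univ
  -- Differentiating z · (e^z - 1)/z = e^z - 1 once gives this identity; a second derivative at 0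
  -- gives the value 1/2 below.
  have h1 : ∀ z, expQuot z + z * deriv expQuot z = Complex.exp z := by
    intro z
    have h2 : HasDerivAt (fun z => z * expQuot z) (1 * expQuot z + z * deriv expQuot z) z :=
      (hasDerivAt_id z).mul (hd z).hasDerivAt
    simp only [expQuot_mul] at h2
    rw [one_mul] at h2
    exact h2.unique ((Complex.hasDerivAt_exp z).sub_const 1)
  have h3 : deriv expQuot 0 = 1 / 2 := by
    have h2 : HasDerivAt (fun z => expQuot z + z * deriv expQuot z)
        (deriv expQuot 0 + (1 * deriv expQuot 0 + 0 * deriv (deriv expQuot) 0)) 0 :=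
      (hd 0).hasDerivAt.add ((hasDerivAt_id 0).mul (hd' 0).hasDerivAt)
    simp only [h1] at h2
    have := h2.unique (Complex.hasDerivAt_exp 0)
    rw [Complex.exp_zero] at this
    linear_combination this / 2
  have h4 : HasDerivAt bernGen (-deriv expQuot 0 / expQuot 0 ^ 2) 0 :=
    (hd 0).hasDerivAt.inv (by rw [expQuot_zero]; exact one_ne_zero)
  rw [limKernel, h4.deriv, h3, expQuot_zero]
  norm_num

theorem desKernel_of_ne {c : ℝ} (hc : c ≠ 0) {y : ℂ} (hy : y ≠ 0) :
    desKernel c y = (bernGen y - bernGen (c * y)) / y := by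
  have hc' : (c : ℂ) ≠ 0 := by exact_mod_cast hc
  rw [desKernel, if_neg hy, bernGen_of_ne hy, bernGen_of_ne (mul_ne_zero hc' hy)]
  field_simp

/-- For y ≠ 0 the quotient is 1/y times the difference quotient at c = 1 of c ↦ B(cy), B being
`bernGen`; its limit is y B'(y)/y. -/
theorem tendsto_desKernel {y : ℂ} (hy : expQuot y ≠ 0) :
    Tendsto (fun c : ℝ => -desKernel c y / ((c : ℂ) - 1)) (𝓝[≠] 1) (𝓝 (limKernel y)) := by
  rcases eq_or_ne y 0 with rfl | h0
  · rw [limKernel_zero]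
    refine tendsto_const_nhds.congr' ?_
    filter_upwards [self_mem_nhdsWithin] with c hc
    have : (c : ℂ) - 1 ≠ 0 := by
      rw [sub_ne_zero]; exact_mod_cast hc
    rw [desKernel, if_pos rfl]
    field_simp
  · have h1 : HasDerivAt (fun c : ℝ => bernGen (c * y)) (limKernel y * y) 1 := by
      have h2 : HasDerivAt (fun c : ℂ => c * y) y 1 := by
        simpa using (hasDerivAt_id (1 : ℂ)).mul_const y
      have h3 : HasDerivAt (fun c : ℂ => bernGen (c * y)) (limKernel y * y) ((1 : ℝ) : ℂ) := by
        rw [Complex.ofReal_one]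
        refine HasDerivAt.comp (h₂ := bernGen) (1 : ℂ) ?_ h2
        rw [one_mul]
        exact hasDerivAt_bernGen hy
      exact h3.comp_ofReal
    have h4 := (hasDerivAt_iff_tendsto_slope.1 h1).div_const y
    rw [mul_div_cancel_right₀ _ h0] at h4
    refine h4.congr' ?_
    filter_upwards [self_mem_nhdsWithin,
      mem_nhdsWithin_of_mem_nhds (isOpen_ne.mem_nhds (one_ne_zero (α := ℝ)))] with c hc hc0
    have : (c : ℂ) - 1 ≠ 0 := by
      rw [sub_ne_zero]; exact_mod_cast hc
    rw [desKernel_of_ne hc0 h0, slope_def_module]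
    simp only [Complex.real_smul, Complex.ofReal_inv, Complex.ofReal_sub, Complex.ofReal_one,
      one_mul]
    field_simp
    ring

/-! ### Exponential decay of the kernels near the half-line -/

/-- A neighbourhood of the half-line `[0, ∞)`. -/
def halfStrip (η : ℝ) : Set ℂ := {T | -η < T.re ∧ |T.im| < η}

theorem halfStrip_mono {η η' : ℝ} (h : η ≤ η') : halfStrip η ⊆ halfStrip η' := fun _ hT =>
  ⟨(neg_le_neg h).trans_lt hT.1, hT.2.trans_le h⟩

theorem isOpen_halfStrip (η : ℝ) : IsOpen (halfStrip η) :=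
  (isOpen_lt continuous_const Complex.continuous_re).inter
    (isOpen_lt (continuous_abs.comp Complex.continuous_im) continuous_const)

theorem exp_re_sub_one_le_norm (z : ℂ) : Real.exp z.re - 1 ≤ ‖Complex.exp z - 1‖ := by
  have := norm_sub_norm_le (Complex.exp z) 1
  rwa [Complex.norm_exp, norm_one] at this

theorem norm_limKernel_le {d : ℝ} (hd : 0 < d) {z : ℂ} (hz : d ≤ z.re) :
    ‖limKernel z‖ ≤ (1 + ‖z‖) * ((1 - Real.exp (-d))⁻¹ ^ 2) * Real.exp (-z.re) := by
  have hz0 : 0 < z.re := hd.trans_le hz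
  have hz1 : z ≠ 0 := fun h => by simp [h] at hz0
  have hz2 := exp_ne_one_of_re_pos hz0
  set q := 1 - Real.exp (-d) with hq
  have hq0 : 0 < q := by
    rw [hq, sub_pos, Real.exp_lt_one_iff]
    linarith
  have hq1 : q ≤ 1 := by rw [hq]; linarith [Real.exp_pos (-d)]
  have hlow : q * Real.exp z.re ≤ ‖Complex.exp z - 1‖ := by
    refine le_trans ?_ (exp_re_sub_one_le_norm z)
    have : 1 ≤ Real.exp (-d) * Real.exp z.re := by
      rw [← Real.exp_add]
      exact Real.one_le_exp (by linarith)
    rw [hq]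
    linarith
  have hpos : 0 < q * Real.exp z.re := by positivity
  rw [limKernel_of_ne hz1 hz2]
  have h1 : ‖1 / (Complex.exp z - 1)‖ ≤ q⁻¹ ^ 2 * Real.exp (-z.re) := by
    rw [norm_div, norm_one, one_div, Real.exp_neg]
    refine (inv_anti₀ hpos hlow).trans ?_
    rw [mul_inv]
    gcongr
    exact le_self_pow₀ ((one_le_inv₀ hq0).2 hq1) two_ne_zero
  have h2 : ‖z * Complex.exp z / (Complex.exp z - 1) ^ 2‖ ≤
      ‖z‖ * (q⁻¹ ^ 2 * Real.exp (-z.re)) := by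
    rw [norm_div, norm_mul, norm_pow, Complex.norm_exp]
    calc ‖z‖ * Real.exp z.re / ‖Complex.exp z - 1‖ ^ 2
        ≤ ‖z‖ * Real.exp z.re / (q * Real.exp z.re) ^ 2 := by gcongr
      _ = _ := by
        rw [Real.exp_neg]
        field_simp
  calc _ ≤ _ := norm_sub_le _ _
    _ ≤ _ := add_le_add h1 h2
    _ = _ := by ring

/-- For Re T < x₀ one has |γT| ≤ 1, and compactness suffices. For Re T ≥ x₀ the width η is chosen
with |γ|η = bx₀, b = Re γ / 2, so that Im T costs at most half of Re γ · Re T and Re(γT) ≥ b Re T.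
Half of the remaining rate b absorbs the factor 1 + |γT|. -/
theorem exists_limKernel_bound {γ : ℂ} (hγ : 0 < γ.re) : ∃ η C a : ℝ, 0 < η ∧ 0 < C ∧ 0 < a ∧
    ∀ T ∈ halfStrip η, expQuot (γ * T) ≠ 0 ∧ ‖limKernel (γ * T)‖ ≤ C * Real.exp (-a * T.re) := by
  have hγ0 : 0 < ‖γ‖ := hγ.trans_le (Complex.re_le_norm γ)
  obtain ⟨C₀, hC₀⟩ := (isCompact_closedBall (0 : ℂ) 1).exists_bound_of_continuousOn
    (f := limKernel) fun z hz => (differentiableAt_limKernel (expQuot_ne_zero_of_norm_lt (by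
      rw [mem_closedBall_zero_iff] at hz
      linarith [Real.pi_gt_three]))).continuousAt.continuousWithinAt
  have hC₀0 : 0 ≤ C₀ := (norm_nonneg _).trans (hC₀ 0 (by simp))
  set b := γ.re / 2 with hb
  set x₀ := 1 / (2 * ‖γ‖) with hx₀
  have hb0 : 0 < b := by positivity
  have hx₀0 : 0 < x₀ := by positivity
  set η := b * x₀ / ‖γ‖ with hη
  have hη0 : 0 < η := by positivity
  have hγη : ‖γ‖ * η = b * x₀ := by rw [hη]; field_simp
  have hγx : ‖γ‖ * x₀ = 1 / 2 := by rw [hx₀]; field_simp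
  have hbγ : b ≤ ‖γ‖ / 2 := by rw [hb]; linarith [Complex.re_le_norm γ]
  have hηx : η ≤ x₀ := by
    rw [hη, div_le_iff₀ hγ0, mul_comm]
    exact mul_le_mul_of_nonneg_left (by linarith) hx₀0.le
  set q := (1 - Real.exp (-(b * x₀)))⁻¹ ^ 2 with hq
  have hq0 : 0 < q := by
    have : 0 < 1 - Real.exp (-(b * x₀)) := by
      rw [sub_pos, Real.exp_lt_one_iff]
      have := mul_pos hb0 hx₀0
      linarith
    positivity
  refine ⟨η, max ((C₀ + 1) * Real.exp (b / 2 * x₀)) ((1 + 4 * ‖γ‖ / b) * q), b / 2, hη0, ?_,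
    by positivity, fun T hT => ?_⟩
  · exact lt_max_of_lt_left (by positivity)
  obtain ⟨hT1, hT2⟩ := hT
  have hnorm : ‖γ * T‖ ≤ ‖γ‖ * (|T.re| + |T.im|) := by
    rw [norm_mul]
    gcongr
    exact Complex.norm_le_abs_re_add_abs_im T
  rcases lt_or_ge T.re x₀ with h | h
  · have h1 : ‖γ * T‖ ≤ 1 := by
      have h2 : |T.re| ≤ x₀ := abs_le.2 ⟨by linarith, h.le⟩
      calc _ ≤ _ := hnorm
        _ ≤ ‖γ‖ * (x₀ + x₀) := by gcongr; linarith
        _ = 1 := by linarith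
    refine ⟨expQuot_ne_zero_of_norm_lt (by linarith [Real.pi_gt_three]), ?_⟩
    have h3 : 1 ≤ Real.exp (b / 2 * x₀) * Real.exp (-(b / 2) * T.re) := by
      rw [← Real.exp_add]
      apply Real.one_le_exp
      nlinarith
    calc ‖limKernel (γ * T)‖ ≤ C₀ := hC₀ _ (by simpa using h1)
      _ ≤ (C₀ + 1) * (Real.exp (b / 2 * x₀) * Real.exp (-(b / 2) * T.re)) := by nlinarith
      _ = ((C₀ + 1) * Real.exp (b / 2 * x₀)) * Real.exp (-(b / 2) * T.re) := by ring
      _ ≤ _ := by gcongr; exact le_max_left _ _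
  · have hT0 : 0 < T.re := hx₀0.trans_le h
    have hre : b * T.re ≤ (γ * T).re := by
      rw [Complex.mul_re]
      have h1 : γ.im * T.im ≤ ‖γ‖ * η := by
        refine (le_abs_self _).trans ?_
        rw [abs_mul]
        exact mul_le_mul (Complex.abs_im_le_norm γ) hT2.le (abs_nonneg _) hγ0.le
      have h2 : b * x₀ ≤ b * T.re := by gcongr
      have h3 : γ.re = 2 * b := by rw [hb]; ring
      rw [h3]
      linarith
    have hd : b * x₀ ≤ (γ * T).re := le_trans (by gcongr) hre
    refine ⟨expQuot_ne_zero_of_ne (exp_ne_one_of_re_pos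
      ((mul_pos hb0 hx₀0).trans_le hd)), ?_⟩
    have h1 := norm_limKernel_le (mul_pos hb0 hx₀0) hd
    have h2 : ‖γ * T‖ ≤ 2 * ‖γ‖ * T.re := by
      refine hnorm.trans ?_
      rw [abs_of_pos hT0]
      nlinarith
    have h3 : 1 + ‖γ * T‖ ≤ (1 + 4 * ‖γ‖ / b) * Real.exp (b / 2 * T.re) := by
      have h4 : 1 ≤ Real.exp (b / 2 * T.re) := Real.one_le_exp (by positivity)
      have h5 : b / 2 * T.re ≤ Real.exp (b / 2 * T.re) := by
        linarith [Real.add_one_le_exp (b / 2 * T.re)]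
      have h6 : 2 * ‖γ‖ * T.re = 4 * ‖γ‖ / b * (b / 2 * T.re) := by field_simp; ring
      rw [add_mul, one_mul]
      refine add_le_add h4 (h2.trans ?_)
      rw [h6]
      gcongr
    calc ‖limKernel (γ * T)‖ ≤ (1 + ‖γ * T‖) * q * Real.exp (-(γ * T).re) := h1
      _ ≤ ((1 + 4 * ‖γ‖ / b) * Real.exp (b / 2 * T.re)) * q * Real.exp (-(b * T.re)) := by
        gcongr
      _ = ((1 + 4 * ‖γ‖ / b) * q) * (Real.exp (b / 2 * T.re) * Real.exp (-(b * T.re))) := by ring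
      _ = ((1 + 4 * ‖γ‖ / b) * q) * Real.exp (-(b / 2) * T.re) := by
        rw [← Real.exp_add]; congr 2; ring
      _ ≤ _ := by gcongr; exact le_max_right _ _

theorem smul_mem_halfStrip {η τ : ℝ} (h0 : 0 < τ) (h2 : τ ≤ 2) {T : ℂ}
    (hT : T ∈ halfStrip (η / 2)) : (τ : ℂ) * T ∈ halfStrip η := by
  obtain ⟨h3, h4⟩ := hT
  have h5 : 0 ≤ |T.im| := abs_nonneg _
  refine ⟨?_, ?_⟩
  · rw [Complex.re_ofReal_mul]; nlinarith
  · rw [Complex.im_ofReal_mul, abs_mul, abs_of_pos h0]; nlinarith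

/-- The mean value inequality for τ ↦ B(τγT) on [1/2, 2] bounds B(y) - B(cy) by |c - 1| |y| sup
|B'(τy)|, and the division by y in the kernel cancels |y|. The strip and the decay rate are halved
because τ ranges up to 2 and down to 1/2. -/
theorem exists_desKernel_bound {γ : ℂ} (hγ : 0 < γ.re) : ∃ η C a : ℝ, 0 < η ∧ 0 < C ∧ 0 < a ∧
    (∀ T ∈ halfStrip η, expQuot (γ * T) ≠ 0 ∧
      ‖limKernel (γ * T)‖ ≤ C * Real.exp (-a * T.re)) ∧
    ∀ T ∈ halfStrip η, ∀ c ∈ Set.Icc (1 / 2 : ℝ) 2,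
      ‖desKernel c (γ * T)‖ ≤ |c - 1| * (C * Real.exp (-a * T.re)) := by
  obtain ⟨η, C, a, hη, hC, ha, H⟩ := exists_limKernel_bound hγ
  have hle : ∀ x : ℝ, -η / 2 < x → ∀ τ ∈ Set.Icc (1 / 2 : ℝ) 2,
      C * Real.exp (-a * (τ * x)) ≤ (C * Real.exp (a * η) + 1) * Real.exp (-(a / 2) * x) := by
    intro x hx τ hτ
    have h1 : Real.exp (-a * (τ * x)) ≤ Real.exp (a * η) * Real.exp (-(a / 2) * x) := by
      rw [← Real.exp_add, Real.exp_le_exp]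
      have h2 : 0 ≤ a * (η + (τ - 1 / 2) * x) := by
        refine mul_nonneg ha.le ?_
        rcases le_or_gt 0 x with h | h
        · nlinarith [hτ.1, mul_nonneg (sub_nonneg.2 hτ.1) h]
        · nlinarith [hτ.1, hτ.2]
      linarith
    calc _ ≤ C * (Real.exp (a * η) * Real.exp (-(a / 2) * x)) := by gcongr
      _ ≤ _ := by nlinarith [Real.exp_pos (-(a / 2) * x)]
  refine ⟨η / 2, C * Real.exp (a * η) + 1, a / 2, by positivity, by positivity, by positivity,
    fun T hT => ⟨(H T (halfStrip_mono (by linarith) hT)).1, ?_⟩, fun T hT c hc => ?_⟩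
  · have := hle T.re (by linarith [hT.1]) 1 (by norm_num)
    rw [one_mul] at this
    exact (H T (halfStrip_mono (by linarith) hT)).2.trans this
  · rcases eq_or_ne (γ * T) 0 with h0 | h0
    · have hT0 : T = 0 := by
        rcases mul_eq_zero.1 h0 with h | h
        · rw [h] at hγ; simp at hγ
        · exact h
      rw [h0, hT0, desKernel, if_pos rfl, norm_div]
      have h1 : ‖(c : ℂ) - 1‖ = |c - 1| := by
        rw [← Complex.ofReal_one, ← Complex.ofReal_sub, Complex.norm_real, Real.norm_eq_abs]
      -- Since B'(0) = -1/2, the bound at T = 0 says 1/2 ≤ C, which covers the exceptional value (c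
      -- - 1)/2 of the kernel.
      have h2 := (H 0 ⟨by simpa using hη, by simpa using hη⟩).2
      rw [mul_zero, limKernel_zero] at h2
      simp at h2
      have h3 : 1 ≤ Real.exp (a * η) := Real.one_le_exp (by positivity)
      rw [h1]
      simp only [Complex.norm_ofNat, Complex.zero_re, mul_zero, Real.exp_zero, mul_one]
      rw [div_eq_mul_inv]
      gcongr
      nlinarith
    · have hder : ∀ τ ∈ Set.Icc (1 / 2 : ℝ) 2, HasDerivWithinAt
          (fun τ : ℝ => bernGen (τ * (γ * T))) (limKernel (τ * (γ * T)) * (γ * T))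
          (Set.Icc (1 / 2 : ℝ) 2) τ := by
        intro τ hτ
        have hE : expQuot ((τ : ℂ) * (γ * T)) ≠ 0 := by
          rw [mul_left_comm]
          exact (H _ (smul_mem_halfStrip (by linarith [hτ.1]) hτ.2 hT)).1
        have h2 : HasDerivAt (fun c : ℂ => c * (γ * T)) (γ * T) τ := by
          simpa using (hasDerivAt_id (τ : ℂ)).mul_const (γ * T)
        exact (HasDerivAt.comp (h₂ := bernGen) (τ : ℂ)
          (hasDerivAt_bernGen hE) h2).comp_ofReal.hasDerivWithinAt
      have hbound : ∀ τ ∈ Set.Icc (1 / 2 : ℝ) 2, ‖limKernel (τ * (γ * T)) * (γ * T)‖ ≤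
          ((C * Real.exp (a * η) + 1) * Real.exp (-(a / 2) * T.re)) * ‖γ * T‖ := by
        intro τ hτ
        rw [norm_mul, mul_left_comm]
        gcongr
        refine (H _ (smul_mem_halfStrip (by linarith [hτ.1]) hτ.2 hT)).2.trans ?_
        rw [Complex.re_ofReal_mul]
        exact hle _ (by linarith [hT.1]) τ hτ
      have := (convex_Icc (1 / 2 : ℝ) 2).norm_image_sub_le_of_norm_hasDerivWithin_le hder hbound
        hc (show (1 : ℝ) ∈ Set.Icc (1 / 2 : ℝ) 2 by norm_num)
      rw [desKernel_of_ne (by linarith [hc.1]) h0, norm_div, div_le_iff₀ (norm_pos_iff.2 h0)]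
      rw [Complex.ofReal_one, one_mul, Real.norm_eq_abs, abs_sub_comm] at this
      linarith

/-- This is B(y) = ∑_{m≥1} y e^{-my} differentiated term by term. It is verified through the closed
forms of ∑ q^m and ∑ m q^m with q = e^{-y}. -/
theorem hasSum_limKernel {y : ℂ} (hy : 0 < y.re) :
    HasSum (fun m : ℕ => (1 - ((m : ℂ) + 1) * y) * Complex.exp (-(((m : ℂ) + 1) * y)))
      (limKernel y) := by
  set q := Complex.exp (-y) with hq
  have hq1 : ‖q‖ < 1 := by
    rw [hq, Complex.norm_exp, Real.exp_lt_one_iff, Complex.neg_re]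
    linarith
  have hq0 : 1 - q ≠ 0 := by
    rw [sub_ne_zero]
    rintro h
    rw [← h, norm_one] at hq1
    exact lt_irrefl _ hq1
  have hq2 : q ≠ 0 := Complex.exp_ne_zero _
  have h1 : HasSum (fun m : ℕ => q ^ (m + 1)) (q / (1 - q)) := by
    have := (hasSum_geometric_of_norm_lt_one hq1).mul_left q
    simpa only [pow_succ', div_eq_mul_inv] using this
  have h2 : HasSum (fun m : ℕ => ((m : ℂ) + 1) * q ^ (m + 1)) (q / (1 - q) ^ 2) := by
    have := (hasSum_nat_add_iff' (f := fun n : ℕ => (n : ℂ) * q ^ n) 1).2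
      (hasSum_coe_mul_geometric_of_norm_lt_one hq1)
    simpa only [Finset.sum_range_one, Nat.cast_zero, zero_mul, sub_zero, Nat.cast_add,
      Nat.cast_one] using this
  have h3 := h1.sub (h2.mul_left y)
  have hy1 : y ≠ 0 := fun h => by simp [h] at hy
  have hexp : Complex.exp y = q⁻¹ := by rw [hq, Complex.exp_neg, inv_inv]
  have h4 : limKernel y = q / (1 - q) - y * (q / (1 - q) ^ 2) := by
    rw [limKernel_of_ne hy1 (exp_ne_one_of_re_pos hy), hexp]
    have : q⁻¹ - 1 = (1 - q) / q := by field_simp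
    rw [this]
    field_simp
  rw [h4]
  refine h3.congr_fun fun m => ?_
  have h5 : Complex.exp (-(((m : ℂ) + 1) * y)) = q ^ (m + 1) := by
    rw [hq, ← Complex.exp_nat_mul]
    congr 1
    push_cast
    ring
  rw [h5]
  ring

/-! ### Mellin transforms of exponentially decaying functions -/

theorem norm_cpow_mul_exp {t : ℝ} (ht : 0 < t) (w N : ℂ) :
    ‖(t : ℂ) ^ (w - 1) * Complex.exp (-(N * t))‖ = t ^ (w.re - 1) * Real.exp (-(N.re * t)) := by
  rw [norm_mul, Complex.norm_cpow_eq_rpow_re_of_pos ht, Complex.norm_exp]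
  simp

theorem integrableOn_rpow_mul_exp {x b : ℝ} (hx : 0 < x) (hb : 0 < b) :
    IntegrableOn (fun t : ℝ => t ^ (x - 1) * Real.exp (-(b * t))) (Set.Ioi 0) := by
  refine (integrableOn_rpow_mul_exp_neg_mul_rpow (p := 1) (s := x - 1) (by linarith) one_pos
    hb).congr_fun (fun t _ => ?_) measurableSet_Ioi
  simp only [Real.rpow_one, neg_mul]

theorem continuousOn_cpow_mul_exp (w N : ℂ) :
    ContinuousOn (fun t : ℝ => (t : ℂ) ^ (w - 1) * Complex.exp (-(N * t))) (Set.Ioi 0) := by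
  intro t ht
  have h1 : ContinuousAt (fun t : ℝ => (t : ℂ) ^ (w - 1)) t :=
    (continuousAt_cpow_const (Or.inl (by simpa using ht))).comp
      Complex.continuous_ofReal.continuousAt
  have h2 : Continuous fun t : ℝ => Complex.exp (-(N * t)) := by fun_prop
  exact (h1.mul h2.continuousAt).continuousWithinAt

theorem integrableOn_cpow_mul_exp_mul {w N : ℂ} (hw : 0 < w.re) (hN : 0 < N.re) {f : ℝ → ℂ}
    (hf : ContinuousOn f (Set.Ioi 0)) {C : ℝ} (hC : ∀ t > 0, ‖f t‖ ≤ C) :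
    IntegrableOn (fun t : ℝ => (t : ℂ) ^ (w - 1) * Complex.exp (-(N * t)) * f t) (Set.Ioi 0) := by
  refine Integrable.mono' ((integrableOn_rpow_mul_exp hw hN).mul_const C)
    (((continuousOn_cpow_mul_exp w N).mul hf).aestronglyMeasurable measurableSet_Ioi) ?_
  refine (ae_restrict_mem measurableSet_Ioi).mono fun t ht => ?_
  rw [norm_mul, norm_cpow_mul_exp ht]
  have := Real.rpow_nonneg (le_of_lt ht) (w.re - 1)
  gcongr
  exact hC t ht

theorem norm_integral_cpow_mul_exp_mul_le {w N : ℂ} (hw : 0 < w.re) (hN : 0 < N.re) {f : ℝ → ℂ}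
    {C : ℝ} (hC : ∀ t > 0, ‖f t‖ ≤ C) :
    ‖∫ t in Set.Ioi (0 : ℝ), (t : ℂ) ^ (w - 1) * Complex.exp (-(N * t)) * f t‖ ≤
      C * Real.Gamma w.re * N.re ^ (-w.re) := by
  refine (norm_integral_le_of_norm_le ((integrableOn_rpow_mul_exp hw hN).mul_const C) ?_).trans
    (le_of_eq ?_)
  · refine (ae_restrict_mem measurableSet_Ioi).mono fun t ht => ?_
    rw [norm_mul, norm_cpow_mul_exp ht]
    have := Real.rpow_nonneg (le_of_lt ht) (w.re - 1)
    gcongr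
    exact hC t ht
  · rw [integral_mul_const, Real.integral_rpow_mul_exp_neg_mul_Ioi hw hN, one_div,
      Real.inv_rpow hN.le, Real.rpow_neg hN.le]
    ring

/-- For real N > 0 this is Euler's integral. Both sides are holomorphic in N on the right half-plane
and agree at the points 1 + 1/(n+1), which accumulate at 1. -/
theorem integral_cpow_mul_exp_neg_mul {w N : ℂ} (hw : 0 < w.re) (hN : 0 < N.re) :
    ∫ t in Set.Ioi (0 : ℝ), (t : ℂ) ^ (w - 1) * Complex.exp (-(N * t)) =
      Complex.Gamma w * N ^ (-w) := by
  set U : Set ℂ := {N | 0 < N.re} with hU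
  have hUo : IsOpen U := isOpen_lt continuous_const Complex.continuous_re
  have hUc : IsPreconnected U := (convex_halfSpace_re_gt 0).isPreconnected
  have h1 : DifferentiableOn ℂ (fun N : ℂ =>
      ∫ t in Set.Ioi (0 : ℝ), (t : ℂ) ^ (w - 1) * Complex.exp (-(N * t))) U := by
    intro N hN
    have hN' : 0 < N.re := hN
    -- The cutoff at t > 0 makes the bounds hold for every t, as the criterion requires, and does
    -- not change the integral over the half-line.
    have h := differentiableAt_integral_of_bounded (r := 1) (μ := volume.restrict (Set.Ioi (0 : ℝ)))
      (G := fun z t => if 0 < t then (t : ℂ) ^ (w - 1) * Complex.exp (-(z 0 * t)) else 0)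
      (p := fun _ => N) (ρ := N.re / 2) (half_pos hN')
      (g := fun t => if 0 < t then t ^ (w.re - 1) * Real.exp (-(N.re / 2 * t)) else 0)
      (fun s _ => ?_) ?_ (fun t s hs => ?_) (fun t s _ => ?_)
    · have h2 : DifferentiableAt ℂ (fun (N : ℂ) (_ : Fin 1) => N) N :=
        differentiableAt_pi.2 fun _ => differentiableAt_id
      refine DifferentiableAt.differentiableWithinAt ((h.comp N h2).congr_of_eventuallyEq
        (Eventually.of_forall fun z => ?_))
      exact setIntegral_congr_fun measurableSet_Ioi fun t ht => (if_pos ht).symm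
    · refine (((continuousOn_cpow_mul_exp w (s 0)).aestronglyMeasurable
        measurableSet_Ioi)).congr ?_
      exact (ae_restrict_mem measurableSet_Ioi).mono fun t ht => (if_pos ht).symm
    · refine (integrableOn_rpow_mul_exp hw (half_pos hN')).congr ?_
      exact (ae_restrict_mem measurableSet_Ioi).mono fun t ht => (if_pos ht).symm
    · rcases lt_or_ge 0 t with ht | ht
      · rw [if_pos ht, if_pos ht, norm_cpow_mul_exp ht]
        have h3 : |(s 0 - N).re| < N.re / 2 := by
          refine (Complex.abs_re_le_norm _).trans_lt ?_
          rw [Metric.mem_ball, dist_eq_norm] at hs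
          exact (norm_le_pi_norm (s - fun _ => N) 0).trans_lt hs
        rw [abs_lt, Complex.sub_re] at h3
        have := Real.rpow_nonneg ht.le (w.re - 1)
        gcongr
        linarith
      · rw [if_neg ht.not_gt, if_neg ht.not_gt, norm_zero]
    · by_cases ht : 0 < t
      · simp only [if_pos ht]
        fun_prop
      · simp only [if_neg ht]
        fun_prop
  have h2 : DifferentiableOn ℂ (fun N : ℂ => Complex.Gamma w * N ^ (-w)) U := by
    intro N hN
    exact ((differentiableAt_id.cpow_const (Or.inl hN)).const_mul _).differentiableWithinAt
  refine (h1.analyticOnNhd hUo).eqOn_of_preconnected_of_frequently_eq (h2.analyticOnNhd hUo) hUc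
    (show (1 : ℂ) ∈ U by simp [hU]) ?_ hN
  have ht : Tendsto (fun n : ℕ => 1 + ((1 / ((n : ℝ) + 1) : ℝ) : ℂ)) atTop (𝓝[≠] 1) := by
    refine tendsto_nhdsWithin_iff.2
      ⟨by simpa only [add_zero] using tendsto_ofReal_one_div_add_one.const_add 1,
        Eventually.of_forall fun n => ?_⟩
    have : ((n : ℝ) + 1) ≠ 0 := by positivity
    rw [Set.mem_compl_singleton_iff, Ne, add_eq_left]
    exact_mod_cast one_div_ne_zero this
  refine ht.frequently (Eventually.of_forall fun n => ?_).frequently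
  have hr : 0 < 1 + 1 / ((n : ℝ) + 1) := by positivity
  have := Complex.integral_cpow_mul_exp_neg_mul_Ioi hw hr
  push_cast at this ⊢
  rw [this, mul_comm]
  congr 1
  rw [one_div, Complex.cpow_neg, Complex.inv_cpow]
  have h0 : (0 : ℝ) ≤ 1 + 1 / ((n : ℝ) + 1) := hr.le
  have := Complex.arg_ofReal_of_nonneg h0
  push_cast at this
  rw [this]
  exact Real.pi_ne_zero.symm

/-- At a pole w = -n the reciprocal of Γ is 0, also in the convention for values at poles. The
hypothesis forces n < K, so the Pochhammer polynomial vanishes there too. -/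
theorem inv_Gamma_mul_Gamma_add {w : ℂ} {K : ℕ} (hw : -(K : ℝ) < w.re) :
    (Complex.Gamma w)⁻¹ * Complex.Gamma (w + K) = (ascPochhammer ℂ K).eval w := by
  by_cases h : ∃ n : ℕ, w = -n
  · obtain ⟨n, rfl⟩ := h
    rw [Complex.Gamma_neg_nat_eq_zero, inv_zero, zero_mul]
    have hn : n < K := by
      simp at hw
      exact_mod_cast hw
    rw [ascPochhammer_eval_neg_coe_nat_of_lt hn]
  · push Not at h
    clear hw
    have hne := Complex.Gamma_ne_zero h
    induction K with
    | zero => simp [inv_mul_cancel₀ hne]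
    | succ K ih =>
      have h1 : w + K ≠ 0 := fun h0 => h K (eq_neg_of_add_eq_zero_left h0)
      rw [ascPochhammer_succ_eval, ← ih]
      push_cast
      rw [← add_assoc, Complex.Gamma_add_one _ h1]
      ring

/-! ### Taylor remainders of the generating function of the Bernoulli numbers -/

/-- The remainder `(z / (e^z - 1) - ∑_{j < K} b_j z^j) / z^K`. -/
noncomputable def bernTail : ℕ → ℂ → ℂ
  | 0 => bernGen
  | K + 1 => dslope (bernTail K) 0

/-- The Taylor coefficients of `z / (e^z - 1)`. -/
noncomputable def bernCoeff (j : ℕ) : ℂ := bernTail j 0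

theorem bernTail_eq (K : ℕ) (y : ℂ) : bernTail K y = bernCoeff K + y * bernTail (K + 1) y := by
  have := sub_smul_dslope (bernTail K) 0 y
  rw [sub_zero, smul_eq_mul] at this
  rw [bernTail, this, bernCoeff]
  ring

theorem differentiableOn_bernTail (K : ℕ) : DifferentiableOn ℂ (bernTail K) {z | expQuot z ≠ 0} := by
  induction K with
  | zero => exact differentiableOn_bernGen
  | succ K ih =>
    refine (Complex.differentiableOn_dslope (isOpen_expQuot_ne_zero.mem_nhds ?_)).2 ih
    simp [expQuot_zero]

theorem mul_ofReal_re_pos {γ : ℂ} (hγ : 0 < γ.re) {t : ℝ} (ht : 0 < t) : 0 < (γ * t).re := by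
  rw [Complex.re_mul_ofReal]
  exact mul_pos hγ ht

theorem continuousOn_bernTail {γ : ℂ} (hγ : 0 < γ.re) (K : ℕ) :
    ContinuousOn (fun t : ℝ => bernTail K (γ * t)) (Set.Ioi 0) := by
  refine (differentiableOn_bernTail K).continuousOn.comp
    (Continuous.continuousOn (by fun_prop)) fun t ht => ?_
  exact expQuot_ne_zero_of_ne (exp_ne_one_of_re_pos (mul_ofReal_re_pos hγ ht))

/-- For |y| ≤ 1 compactness suffices; for |y| > 1 the relation y · tail_{K+1}(y) = tail_K(y) - b_K
passes the bound from K to K + 1. The base case is e^x - 1 ≥ x. -/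
theorem exists_bernTail_bound {γ : ℂ} (hγ : 0 < γ.re) (K : ℕ) :
    ∃ C : ℝ, 0 ≤ C ∧ ∀ t : ℝ, 0 < t → ‖bernTail K (γ * t)‖ ≤ C := by
  induction K with
  | zero =>
    refine ⟨‖γ‖ / γ.re, by positivity, fun t ht => ?_⟩
    have h0 := mul_ofReal_re_pos hγ ht
    have h1 : γ * t ≠ 0 := fun h => by simp [h] at h0
    have h2 : γ.re * t ≤ ‖Complex.exp (γ * t) - 1‖ := by
      refine le_trans ?_ (exp_re_sub_one_le_norm _)
      rw [Complex.re_mul_ofReal]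
      linarith [Real.add_one_le_exp (γ.re * t)]
    rw [bernTail, bernGen_of_ne h1, norm_div, norm_mul, Complex.norm_real,
      Real.norm_of_nonneg ht.le]
    calc _ ≤ ‖γ‖ * t / (γ.re * t) := by gcongr
      _ = _ := by field_simp
  | succ K ih =>
    obtain ⟨C, hC, h⟩ := ih
    obtain ⟨C₀, hC₀⟩ := (isCompact_closedBall (0 : ℂ) 1).exists_bound_of_continuousOn
      (f := bernTail (K + 1)) ((differentiableOn_bernTail (K + 1)).continuousOn.mono fun z hz =>
        expQuot_ne_zero_of_norm_lt (by
          rw [mem_closedBall_zero_iff] at hz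
          linarith [Real.pi_gt_three]))
    refine ⟨max C₀ (C + ‖bernCoeff K‖), le_max_of_le_right (by positivity), fun t ht => ?_⟩
    rcases le_or_gt ‖γ * t‖ 1 with h1 | h1
    · exact (hC₀ _ (by simpa using h1)).trans (le_max_left _ _)
    · have h2 : γ * t * bernTail (K + 1) (γ * t) = bernTail K (γ * t) - bernCoeff K := by
        rw [bernTail_eq K]
        ring
      have h3 : ‖γ * t‖ * ‖bernTail (K + 1) (γ * t)‖ ≤ C + ‖bernCoeff K‖ := by
        rw [← norm_mul, h2]
        exact (norm_sub_le _ _).trans (by linarith [h t ht])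
      exact (le_mul_of_one_le_left (norm_nonneg _) h1.le).trans (h3.trans (le_max_right _ _))

/-- The remainder term of the asymptotic expansion of `∑_m (N + m γ)^{-w-1}`. -/
noncomputable def emTail (γ : ℂ) (K : ℕ) (N w : ℂ) : ℂ :=
  (Complex.Gamma w)⁻¹ * (γ ^ K * ∫ t in Set.Ioi (0 : ℝ),
    (t : ℂ) ^ (w + K - 1) * Complex.exp (-(N * t)) * bernTail K (γ * t))

/-- Split one Taylor coefficient off the remainder. Its Mellin integral is Γ(w+K) N^{-(w+K)}, and
the factor 1/Γ(w) turns the Gamma value into a Pochhammer polynomial. -/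
theorem emTail_eq {γ : ℂ} (hγ : 0 < γ.re) {K : ℕ} {N w : ℂ} (hN : 0 < N.re)
    (hw : -(K : ℝ) < w.re) :
    emTail γ K N w = bernCoeff K * γ ^ K * (ascPochhammer ℂ K).eval w * N ^ (-(w + K)) +
      emTail γ (K + 1) N w := by
  have hw1 : 0 < (w + K).re := by simp; linarith
  have hw2 : 0 < (w + (K + 1 : ℕ)).re := by simp; linarith
  obtain ⟨C, -, hC⟩ := exists_bernTail_bound hγ (K + 1)
  have hi1 := integrableOn_cpow_mul_exp_mul hw1 hN (f := fun _ => bernCoeff K)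
    continuousOn_const (C := ‖bernCoeff K‖) (fun _ _ => le_rfl)
  have hi2 := (integrableOn_cpow_mul_exp_mul hw2 hN (continuousOn_bernTail hγ (K + 1))
    hC).const_mul γ
  have h1 : ∀ t ∈ Set.Ioi (0 : ℝ),
      (t : ℂ) ^ (w + K - 1) * Complex.exp (-(N * t)) * bernTail K (γ * t) =
      (t : ℂ) ^ (w + K - 1) * Complex.exp (-(N * t)) * bernCoeff K +
      γ * ((t : ℂ) ^ (w + (K + 1 : ℕ) - 1) * Complex.exp (-(N * t)) *
        bernTail (K + 1) (γ * t)) := by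
    intro t ht
    have ht0 : (t : ℂ) ≠ 0 := by exact_mod_cast (ne_of_gt ht)
    have h2 : (t : ℂ) ^ (w + (K + 1 : ℕ) - 1) = t ^ (w + K - 1) * t := by
      rw [show w + (K + 1 : ℕ) - 1 = (w + K - 1) + 1 by push_cast; ring,
        Complex.cpow_add _ _ ht0, Complex.cpow_one]
    rw [bernTail_eq K, h2]
    ring
  rw [emTail, setIntegral_congr_fun measurableSet_Ioi h1, integral_add hi1 hi2,
    integral_const_mul, integral_mul_const, integral_cpow_mul_exp_neg_mul hw1 hN,
    ← inv_Gamma_mul_Gamma_add hw, emTail, pow_succ]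
  ring

/-- Each Taylor term removed gains one power of N, and this gain drives the continuation. The
constant is locally uniform in w because |1/Γ(w)| Γ(Re w + K) is continuous. -/
theorem norm_emTail_le {γ : ℂ} (hγ : 0 < γ.re) (K : ℕ) {w₀ : ℂ} (hw₀ : -(K : ℝ) < w₀.re) :
    ∃ ρ C : ℝ, 0 < ρ ∧ 0 ≤ C ∧ ∀ w ∈ Metric.ball w₀ ρ, -(K : ℝ) < w.re ∧ ∀ N : ℂ, 0 < N.re →
      ‖emTail γ K N w‖ ≤ C * N.re ^ (-(w.re + K)) := by
  obtain ⟨C, hC0, hC⟩ := exists_bernTail_bound hγ K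
  have hcont : ContinuousAt (fun w : ℂ => ‖(Complex.Gamma w)⁻¹‖ * Real.Gamma (w + K).re) w₀ := by
    refine (Complex.differentiable_one_div_Gamma.continuous.continuousAt.norm).mul ?_
    refine ContinuousAt.comp (g := Real.Gamma) (Real.differentiableAt_Gamma fun m h => ?_).continuousAt
      (by fun_prop)
    have : 0 < (w₀ + K).re := by simp; linarith
    rw [h] at this
    have : (0 : ℝ) ≤ m := Nat.cast_nonneg m
    linarith
  obtain ⟨ρ, hρ, H⟩ := Metric.eventually_nhds_iff_ball.1
    ((hcont.eventually (gt_mem_nhds (lt_add_one _))).and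
      (Complex.continuous_re.continuousAt.eventually (lt_mem_nhds hw₀)))
  set B := ‖(Complex.Gamma w₀)⁻¹‖ * Real.Gamma (w₀ + K).re + 1 with hB
  have hB0 : 0 ≤ B := by
    have : 0 < (w₀ + K).re := by simp; linarith
    have := (Real.Gamma_pos_of_pos this).le
    positivity
  refine ⟨ρ, B * (‖γ‖ ^ K * C), hρ, by positivity, fun w hw => ⟨(H w hw).2, fun N hN => ?_⟩⟩
  have hw1 : 0 < (w + K).re := by
    have := (H w hw).2
    simp; linarith
  have h1 := norm_integral_cpow_mul_exp_mul_le hw1 hN hC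
  rw [emTail, norm_mul, norm_mul, norm_pow]
  have h2 : (w + K).re = w.re + K := by simp
  have h3 : 0 ≤ N.re ^ (-(w.re + K)) := Real.rpow_nonneg hN.le _
  calc _ ≤ ‖(Complex.Gamma w)⁻¹‖ * (‖γ‖ ^ K *
        (C * Real.Gamma (w + K).re * N.re ^ (-(w + K).re))) := by gcongr
    _ = (‖(Complex.Gamma w)⁻¹‖ * Real.Gamma (w + K).re) *
        ((‖γ‖ ^ K * C) * N.re ^ (-(w.re + K))) := by rw [h2]; ring
    _ ≤ B * ((‖γ‖ ^ K * C) * N.re ^ (-(w.re + K))) := by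
        gcongr
        exact (H w hw).1.le
    _ = _ := by ring

theorem differentiableAt_mellin {N : ℂ} (hN : 0 < N.re) {f : ℝ → ℂ}
    (hf : ContinuousOn f (Set.Ioi 0)) {C : ℝ} (hC : ∀ t > 0, ‖f t‖ ≤ C) {w : ℂ}
    (hw : 0 < w.re) : DifferentiableAt ℂ (fun w : ℂ => ∫ t in Set.Ioi (0 : ℝ),
      (t : ℂ) ^ (w - 1) * Complex.exp (-(N * t)) * f t) w := by
  have h := differentiableAt_integral_of_bounded (r := 1) (μ := volume.restrict (Set.Ioi (0 : ℝ)))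
    (G := fun z t => if 0 < t then (t : ℂ) ^ (z 0 - 1) * Complex.exp (-(N * t)) * f t else 0)
    (p := fun _ => w) (ρ := w.re / 2) (half_pos hw)
    -- A power of t whose exponent lies between two others is at most their sum: the larger exponent
    -- serves t ≥ 1, the smaller one t < 1.
    (g := fun t => if 0 < t then (t ^ (w.re / 2 - 1) * Real.exp (-(N.re * t)) +
      t ^ (3 * w.re / 2 - 1) * Real.exp (-(N.re * t))) * C else 0)
    (fun s _ => ?_) ?_ (fun t s hs => ?_) (fun t s _ => ?_)
  · have h2 : DifferentiableAt ℂ (fun (N : ℂ) (_ : Fin 1) => N) w :=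
      differentiableAt_pi.2 fun _ => differentiableAt_id
    refine (h.comp w h2).congr_of_eventuallyEq (Eventually.of_forall fun z => ?_)
    exact setIntegral_congr_fun measurableSet_Ioi fun t ht => (if_pos ht).symm
  · refine ((((continuousOn_cpow_mul_exp (s 0) N).mul hf).aestronglyMeasurable
      measurableSet_Ioi)).congr ?_
    exact (ae_restrict_mem measurableSet_Ioi).mono fun t ht => (if_pos ht).symm
  · refine Integrable.congr (((integrableOn_rpow_mul_exp (half_pos hw) hN).add
      (integrableOn_rpow_mul_exp (x := 3 * w.re / 2) (by positivity) hN)).mul_const C) ?_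
    exact (ae_restrict_mem measurableSet_Ioi).mono fun t ht => (if_pos ht).symm
  · rcases lt_or_ge 0 t with ht | ht
    · rw [if_pos ht, if_pos ht, norm_mul, norm_cpow_mul_exp ht, ← add_mul]
      have h3 : |(s 0 - w).re| < w.re / 2 := by
        refine (Complex.abs_re_le_norm _).trans_lt ?_
        rw [Metric.mem_ball, dist_eq_norm] at hs
        exact (norm_le_pi_norm (s - fun _ => w) 0).trans_lt hs
      rw [abs_lt, Complex.sub_re] at h3
      have h4 := Real.rpow_nonneg ht.le (w.re / 2 - 1)
      have h5 := Real.rpow_nonneg ht.le (3 * w.re / 2 - 1)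
      have h6 : t ^ ((s 0).re - 1) ≤ t ^ (w.re / 2 - 1) + t ^ (3 * w.re / 2 - 1) := by
        rcases le_or_gt 1 t with h | h
        · have := Real.rpow_le_rpow_of_exponent_le h
            (show (s 0).re - 1 ≤ 3 * w.re / 2 - 1 by linarith)
          linarith
        · have := Real.rpow_le_rpow_of_exponent_ge ht h.le
            (show w.re / 2 - 1 ≤ (s 0).re - 1 by linarith)
          linarith
      gcongr
      exact hC t ht
    · rw [if_neg ht.not_gt, if_neg ht.not_gt, norm_zero]
  · by_cases ht : 0 < t
    · simp only [if_pos ht]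
      have ht0 : (t : ℂ) ≠ 0 := by exact_mod_cast ht.ne'
      have h1 : DifferentiableAt ℂ (fun s : Fin 1 → ℂ => s 0 - 1) s := by fun_prop
      exact ((h1.const_cpow (Or.inl ht0)).mul_const _).mul_const _
    · simp only [if_neg ht]
      fun_prop

theorem differentiableAt_emTail {γ : ℂ} (hγ : 0 < γ.re) {K : ℕ} {N w : ℂ} (hN : 0 < N.re)
    (hw : -(K : ℝ) < w.re) : DifferentiableAt ℂ (emTail γ K N) w := by
  obtain ⟨C, -, hC⟩ := exists_bernTail_bound hγ K
  have hw1 : 0 < (w + K).re := by simp; linarith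
  have h1 := differentiableAt_mellin hN (continuousOn_bernTail hγ K) hC hw1
  have h2 : DifferentiableAt ℂ (fun w : ℂ => w + K) w := by fun_prop
  exact (Complex.differentiable_one_div_Gamma w).mul ((h1.comp w h2).const_mul _)

/-- Write each power as a Mellin integral and sum the geometric series: ∑_{m≥1} e^{-mγt} =
B(γt)/(γt). The factor 1/t shifts the Mellin exponent from s to s - 1, and Γ(s) = (s - 1)Γ(s - 1)
accounts for the prefactor. -/
theorem hasSum_add_mul_cpow {γ N s : ℂ} (hγ : 0 < γ.re) (hN : 0 < N.re) (hs : 1 < s.re) :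
    HasSum (fun m : ℕ => (N + ((m : ℂ) + 1) * γ) ^ (-s)) ((γ * (s - 1))⁻¹ * emTail γ 0 N (s - 1)) := by
  have hs0 : 0 < s.re := one_pos.trans hs
  have hNm : ∀ m : ℕ, (N + ((m : ℂ) + 1) * γ).re = N.re + ((m : ℝ) + 1) * γ.re := by
    intro m
    have := Complex.re_ofReal_mul ((m : ℝ) + 1) γ
    push_cast at this
    rw [Complex.add_re, this]
  have hNm0 : ∀ m : ℕ, 0 < (N + ((m : ℂ) + 1) * γ).re := fun m => by rw [hNm]; positivity
  have hG : Complex.Gamma s ≠ 0 := Complex.Gamma_ne_zero_of_re_pos hs0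
  have hint : ∀ m : ℕ, IntegrableOn (fun t : ℝ => (t : ℂ) ^ (s - 1) *
      Complex.exp (-((N + ((m : ℂ) + 1) * γ) * t))) (Set.Ioi 0) := by
    intro m
    have := integrableOn_cpow_mul_exp_mul hs0 (hNm0 m) (f := fun _ => 1) continuousOn_const
      (C := 1) (fun _ _ => by simp)
    simpa using this
  have hnorm : ∀ m : ℕ, ∫ t in Set.Ioi (0 : ℝ), ‖(t : ℂ) ^ (s - 1) *
      Complex.exp (-((N + ((m : ℂ) + 1) * γ) * t))‖ =
      Real.Gamma s.re * (N.re + ((m : ℝ) + 1) * γ.re) ^ (-s.re) := by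
    intro m
    have h0 := hNm0 m
    rw [setIntegral_congr_fun measurableSet_Ioi fun t ht => norm_cpow_mul_exp ht _ _,
      Real.integral_rpow_mul_exp_neg_mul_Ioi hs0 h0, hNm, one_div, Real.inv_rpow (by positivity),
      Real.rpow_neg (by positivity)]
    ring
  have hsum : Summable fun m : ℕ => ∫ t in Set.Ioi (0 : ℝ), ‖(t : ℂ) ^ (s - 1) *
      Complex.exp (-((N + ((m : ℂ) + 1) * γ) * t))‖ := by
    simp only [hnorm]
    refine Summable.mul_left _ ?_
    have h1 := ((summable_nat_add_iff 1).2 (Real.summable_nat_rpow (p := -s.re) |>.2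
      (by linarith))).mul_left (γ.re ^ (-s.re))
    refine Summable.of_nonneg_of_le (fun m => by positivity) (fun m => ?_) h1
    rw [← Real.mul_rpow hγ.le (by positivity)]
    refine Real.rpow_le_rpow_of_nonpos (by positivity) ?_ (by linarith)
    push_cast
    linarith
  have h1 := hasSum_integral_of_summable_integral_norm hint hsum
  simp only [integral_cpow_mul_exp_neg_mul hs0 (hNm0 _)] at h1
  have h2 := h1.mul_left (Complex.Gamma s)⁻¹
  simp only [inv_mul_cancel_left₀ hG] at h2
  refine (congrArg (HasSum _) ?_).mp h2
  have hs1 : s - 1 ≠ 0 := fun h => by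
    rw [sub_eq_zero] at h
    rw [h] at hs
    simp at hs
  have hγ0 : γ ≠ 0 := fun h => by simp [h] at hγ
  have hG2 : Complex.Gamma s = (s - 1) * Complex.Gamma (s - 1) := by
    rw [← Complex.Gamma_add_one _ hs1, sub_add_cancel]
  have h3 : ∀ t ∈ Set.Ioi (0 : ℝ), ∑' m : ℕ, (t : ℂ) ^ (s - 1) *
      Complex.exp (-((N + ((m : ℂ) + 1) * γ) * t)) =
      γ⁻¹ * ((t : ℂ) ^ (s - 1 + (0 : ℕ) - 1) * Complex.exp (-(N * t)) * bernTail 0 (γ * t)) := by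
    intro t ht
    have ht0 : (t : ℂ) ≠ 0 := by exact_mod_cast (ne_of_gt ht)
    have hre := mul_ofReal_re_pos hγ ht
    have hq1 : ‖Complex.exp (-(γ * t))‖ < 1 := by
      rw [Complex.norm_exp, Real.exp_lt_one_iff, Complex.neg_re]
      linarith
    have h4 : ∀ m : ℕ, (t : ℂ) ^ (s - 1) * Complex.exp (-((N + ((m : ℂ) + 1) * γ) * t)) =
        ((t : ℂ) ^ (s - 1) * Complex.exp (-(N * t)) * Complex.exp (-(γ * t))) *
          Complex.exp (-(γ * t)) ^ m := by
      intro m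
      rw [← Complex.exp_nat_mul, mul_assoc, mul_assoc, ← Complex.exp_add, ← Complex.exp_add]
      congr 2
      ring
    simp only [h4]
    rw [tsum_mul_left, tsum_geometric_of_norm_lt_one hq1, bernTail,
      bernGen_of_ne (mul_ne_zero hγ0 ht0)]
    have h5 : (t : ℂ) ^ (s - 1) = t ^ (s - 1 + (0 : ℕ) - 1) * t := by
      rw [show s - 1 = (s - 1 + (0 : ℕ) - 1) + 1 by push_cast; ring,
        Complex.cpow_add _ _ ht0, Complex.cpow_one]
      congr 2
      push_cast
      ring
    have h6 : Complex.exp (γ * t) - 1 ≠ 0 := sub_ne_zero.2 (exp_ne_one_of_re_pos hre)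
    rw [h5, Complex.exp_neg (γ * t)]
    have h7 : 1 - (Complex.exp (γ * t))⁻¹ = (Complex.exp (γ * t) - 1) / Complex.exp (γ * t) := by
      field_simp
    rw [h7]
    field_simp
  rw [setIntegral_congr_fun measurableSet_Ioi h3, integral_const_mul, emTail, hG2, pow_zero, one_mul,
    mul_inv, mul_inv]
  ring

/-! ### Meromorphic continuation of the multiple zeta-function -/

theorem exists_summable_ezWeight_sub {r : ℕ} {σ : Fin r → ℝ}
    (hσ : ∀ j : Fin r, (r : ℝ) - j < ∑ i ∈ Finset.Ici j, σ i) :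
    ∃ δ > 0, (∀ j : Fin r, (r : ℝ) - j < ∑ i ∈ Finset.Ici j, (σ i - δ)) ∧
      Summable (ezWeight fun j => σ j - δ) := by
  have h1 : ∀ᶠ δ in 𝓝[>] (0 : ℝ),
      ∀ j : Fin r, (r : ℝ) - j < ∑ i ∈ Finset.Ici j, (σ i - δ) := by
    rw [eventually_all]
    intro j
    have hc : Tendsto (fun δ : ℝ => ∑ i ∈ Finset.Ici j, (σ i - δ)) (𝓝[>] 0)
        (𝓝 (∑ i ∈ Finset.Ici j, σ i)) := by
      have : Continuous fun δ : ℝ => ∑ i ∈ Finset.Ici j, (σ i - δ) := by fun_prop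
      simpa only [sub_zero] using (this.tendsto 0).mono_left nhdsWithin_le_nhds
    exact hc.eventually (lt_mem_nhds (hσ j))
  obtain ⟨δ, h2, h3⟩ := (h1.and self_mem_nhdsWithin).exists
  exact ⟨δ, h3, h2, summable_ezWeight h2⟩

theorem mem_ezRegion_iff {r : ℕ} {s : Fin r → ℂ} :
    s ∈ ezRegion r ↔ ∀ j : Fin r, (r : ℝ) - j < ∑ i ∈ Finset.Ici j, (s i).re := by
  simp only [ezRegion, Set.mem_ofPred_eq, Complex.re_sum]

/-! ### Summation over the last index and merging of the last two exponents -/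

theorem sum_Ici_castSucc {M : Type*} [AddCommMonoid M] {r : ℕ} (f : Fin (r + 1) → M) (j : Fin r) :
    ∑ i ∈ Finset.Ici j.castSucc, f i = (∑ i ∈ Finset.Ici j, f i.castSucc) + f (Fin.last r) := by
  simp only [← Finset.filter_le_eq_Ici, Finset.sum_filter, Fin.sum_univ_castSucc,
    Fin.castSucc_le_castSucc_iff]
  simp [Fin.le_last]

theorem sum_Iic_castSucc {M : Type*} [AddCommMonoid M] {r : ℕ} (f : Fin (r + 1) → M) (j : Fin r) :
    ∑ i ∈ Finset.Iic j.castSucc, f i = ∑ i ∈ Finset.Iic j, f i.castSucc := by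
  simp only [← Finset.filter_ge_eq_Iic, Finset.sum_filter, Fin.sum_univ_castSucc,
    Fin.castSucc_le_castSucc_iff]
  simp

theorem sum_Iic_last {M : Type*} [AddCommMonoid M] {r : ℕ} (f : Fin (r + 1) → M) :
    ∑ i ∈ Finset.Iic (Fin.last r), f i = ∑ i, f i := by
  simp only [← Finset.filter_ge_eq_Iic, Finset.sum_filter, Fin.le_last, if_true]

theorem ezTerm_snoc {n : ℕ} (γ s : Fin (n + 2) → ℂ) (m : Fin (n + 1) → ℕ) (k : ℕ) :
    ezTerm γ s (Fin.snoc (α := fun _ => ℕ) m k) =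
      ezTerm (fun j => γ j.castSucc) (fun j => s j.castSucc) m *
        (ezSum (fun j => γ j.castSucc) m (Fin.last n) + ((k : ℂ) + 1) * γ (Fin.last (n + 1))) ^
          (-s (Fin.last (n + 1))) := by
  simp only [ezTerm, ezSum]
  rw [Fin.prod_univ_castSucc]
  simp only [sum_Iic_castSucc, sum_Iic_last]
  rw [Fin.sum_univ_castSucc]
  simp only [Fin.snoc_castSucc, Fin.snoc_last]

/-- The argument `(s_1, …, s_{r-1}, s_r + s_{r+1} - 1 + z)`. -/
def mergeLast {n : ℕ} (z : ℂ) (s : Fin (n + 2) → ℂ) (j : Fin (n + 1)) : ℂ :=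
  s j.castSucc + if j = Fin.last n then s (Fin.last (n + 1)) - 1 + z else 0

theorem differentiable_mergeLast {n : ℕ} (z : ℂ) :
    Differentiable ℂ (mergeLast z : (Fin (n + 2) → ℂ) → _) := by
  refine differentiable_pi.2 fun j => ?_
  by_cases hj : j = Fin.last n
  · simp only [mergeLast, if_pos hj]; fun_prop
  · simp only [mergeLast, if_neg hj]; fun_prop

theorem isOpenMap_mergeLast {n : ℕ} (z : ℂ) :
    IsOpenMap (mergeLast z : (Fin (n + 2) → ℂ) → Fin (n + 1) → ℂ) := by
  refine IsOpenMap.of_sections fun s => ⟨fun y => Fin.snoc (α := fun _ => ℂ)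
    (fun j => y j - if j = Fin.last n then s (Fin.last (n + 1)) - 1 + z else 0)
    (s (Fin.last (n + 1))), ?_, ?_, ?_⟩
  · refine continuousAt_pi.2 fun i => ?_
    refine Fin.lastCases ?_ (fun j => ?_) i
    · simp only [Fin.snoc_last]; exact continuousAt_const
    · simp only [Fin.snoc_castSucc]
      exact (continuous_apply j).continuousAt.sub continuousAt_const
  · funext i
    refine Fin.lastCases ?_ (fun j => ?_) i
    · simp only [Fin.snoc_last]
    · simp only [Fin.snoc_castSucc, mergeLast, add_sub_cancel_right]
  · intro y
    funext j
    simp only [mergeLast, Fin.snoc_last, Fin.snoc_castSucc, sub_add_cancel]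

theorem sum_Ici_mergeLast {n : ℕ} (z : ℂ) (s : Fin (n + 2) → ℂ) (j : Fin (n + 1)) :
    ∑ i ∈ Finset.Ici j, (mergeLast z s i).re =
      (∑ i ∈ Finset.Ici j.castSucc, (s i).re) - 1 + z.re := by
  rw [sum_Ici_castSucc]
  simp only [mergeLast, Complex.add_re, Finset.sum_add_distrib, apply_ite Complex.re,
    Complex.zero_re, Finset.sum_ite_eq', Finset.mem_Ici, Fin.le_last, if_true, Complex.sub_re,
    Complex.one_re]
  ring

theorem ezTerm_mergeLast {n : ℕ} {γ : Fin (n + 1) → ℂ} (hγ : ∀ j, 0 < (γ j).re) (z : ℂ)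
    (s : Fin (n + 2) → ℂ) (m : Fin (n + 1) → ℕ) :
    ezTerm γ (mergeLast z s) m = ezTerm γ (fun j => s j.castSucc) m *
      ezSum γ m (Fin.last n) ^ (-(s (Fin.last (n + 1)) - 1 + z)) := by
  have h0 : ezSum γ m (Fin.last n) ≠ 0 := fun h => by
    have := ezSum_re_pos hγ m (Fin.last n)
    simp [h] at this
  have h1 : ∀ j, ezSum γ m j ^ (-mergeLast z s j) = ezSum γ m j ^ (-s j.castSucc) *
      if j = Fin.last n then ezSum γ m (Fin.last n) ^ (-(s (Fin.last (n + 1)) - 1 + z)) else 1 := by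
    intro j
    by_cases hj : j = Fin.last n
    · subst hj
      rw [mergeLast, if_pos rfl, if_pos rfl, ← Complex.cpow_add _ _ h0]
      congr 1
      ring
    · rw [mergeLast, if_neg hj, if_neg hj, add_zero, mul_one]
  show ∏ j, ezSum γ m j ^ (-mergeLast z s j) = (∏ j, ezSum γ m j ^ (-s j.castSucc)) * _
  simp only [h1, Finset.prod_mul_distrib, Finset.prod_ite_eq', Finset.mem_univ, if_true]

theorem ezWeight_mergeLast {n : ℕ} (z : ℂ) (s : Fin (n + 2) → ℂ) (m : Fin (n + 1) → ℕ) :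
    ezWeight (fun j => (mergeLast z s j).re) m = ezWeight (fun j => (s j.castSucc).re) m *
      indexSum m (Fin.last n) ^ (-((s (Fin.last (n + 1)) - 1).re + z.re)) := by
  have h1 : ∀ j, indexSum m j ^ (-(mergeLast z s j).re) = indexSum m j ^ (-(s j.castSucc).re) *
      if j = Fin.last n then
        indexSum m (Fin.last n) ^ (-((s (Fin.last (n + 1)) - 1).re + z.re)) else 1 := by
    intro j
    by_cases hj : j = Fin.last n
    · subst hj
      rw [mergeLast, if_pos rfl, if_pos rfl, ← Real.rpow_add (indexSum_pos _ _)]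
      congr 1
      simp only [Complex.add_re]
      ring
    · rw [mergeLast, if_neg hj, if_neg hj, add_zero, mul_one]
  simp only [ezWeight, h1, Finset.prod_mul_distrib, Finset.prod_ite_eq', Finset.mem_univ, if_true]

/-- The region in which the expansion with `K` terms converges. -/
def emRegion (n K : ℕ) : Set (Fin (n + 2) → ℂ) :=
  {s | -(K : ℝ) < (s (Fin.last (n + 1)) - 1).re ∧ mergeLast (K : ℂ) s ∈ ezRegion (n + 1)}

theorem isOpen_ezRegion (r : ℕ) : IsOpen (ezRegion r) := by
  have : ezRegion r = ⋂ j : Fin r, {s | (r : ℝ) - (j : ℝ) < (∑ i ∈ Finset.Ici j, s i).re} := by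
    ext s
    simp [ezRegion]
  rw [this]
  refine isOpen_iInter_of_finite fun j => isOpen_lt continuous_const ?_
  exact Complex.continuous_re.comp (by fun_prop)

theorem isOpen_emRegion (n K : ℕ) : IsOpen (emRegion n K) :=
  (isOpen_lt continuous_const (Complex.continuous_re.comp (by fun_prop))).inter
    ((isOpen_ezRegion _).preimage (differentiable_mergeLast _).continuous)

theorem emRegion_subset_succ (n K : ℕ) : emRegion n K ⊆ emRegion n (K + 1) := by
  rintro s ⟨h1, h2⟩
  refine ⟨by push_cast; linarith, ?_⟩
  rw [mem_ezRegion_iff] at h2 ⊢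
  intro j
  have := h2 j
  rw [sum_Ici_mergeLast] at this ⊢
  simp only [Complex.natCast_re] at this ⊢
  push_cast at this ⊢
  linarith

/-- The last merged coordinate belongs to every tail sum, so increasing K raises all of them
together. -/
theorem exists_mem_emRegion {n : ℕ} (s : Fin (n + 2) → ℂ) : ∃ K, s ∈ emRegion n K := by
  have h1 : ∀ᶠ K : ℕ in atTop, -(K : ℝ) < (s (Fin.last (n + 1)) - 1).re := by
    filter_upwards [tendsto_natCast_atTop_atTop.eventually_gt_atTop
      (-(s (Fin.last (n + 1)) - 1).re)] with K hK
    linarith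
  have h2 : ∀ᶠ K : ℕ in atTop, ∀ j : Fin (n + 1),
      ((n + 1 : ℕ) : ℝ) - j < (∑ i ∈ Finset.Ici j.castSucc, (s i).re) - 1 + K := by
    rw [eventually_all]
    intro j
    filter_upwards [tendsto_natCast_atTop_atTop.eventually_gt_atTop
      (((n + 1 : ℕ) : ℝ) - j - (∑ i ∈ Finset.Ici j.castSucc, (s i).re) + 1)] with K hK
    linarith
  obtain ⟨K, h3, h4⟩ := (h1.and h2).exists
  refine ⟨K, h3, mem_ezRegion_iff.2 fun j => ?_⟩
  rw [sum_Ici_mergeLast, Complex.natCast_re]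
  exact h4 j

/-- Merging lowers each tail sum by one, and the number of terms required for it drops by one as
well. -/
theorem ezRegion_eq_subset_emRegion (n : ℕ) : ezRegion (n + 2) ⊆ emRegion n 0 := by
  intro s hs
  rw [mem_ezRegion_iff] at hs
  refine ⟨?_, mem_ezRegion_iff.2 fun j => ?_⟩
  · have := hs (Fin.last (n + 1))
    rw [show Finset.Ici (Fin.last (n + 1)) = {Fin.last (n + 1)} by ext; simp,
      Finset.sum_singleton] at this
    simp only [Fin.val_last] at this
    push_cast at this
    rw [Complex.sub_re, Complex.one_re]
    push_cast
    linarith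
  · have := hs j.castSucc
    rw [sum_Ici_mergeLast]
    simp only [Fin.val_castSucc] at this
    push_cast at this ⊢
    simp only [Complex.zero_re]
    linarith

section Continuation

variable {n : ℕ}

/-- The general term of the series of remainders. -/
noncomputable def emTerm (γ : Fin (n + 2) → ℂ) (K : ℕ) (s : Fin (n + 2) → ℂ)
    (m : Fin (n + 1) → ℕ) : ℂ :=
  ezTerm (fun j => γ j.castSucc) (fun j => s j.castSucc) m *
    emTail (γ (Fin.last (n + 1))) K (ezSum (fun j => γ j.castSucc) m (Fin.last n))
      (s (Fin.last (n + 1)) - 1)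

/-- The remainder is of order N^{-(Re s_last - 1 + K)}, with N the sum attached to the preceding
index. Multiplying by the term of smaller depth gives the majorant with merged exponents. -/
theorem exists_emTerm_bound {γ : Fin (n + 2) → ℂ} (hγ : ∀ j, 0 < (γ j).re) {K : ℕ}
    {p : Fin (n + 2) → ℂ} (hp : p ∈ emRegion n K) : ∃ ρ > 0, ∃ g : (Fin (n + 1) → ℕ) → ℝ,
      Summable g ∧ ∀ m, ∀ s ∈ Metric.ball p ρ, ‖emTerm γ K s m‖ ≤ g m := by
  have hγ' : ∀ j : Fin (n + 1), 0 < (γ j.castSucc).re := fun j => hγ _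
  obtain ⟨hp1, hp2⟩ := hp
  obtain ⟨δ, hδ, -, hsum⟩ := exists_summable_ezWeight_sub (mem_ezRegion_iff.1 hp2)
  obtain ⟨ρ, C₂, hρ, hC₂, H⟩ := norm_emTail_le (hγ (Fin.last (n + 1))) K hp1
  obtain ⟨C₁, hC₁, H₁⟩ := exists_norm_ezTerm_le hγ' (‖p‖ + 1)
  obtain ⟨C₃, hC₃, H₃⟩ := exists_ezSum_bounds hγ'
  have hC₃0 : 0 < C₃ := one_pos.trans_le hC₃
  -- This bounds |Re(s_last - 1) + K| on the unit ball around p. The radius δ/2 below is used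
  -- because a merged coordinate moves by at most 2‖s - p‖.
  set A := ‖p‖ + 2 + K with hA
  refine ⟨min (min ρ 1) (δ / 2), by positivity, fun m => C₁ * (C₂ * C₃ ^ A) *
    ezWeight (fun j => (mergeLast (K : ℂ) p j).re - δ) m, hsum.mul_left _, fun m s hs => ?_⟩
  rw [Metric.mem_ball, dist_eq_norm, lt_min_iff, lt_min_iff] at hs
  obtain ⟨⟨hs1, hs2⟩, hs3⟩ := hs
  have hcoord : ∀ i, ‖s i - p i‖ ≤ ‖s - p‖ := fun i => norm_le_pi_norm (s - p) i
  have hnorm : ∀ i, ‖s i‖ ≤ ‖p‖ + 1 := by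
    intro i
    calc ‖s i‖ = ‖(s i - p i) + p i‖ := by rw [sub_add_cancel]
      _ ≤ ‖s i - p i‖ + ‖p i‖ := norm_add_le _ _
      _ ≤ ‖p‖ + 1 := by linarith [hcoord i, norm_le_pi_norm p i]
  have hw : s (Fin.last (n + 1)) - 1 ∈ Metric.ball (p (Fin.last (n + 1)) - 1) ρ := by
    rw [Metric.mem_ball, dist_eq_norm, sub_sub_sub_cancel_right]
    exact (hcoord _).trans_lt hs1
  have h1 := H₁ (fun j => s j.castSucc) m fun j => hnorm _
  have h2 := (H _ hw).2 _ (ezSum_re_pos hγ' m (Fin.last n))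
  have h3 : |(s (Fin.last (n + 1)) - 1).re + K| ≤ A := by
    refine (abs_add_le _ _).trans ?_
    rw [Nat.abs_cast]
    have h4 : |(s (Fin.last (n + 1)) - 1).re| ≤ ‖s (Fin.last (n + 1))‖ + 1 :=
      (Complex.abs_re_le_norm _).trans ((norm_sub_le _ _).trans (by simp))
    linarith [hnorm (Fin.last (n + 1))]
  have h4 := rpow_neg_le_of_comparable hC₃ (indexSum_pos m (Fin.last n))
    (H₃ m (Fin.last n)).1 ((Complex.re_le_norm _).trans (H₃ m (Fin.last n)).2) h3
  have h5 : ezWeight (fun j => (mergeLast (K : ℂ) s j).re) m ≤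
      ezWeight (fun j => (mergeLast (K : ℂ) p j).re - δ) m := by
    refine ezWeight_le_ezWeight (fun j => ?_) m
    have h6 : ‖mergeLast (K : ℂ) s j - mergeLast (K : ℂ) p j‖ ≤ 2 * ‖s - p‖ := by
      by_cases hj : j = Fin.last n
      · simp only [mergeLast, if_pos hj]
        calc _ = ‖(s j.castSucc - p j.castSucc) +
            (s (Fin.last (n + 1)) - p (Fin.last (n + 1)))‖ := by congr 1; ring
          _ ≤ _ := norm_add_le _ _
          _ ≤ _ := by linarith [hcoord j.castSucc, hcoord (Fin.last (n + 1))]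
      · simp only [mergeLast, if_neg hj, add_zero]
        linarith [hcoord j.castSucc, norm_nonneg (s - p)]
    have h7 := (Complex.abs_re_le_norm _).trans h6
    rw [abs_le, Complex.sub_re] at h7
    linarith
  have h6 : 0 ≤ ezWeight (fun j : Fin (n + 1) => (s j.castSucc).re) m := ezWeight_nonneg _ _
  rw [emTerm, norm_mul]
  calc _ ≤ (C₁ * ezWeight (fun j => (s j.castSucc).re) m) *
        (C₂ * (C₃ ^ A * indexSum m (Fin.last n) ^ (-((s (Fin.last (n + 1)) - 1).re + K)))) := by
        exact mul_le_mul h1 (h2.trans (mul_le_mul_of_nonneg_left h4 hC₂)) (norm_nonneg _)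
          (by positivity)
    _ = C₁ * (C₂ * C₃ ^ A) * ezWeight (fun j => (mergeLast (K : ℂ) s j).re) m := by
        rw [ezWeight_mergeLast, Complex.natCast_re]
        ring
    _ ≤ _ := mul_le_mul_of_nonneg_left h5 (by positivity)

theorem summable_emTerm {γ : Fin (n + 2) → ℂ} (hγ : ∀ j, 0 < (γ j).re) {K : ℕ}
    {s : Fin (n + 2) → ℂ} (hs : s ∈ emRegion n K) : Summable (emTerm γ K s) := by
  obtain ⟨ρ, hρ, g, hg, h⟩ := exists_emTerm_bound hγ hs
  exact Summable.of_norm_bounded hg fun m => h m s (Metric.mem_ball_self hρ)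

theorem differentiableAt_finset_prod {r : ℕ} {ι : Type*} (t : Finset ι)
    {f : ι → (Fin r → ℂ) → ℂ} {p : Fin r → ℂ} (hf : ∀ i ∈ t, DifferentiableAt ℂ (f i) p) :
    DifferentiableAt ℂ (fun z => ∏ i ∈ t, f i z) p := by
  classical
  induction t using Finset.induction_on with
  | empty => simp only [Finset.prod_empty]; exact differentiableAt_const _
  | insert a t ha ih =>
    simp only [Finset.prod_insert ha]
    exact (hf a (Finset.mem_insert_self _ _)).mul
      (ih fun i hi => hf i (Finset.mem_insert_of_mem hi))

theorem differentiable_ezTerm {r : ℕ} {γ : Fin r → ℂ} (hγ : ∀ j, 0 < (γ j).re)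
    (m : Fin r → ℕ) : Differentiable ℂ fun s => ezTerm γ s m := by
  intro s
  refine differentiableAt_finset_prod _ fun j _ => ?_
  have h0 : ezSum γ m j ≠ 0 := fun h => by
    have := ezSum_re_pos hγ m j
    simp [h] at this
  have h1 : DifferentiableAt ℂ (fun s : Fin r → ℂ => -s j) s := by fun_prop
  exact h1.const_cpow (Or.inl h0)

theorem differentiableAt_tsum_emTerm {γ : Fin (n + 2) → ℂ} (hγ : ∀ j, 0 < (γ j).re) {K : ℕ}
    {p : Fin (n + 2) → ℂ} (hp : p ∈ emRegion n K) :
    DifferentiableAt ℂ (fun s => ∑' m, emTerm γ K s m) p := by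
  have hγ' : ∀ j : Fin (n + 1), 0 < (γ j.castSucc).re := fun j => hγ _
  obtain ⟨ρ, hρ, g, hg, h⟩ := exists_emTerm_bound hγ hp
  obtain ⟨ρ', hρ', h'⟩ := Metric.isOpen_iff.1 (isOpen_emRegion n K) p hp
  refine differentiableAt_tsum_of_bounded (lt_min hρ hρ') hg
    (fun m s hs => h m s (Metric.ball_subset_ball (min_le_left _ _) hs)) fun m s hs => ?_
  have hs' := h' (Metric.ball_subset_ball (min_le_right _ _) hs)
  have h1 : DifferentiableAt ℂ (fun (s : Fin (n + 2) → ℂ) (j : Fin (n + 1)) => s j.castSucc) s := by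
    fun_prop
  have h2 : DifferentiableAt ℂ (fun s : Fin (n + 2) → ℂ => s (Fin.last (n + 1)) - 1) s := by
    fun_prop
  have h3 := (differentiableAt_emTail (hγ (Fin.last (n + 1)))
    (ezSum_re_pos hγ' m (Fin.last n)) hs'.1).comp s h2
  exact (((differentiable_ezTerm hγ' m) _).comp s h1).mul h3

/-- The value of the continuation given by the expansion with `K` terms, in terms of the
continuation `F` of the multiple zeta-function of smaller depth. -/
noncomputable def emValue (γ : Fin (n + 2) → ℂ) (F : (Fin (n + 1) → ℂ) → ℂ) (K : ℕ)
    (s : Fin (n + 2) → ℂ) : ℂ :=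
  (γ (Fin.last (n + 1)) * (s (Fin.last (n + 1)) - 1))⁻¹ *
    ((∑ j ∈ Finset.range K, bernCoeff j * γ (Fin.last (n + 1)) ^ j *
      (ascPochhammer ℂ j).eval (s (Fin.last (n + 1)) - 1) * F (mergeLast (j : ℂ) s)) +
      ∑' m, emTerm γ K s m)

/-- Sum `emTail_eq` over m. In this region the K-th Taylor term sums to an absolutely convergent
zeta series of smaller depth, whose value is F at the merged argument. -/
theorem emValue_succ {γ : Fin (n + 2) → ℂ} (hγ : ∀ j, 0 < (γ j).re)
    {F : (Fin (n + 1) → ℂ) → ℂ} (hF : IsMultipleZeta (fun j : Fin (n + 1) => γ j.castSucc) F)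
    {K : ℕ} {s : Fin (n + 2) → ℂ} (hs : s ∈ emRegion n K) :
    emValue γ F K s = emValue γ F (K + 1) s := by
  have hγ' : ∀ j : Fin (n + 1), 0 < (γ j.castSucc).re := fun j => hγ _
  have h1 := (hF.2 _ hs.2).mul_left (bernCoeff K * γ (Fin.last (n + 1)) ^ K *
    (ascPochhammer ℂ K).eval (s (Fin.last (n + 1)) - 1))
  have h2 := h1.add (summable_emTerm hγ (emRegion_subset_succ n K hs)).hasSum
  have h3 : emTerm γ K s = fun m => bernCoeff K * γ (Fin.last (n + 1)) ^ K *
      (ascPochhammer ℂ K).eval (s (Fin.last (n + 1)) - 1) *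
      ezTerm (fun j : Fin (n + 1) => γ j.castSucc) (mergeLast (K : ℂ) s) m +
      emTerm γ (K + 1) s m := by
    funext m
    rw [emTerm, emTail_eq (hγ _) (ezSum_re_pos hγ' m (Fin.last n)) hs.1, ezTerm_mergeLast hγ',
      emTerm]
    ring
  rw [emValue, emValue, Finset.sum_range_succ, h3, h2.tsum_eq]
  ring

theorem emValue_eq_of_le {γ : Fin (n + 2) → ℂ} (hγ : ∀ j, 0 < (γ j).re)
    {F : (Fin (n + 1) → ℂ) → ℂ} (hF : IsMultipleZeta (fun j : Fin (n + 1) => γ j.castSucc) F)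
    {K L : ℕ} (hKL : K ≤ L) {s : Fin (n + 2) → ℂ} (hs : s ∈ emRegion n K) :
    s ∈ emRegion n L ∧ emValue γ F K s = emValue γ F L s := by
  induction L, hKL using Nat.le_induction with
  | base => exact ⟨hs, rfl⟩
  | succ L _ ih => exact ⟨emRegion_subset_succ n L ih.1, ih.2.trans (emValue_succ hγ hF ih.1)⟩

theorem meromorphicNear_emValue {γ : Fin (n + 2) → ℂ} (hγ : ∀ j, 0 < (γ j).re)
    {F : (Fin (n + 1) → ℂ) → ℂ} (hF : IsMultipleZeta (fun j : Fin (n + 1) => γ j.castSucc) F)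
    {K : ℕ} {p : Fin (n + 2) → ℂ} (hp : p ∈ emRegion n K) :
    MeromorphicNear (emValue γ F K) p := by
  have hγ0 : γ (Fin.last (n + 1)) ≠ 0 := fun h => by
    have := hγ (Fin.last (n + 1))
    simp [h] at this
  refine MeromorphicNear.mul ?_ (MeromorphicNear.add (MeromorphicNear.sum _ fun j _ => ?_)
    (HolomorphicNear.meromorphicNear ?_))
  · refine ⟨fun _ => 1, fun s => γ (Fin.last (n + 1)) * (s (Fin.last (n + 1)) - 1),
      Eventually.of_forall fun _ => differentiableAt_const _,
      Eventually.of_forall fun s => by fun_prop, ?_, Eventually.of_forall fun s _ => by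
        rw [one_div]⟩
    -- Varying only the last coordinate of p gives points near p at which s_last ≠ 1.
    have ht : Tendsto (fun z : ℂ => Function.update p (Fin.last (n + 1)) z)
        (𝓝[≠] p (Fin.last (n + 1))) (𝓝 p) := by
      have : Continuous fun z : ℂ => Function.update p (Fin.last (n + 1)) z :=
        continuous_const.update _ continuous_id
      have := (this.tendsto (p (Fin.last (n + 1)))).mono_left
        (nhdsWithin_le_nhds (s := {p (Fin.last (n + 1))}ᶜ))
      rwa [Function.update_eq_self] at this
    refine ht.frequently (Eventually.frequently ?_)
    have h1 : ∀ᶠ z in 𝓝[≠] p (Fin.last (n + 1)), z ≠ 1 := by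
      by_cases h : p (Fin.last (n + 1)) = 1
      · rw [h]
        exact self_mem_nhdsWithin
      · exact mem_nhdsWithin_of_mem_nhds (isOpen_ne.mem_nhds h)
    filter_upwards [h1] with z hz
    rw [Function.update_self]
    exact mul_ne_zero hγ0 (sub_ne_zero.2 hz)
  · refine MeromorphicNear.mul (HolomorphicNear.meromorphicNear
      (Eventually.of_forall fun s => ?_))
      ((hF.1 _).comp (differentiable_mergeLast _) (isOpenMap_mergeLast _))
    have h1 : DifferentiableAt ℂ (fun s : Fin (n + 2) → ℂ => s (Fin.last (n + 1)) - 1) s := by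
      fun_prop
    exact (((ascPochhammer ℂ j).differentiable _).comp s h1).const_mul _
  · filter_upwards [(isOpen_emRegion n K).mem_nhds hp] with s hs
      using differentiableAt_tsum_emTerm hγ hs

/-- With no Taylor term, F does not enter: the value is the iterated sum with the last index summed
first, legitimate by absolute convergence. -/
theorem hasSum_emValue {γ : Fin (n + 2) → ℂ} (hγ : ∀ j, 0 < (γ j).re)
    (F : (Fin (n + 1) → ℂ) → ℂ) {s : Fin (n + 2) → ℂ} (hs : s ∈ ezRegion (n + 2)) :
    HasSum (ezTerm γ s) (emValue γ F 0 s) := by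
  have hγ' : ∀ j : Fin (n + 1), 0 < (γ j.castSucc).re := fun j => hγ _
  have h0 := (ezRegion_eq_subset_emRegion n hs).1
  have h0' : 1 < (s (Fin.last (n + 1))).re := by
    simp only [Nat.cast_zero, neg_zero, Complex.sub_re, Complex.one_re] at h0
    linarith
  have h1 := (summable_norm_ezTerm hγ hs).of_norm.hasSum
  have h2 := (((Equiv.prodComm _ _).trans
    (Fin.snocEquiv (fun _ : Fin (n + 2) => ℕ))).hasSum_iff (f := ezTerm γ s)).2 h1
  have h3 := h2.prod_fiberwise (g := fun m =>
    (γ (Fin.last (n + 1)) * (s (Fin.last (n + 1)) - 1))⁻¹ * emTerm γ 0 s m) fun m => by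
      have h4 := (hasSum_add_mul_cpow (hγ (Fin.last (n + 1)))
        (ezSum_re_pos hγ' m (Fin.last n)) h0').mul_left
        (ezTerm (fun j : Fin (n + 1) => γ j.castSucc) (fun j => s j.castSucc) m)
      have h5 : ∀ k : ℕ, (ezTerm γ s ∘ ((Equiv.prodComm _ _).trans
          (Fin.snocEquiv (fun _ : Fin (n + 2) => ℕ)))) (m, k) =
          ezTerm (fun j : Fin (n + 1) => γ j.castSucc) (fun j => s j.castSucc) m *
          (ezSum (fun j => γ j.castSucc) m (Fin.last n) + ((k : ℂ) + 1) * γ (Fin.last (n + 1))) ^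
          (-s (Fin.last (n + 1))) := fun k => ezTerm_snoc γ s m k
      simp only [h5]
      rw [emTerm, mul_left_comm]
      exact h4
  have h6 : emValue γ F 0 s = ∑' m, ezTerm γ s m := by
    rw [emValue, Finset.range_zero, Finset.sum_empty, zero_add, ← tsum_mul_left]
    exact h3.tsum_eq
  rw [h6]
  exact h1

theorem exists_isMultipleZeta_succ {γ : Fin (n + 2) → ℂ} (hγ : ∀ j, 0 < (γ j).re)
    {F : (Fin (n + 1) → ℂ) → ℂ} (hF : IsMultipleZeta (fun j : Fin (n + 1) => γ j.castSucc) F) :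
    ∃ F', IsMultipleZeta γ F' := by
  choose K hK using exists_mem_emRegion (n := n)
  have key : ∀ s L, s ∈ emRegion n L → emValue γ F (K s) s = emValue γ F L s := by
    intro s L hL
    rcases le_total (K s) L with h | h
    · exact (emValue_eq_of_le hγ hF h (hK s)).2
    · exact (emValue_eq_of_le hγ hF h hL).2.symm
  refine ⟨fun s => emValue γ F (K s) s, fun p => ?_, fun s hs => ?_⟩
  -- The index K s depends on s without any regularity. Near p the constant index K p is admissible
  -- and gives the same values.
  · refine (meromorphicNear_emValue hγ hF (hK p)).congr ?_
    filter_upwards [(isOpen_emRegion n (K p)).mem_nhds (hK p)] with s hs using (key s _ hs).symm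
  · show HasSum _ (emValue γ F (K s) s)
    rw [key s 0 (ezRegion_eq_subset_emRegion n hs)]
    exact hasSum_emValue hγ F hs

end Continuation

/-! ### Depth one, and the induction on the depth -/

theorem exists_differentiable_eq_mul_riemannZeta :
    ∃ g : ℂ → ℂ, Differentiable ℂ g ∧ ∀ s ≠ 1, riemannZeta s = g s / (s - 1) := by
  -- The residue of ζ at 1 is 1, so this value removes the singularity of (s - 1)ζ(s).
  refine ⟨Function.update (fun s => (s - 1) * riemannZeta s) 1 1, ?_, fun s hs => ?_⟩
  · rw [← differentiableOn_univ,
      ← Complex.differentiableOn_compl_singleton_and_continuousAt_iff (univ_mem (f := 𝓝 (1 : ℂ)))]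
    refine ⟨fun s hs => DifferentiableAt.differentiableWithinAt ?_,
      continuousAt_update_same.2 riemannZeta_residue_one⟩
    have hs1 : s ≠ 1 := hs.2
    have h1 : DifferentiableAt ℂ (fun s => (s - 1) * riemannZeta s) s :=
      (differentiableAt_id.sub_const 1).mul (differentiableAt_riemannZeta hs1)
    refine h1.congr_of_eventuallyEq ?_
    filter_upwards [isOpen_ne.mem_nhds hs1] with z hz using Function.update_of_ne hz _ _
  · rw [Function.update_of_ne hs, mul_div_cancel_left₀ _ (sub_ne_zero.2 hs)]

theorem exists_isMultipleZeta_one {γ : Fin 1 → ℂ} (hγ : ∀ j, 0 < (γ j).re) :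
    ∃ F, IsMultipleZeta γ F := by
  have hγ0 : γ 0 ≠ 0 := fun h => by
    have := hγ 0
    simp [h] at this
  obtain ⟨g, hg, hgz⟩ := exists_differentiable_eq_mul_riemannZeta
  refine ⟨fun s => γ 0 ^ (-s 0) * riemannZeta (s 0), fun p => ?_, fun s hs => ?_⟩
  · refine MeromorphicNear.mul (HolomorphicNear.meromorphicNear
      (Eventually.of_forall fun s => ?_)) ⟨fun s => g (s 0), fun s => s 0 - 1, ?_, ?_, ?_, ?_⟩
    · have h1 : DifferentiableAt ℂ (fun s : Fin 1 → ℂ => -s 0) s := by fun_prop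
      exact h1.const_cpow (Or.inl hγ0)
    · exact Eventually.of_forall fun s => (hg _).comp s (by fun_prop)
    · exact Eventually.of_forall fun s => by fun_prop
    · have ht : Tendsto (fun z : ℂ => (fun _ => z : Fin 1 → ℂ)) (𝓝[≠] p 0) (𝓝 p) := by
        have : Continuous fun z : ℂ => (fun _ => z : Fin 1 → ℂ) := by fun_prop
        have := (this.tendsto (p 0)).mono_left (nhdsWithin_le_nhds (s := {p 0}ᶜ))
        rwa [show (fun _ => p 0 : Fin 1 → ℂ) = p by
          funext i; rw [Subsingleton.elim i 0]] at this
      refine ht.frequently (Eventually.frequently ?_)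
      by_cases h : p 0 = 1
      · rw [h]
        filter_upwards [self_mem_nhdsWithin] with z hz using sub_ne_zero.2 hz
      · filter_upwards [mem_nhdsWithin_of_mem_nhds (isOpen_ne.mem_nhds h)] with z hz
          using sub_ne_zero.2 hz
    · exact Eventually.of_forall fun s hs => hgz _ (sub_ne_zero.1 hs)
  · have hs1 : 1 < (s 0).re := by
      have := hs 0
      rw [show Finset.Ici (0 : Fin 1) = {0} from rfl, Finset.sum_singleton] at this
      simpa using this
    show HasSum _ (γ 0 ^ (-s 0) * riemannZeta (s 0))
    rw [zeta_eq_tsum_one_div_nat_add_one_cpow hs1, ← tsum_mul_left]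
    have h1 : ∀ m : Fin 1 → ℕ, ezTerm γ s m =
        γ 0 ^ (-s 0) * (1 / ((m 0 : ℂ) + 1) ^ s 0) := by
      intro m
      have hm : (0 : ℝ) < (m 0 : ℝ) + 1 := by positivity
      have hm0 : (m 0 : ℂ) + 1 ≠ 0 := by exact_mod_cast hm.ne'
      rw [ezTerm, Fin.prod_univ_one, show Finset.Iic (0 : Fin 1) = {0} from rfl,
        Finset.sum_singleton, Complex.cpow_def_of_ne_zero (mul_ne_zero hm0 hγ0)]
      -- The principal logarithm of mγ splits as log m + log γ because m > 0 is real, so (mγ)^{-s} =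
      -- m^{-s}γ^{-s}.
      have h2 := Complex.log_ofReal_mul hm hγ0
      push_cast at h2
      rw [h2, Complex.ofReal_log hm.le, add_mul, Complex.exp_add, one_div, ← Complex.cpow_neg,
        Complex.cpow_def_of_ne_zero hγ0, Complex.cpow_def_of_ne_zero hm0]
      push_cast
      ring
    have h3 := (summable_norm_ezTerm hγ hs).of_norm.hasSum
    have h4 := (Equiv.funUnique (Fin 1) ℕ).symm.tsum_eq (ezTerm γ s)
    rw [← h4] at h3
    refine (congrArg (HasSum _) (tsum_congr fun m => ?_)).mp h3
    exact h1 _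

theorem exists_isMultipleZeta : ∀ (n : ℕ) {γ : Fin (n + 1) → ℂ}, (∀ j, 0 < (γ j).re) →
    ∃ F, IsMultipleZeta γ F
  | 0, _, hγ => exists_isMultipleZeta_one hγ
  | n + 1, γ, hγ => by
    obtain ⟨F, hF⟩ := exists_isMultipleZeta n (γ := fun j => γ j.castSucc) fun j => hγ _
    exact exists_isMultipleZeta_succ hγ hF

/-! ### The Hankel contour -/

/-- The factor `1 / ((e^{2πis} - 1) Γ(s))` in closed form. -/
noncomputable def hankelCoeff (s : ℂ) : ℂ :=
  Complex.Gamma (1 - s) * Complex.exp (-(Real.pi * Complex.I * s)) / (2 * Real.pi * Complex.I)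

/-- Combine e^{2πis} - 1 = 2i e^{πis} sin(πs) with the reflection formula Γ(s)Γ(1 - s) = π/sin(πs).
-/
theorem hankelCoeff_eq {s : ℂ} (hs : ∀ n : ℤ, s ≠ n) :
    Complex.exp (2 * Real.pi * Complex.I * s) - 1 ≠ 0 ∧
      hankelCoeff s = 1 / ((Complex.exp (2 * Real.pi * Complex.I * s) - 1) * Complex.Gamma s) := by
  have hpi : (Real.pi : ℂ) ≠ 0 := by exact_mod_cast Real.pi_ne_zero
  have h1 : Complex.exp (2 * Real.pi * Complex.I * s) - 1 ≠ 0 := by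
    intro h
    rw [sub_eq_zero, Complex.exp_eq_one_iff] at h
    obtain ⟨n, hn⟩ := h
    refine hs n ?_
    have h2 : (2 * Real.pi * Complex.I) ≠ 0 := by simp [hpi]
    exact mul_left_cancel₀ h2 (by rw [hn]; ring)
  have hG : Complex.Gamma s ≠ 0 := Complex.Gamma_ne_zero fun m h => hs (-m) (by rw [h]; push_cast; rfl)
  have h2 := Complex.Gamma_mul_Gamma_one_sub s
  have h3 : Complex.exp (2 * Real.pi * Complex.I * s) - 1 =
      2 * Complex.I * Complex.exp (Real.pi * Complex.I * s) * Complex.sin (Real.pi * s) := by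
    have e1 : Complex.exp (2 * Real.pi * Complex.I * s) =
        Complex.exp (Real.pi * Complex.I * s) * Complex.exp (Real.pi * Complex.I * s) := by
      rw [← Complex.exp_add]; congr 1; ring
    have e2 : Complex.exp (-(Real.pi * s) * Complex.I) = (Complex.exp (Real.pi * Complex.I * s))⁻¹ := by
      rw [← Complex.exp_neg]; congr 1; ring
    have e3 : Complex.exp (Real.pi * s * Complex.I) = Complex.exp (Real.pi * Complex.I * s) := by
      congr 1; ring
    rw [Complex.sin, e1, e2, e3]
    have := Complex.exp_ne_zero (Real.pi * Complex.I * s)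
    field_simp
    linear_combination ((Complex.exp (Real.pi * Complex.I * s)) ^ 2 - 1) * Complex.I_sq
  refine ⟨h1, ?_⟩
  have h4 : Complex.sin (Real.pi * s) ≠ 0 := fun h => h1 (by rw [h3, h, mul_zero])
  rw [hankelCoeff, h3, Complex.exp_neg, eq_div_iff (mul_ne_zero (h3 ▸ h1) hG)]
  have := Complex.exp_ne_zero (Real.pi * Complex.I * s)
  rw [eq_div_iff h4] at h2
  have hI := Complex.I_ne_zero
  generalize Complex.sin (Real.pi * s) = S at h2 h4 ⊢
  field_simp
  linear_combination h2

theorem eventually_ne_intCast (s : ℂ) : ∀ᶠ w : ℂ in 𝓝[≠] s, ∀ n : ℤ, w ≠ n := by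
  by_cases h : ∃ n : ℤ, s = n
  · obtain ⟨n, rfl⟩ := h
    filter_upwards [self_mem_nhdsWithin,
      mem_nhdsWithin_of_mem_nhds (Metric.ball_mem_nhds (n : ℂ) one_pos)] with w hw hb m hm
    rw [hm, Metric.mem_ball, dist_eq_norm, ← Int.cast_sub, Complex.norm_intCast] at hb
    have h1 : |m - n| < 1 := by exact_mod_cast hb
    have h2 : m = n := by
      rw [Int.abs_lt_one_iff] at h1
      linarith
    exact hw (by rw [hm, h2]; rfl)
  · push Not at h
    have h1 : IsOpen (Set.range ((↑) : ℤ → ℂ))ᶜ := Complex.isOpen_compl_range_intCast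
    have h2 : s ∈ (Set.range ((↑) : ℤ → ℂ))ᶜ := by
      rintro ⟨n, hn⟩
      exact h n hn.symm
    filter_upwards [mem_nhdsWithin_of_mem_nhds (h1.mem_nhds h2)] with w hw n hn
    exact hw ⟨n, hn.symm⟩

theorem differentiableAt_hankelCoeff {s : ℂ} (hs : ∀ n : ℕ, s ≠ (n : ℂ) + 1) :
    DifferentiableAt ℂ hankelCoeff s := by
  have h1 : DifferentiableAt ℂ Complex.Gamma (1 - s) :=
    Complex.differentiableAt_Gamma _ fun m h => hs m (by linear_combination -h)
  have h2 : DifferentiableAt ℂ (fun s : ℂ => 1 - s) s := by fun_prop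
  exact ((h1.comp s h2).mul (by fun_prop)).div_const _

/-- The closed form is holomorphic away from the positive integers, in particular at 0, -1, -2, …,
so it supplies the limit there. -/
theorem hankelFactor_eq {s : ℂ} (hs : ∀ n : ℕ, s ≠ (n : ℂ) + 1) :
    hankelFactor s = hankelCoeff s := by
  refine Tendsto.limUnder_eq ?_
  refine ((differentiableAt_hankelCoeff hs).continuousAt.tendsto.mono_left
    nhdsWithin_le_nhds).congr' ?_
  filter_upwards [eventually_ne_intCast s] with w hw using (hankelCoeff_eq hw).2

/-- A function given by its values on the two legs and the circle of the contour. -/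
theorem integrable_and_integral_legs {E : Type*} [NormedAddCommGroup E] [NormedSpace ℝ E] {ε : ℝ}
    {F A B D : ℝ → E} (h1 : ∀ u < 0, F u = A (ε - u))
    (h2 : ∀ u, 0 ≤ u → u ≤ 2 * Real.pi → F u = B u)
    (h3 : ∀ u, 2 * Real.pi < u → F u = D (ε + (u - 2 * Real.pi)))
    (hA : IntegrableOn A (Set.Ioi ε)) (hB : IntegrableOn B (Set.Icc 0 (2 * Real.pi)))
    (hD : IntegrableOn D (Set.Ioi ε)) :
    Integrable F ∧ ∫ u, F u = (∫ t in Set.Ioi ε, A t) + (∫ u in Set.Icc 0 (2 * Real.pi), B u) +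
      ∫ t in Set.Ioi ε, D t := by
  have hpi := Real.two_pi_pos
  -- Each leg becomes an indicator on the whole line, moved into place by a reflection or a
  -- translation; both preserve the integral.
  have hA' := ((integrable_indicator_iff measurableSet_Ioi).2 hA).comp_sub_left ε
  have hD' := ((integrable_indicator_iff measurableSet_Ioi).2 hD).comp_add_right (ε - 2 * Real.pi)
  have hB' := (integrable_indicator_iff measurableSet_Icc).2 hB
  have hF : F = fun u => (Set.Ioi ε).indicator A (ε - u) +
      (Set.Icc 0 (2 * Real.pi)).indicator B u +
      (Set.Ioi ε).indicator D (u + (ε - 2 * Real.pi)) := by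
    funext u
    rcases lt_or_ge u 0 with hu | hu
    · rw [h1 u hu, Set.indicator_of_mem (Set.mem_Ioi.2 (by linarith)), Set.indicator_of_notMem,
        Set.indicator_of_notMem, add_zero, add_zero]
      · simp only [Set.mem_Ioi, not_lt]; linarith
      · simp only [Set.mem_Icc, not_and_or, not_le]; exact Or.inl hu
    rcases le_or_gt u (2 * Real.pi) with hu2 | hu2
    · rw [h2 u hu hu2, Set.indicator_of_notMem, Set.indicator_of_mem (Set.mem_Icc.2 ⟨hu, hu2⟩),
        Set.indicator_of_notMem, add_zero, zero_add]
      · simp only [Set.mem_Ioi, not_lt]; linarith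
      · simp only [Set.mem_Ioi, not_lt]; linarith
    · rw [h3 u hu2, Set.indicator_of_notMem, Set.indicator_of_notMem, Set.indicator_of_mem,
        add_zero, zero_add]
      · congr 1; ring
      · simp only [Set.mem_Ioi]; linarith
      · simp only [Set.mem_Icc, not_and_or, not_le]; exact Or.inr hu2
      · simp only [Set.mem_Ioi, not_lt]; linarith
  rw [hF]
  refine ⟨(hA'.add hB').add hD', ?_⟩
  refine (integral_add (hA'.add hB') hD').trans ?_
  rw [integral_add' hA' hB',
    integral_sub_left_eq_self (fun t => (Set.Ioi ε).indicator A t),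
    integral_add_right_eq_self (fun t => (Set.Ioi ε).indicator D t),
    integral_indicator measurableSet_Ioi, integral_indicator measurableSet_Icc,
    integral_indicator measurableSet_Ioi]

theorem mem_halfStrip_of_norm_lt {η : ℝ} {T : ℂ} (h : ‖T‖ < η) : T ∈ halfStrip η :=
  ⟨by linarith [neg_abs_le T.re, Complex.abs_re_le_norm T], (Complex.abs_im_le_norm T).trans_lt h⟩

theorem ofReal_mem_halfStrip {η : ℝ} (hη : 0 < η) {t : ℝ} (ht : 0 ≤ t) :
    (t : ℂ) ∈ halfStrip η := ⟨by simp; linarith, by simpa using hη⟩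

theorem hankelPath_mem_halfStrip {ε ε' : ℝ} (hε : 0 < ε) (hε' : ε < ε') (u : ℝ) :
    hankelPath ε u ∈ halfStrip ε' := by
  unfold hankelPath
  split_ifs with h1 h2
  · exact ofReal_mem_halfStrip (hε.trans hε') (by linarith)
  · refine mem_halfStrip_of_norm_lt ?_
    rw [norm_mul, mul_comm Complex.I, Complex.norm_exp_ofReal_mul_I, mul_one, Complex.norm_real,
      Real.norm_of_nonneg hε.le]
    exact hε'
  · exact ofReal_mem_halfStrip (hε.trans hε') (by linarith)

/-- Expand f in its power series and compare term by term: on the circle t^{n+s-1} integrates to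
(e^{2πis} - 1) ε^{n+s}/(n+s), and on the segment to ε^{n+s}/(n+s). No contour deformation across the
branch cut is needed. -/
theorem circle_integral_eq {ε ε' : ℝ} (hε : 0 < ε) (hε' : ε < ε') {f : ℂ → ℂ}
    (hf : DifferentiableOn ℂ f (Metric.ball 0 ε')) {s : ℂ} (hs : 0 < s.re) :
    ∫ u in (0 : ℝ)..2 * Real.pi, f (ε * Complex.exp (Complex.I * u)) *
      (Complex.exp ((s - 1) * ((Real.log ε : ℝ) + Complex.I * u)) *
        (Complex.I * ε * Complex.exp (Complex.I * u))) =
      (Complex.exp (2 * Real.pi * Complex.I * s) - 1) *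
        ∫ t in (0 : ℝ)..ε, f t * (t : ℂ) ^ (s - 1) := by
  have hεc : (ε : ℂ) ≠ 0 := by exact_mod_cast hε.ne'
  have hlog : Complex.exp (Real.log ε : ℝ) = ε := by
    rw [← Complex.ofReal_exp, Real.exp_log hε]
  obtain ⟨a, ha⟩ : ∃ a : ℕ → ℂ, ∀ z ∈ Metric.ball (0 : ℂ) ε', HasSum (fun n => a n * z ^ n) (f z) := by
    refine ⟨fun n => (n.factorial : ℂ)⁻¹ * iteratedDeriv n f 0, fun z hz => ?_⟩
    have := Complex.hasSum_taylorSeries_on_ball hf hz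
    refine this.congr_fun fun n => ?_
    simp only [smul_eq_mul, sub_zero]
    ring
  have hεb : (ε : ℂ) ∈ Metric.ball (0 : ℂ) ε' := by
    rw [mem_ball_zero_iff, Complex.norm_real, Real.norm_of_nonneg hε.le]
    exact hε'
  have hsum : Summable fun n => ‖a n‖ * ε ^ n := by
    refine (ha ε hεb).summable.norm.congr fun n => ?_
    rw [norm_mul, norm_pow, Complex.norm_real, Real.norm_of_nonneg hε.le]
  have hne : ∀ n : ℕ, (n : ℂ) + s ≠ 0 := fun n h => by
    have := congrArg Complex.re h
    simp at this
    have : (0 : ℝ) ≤ n := Nat.cast_nonneg n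
    linarith
  have hseg : HasSum (fun n : ℕ => a n * (ε : ℂ) ^ ((n : ℂ) + s) / ((n : ℂ) + s))
      (∫ t in (0 : ℝ)..ε, f t * (t : ℂ) ^ (s - 1)) := by
    have h1 := intervalIntegral.hasSum_integral_of_dominated_convergence (μ := volume)
      (a := 0) (b := ε) (F := fun (n : ℕ) (t : ℝ) => a n * (t : ℂ) ^ n * (t : ℂ) ^ (s - 1))
      (f := fun t : ℝ => f t * (t : ℂ) ^ (s - 1))
      (fun n t => ‖a n‖ * ε ^ n * t ^ (s.re - 1)) ?_ ?_ ?_ ?_ ?_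
    · refine h1.congr_fun fun n => ?_
      have h2 : ∀ t ∈ Set.Ioc (0 : ℝ) ε, a n * (t : ℂ) ^ n * (t : ℂ) ^ (s - 1) =
          a n * (t : ℂ) ^ ((n : ℂ) + s - 1) := by
        intro t ht
        have ht0 : (t : ℂ) ≠ 0 := by exact_mod_cast ht.1.ne'
        rw [mul_assoc, ← Complex.cpow_natCast, ← Complex.cpow_add _ _ ht0]
        congr 2
        ring
      rw [intervalIntegral.integral_of_le hε.le, setIntegral_congr_fun measurableSet_Ioc h2,
        ← intervalIntegral.integral_of_le hε.le, intervalIntegral.integral_const_mul, integral_cpow,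
        sub_add_cancel, Complex.ofReal_zero, Complex.zero_cpow (hne n), sub_zero, mul_div_assoc]
      left
      simp only [Complex.sub_re, Complex.add_re, Complex.natCast_re, Complex.one_re]
      have : (0 : ℝ) ≤ n := Nat.cast_nonneg n
      linarith
    · intro n
      rw [Set.uIoc_of_le hε.le]
      refine ContinuousOn.aestronglyMeasurable (fun t ht => ?_) measurableSet_Ioc
      have h2 : ContinuousAt (fun t : ℝ => (t : ℂ) ^ (s - 1)) t :=
        (continuousAt_cpow_const (Or.inl (by simpa using ht.1))).comp
          Complex.continuous_ofReal.continuousAt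
      have h3 : Continuous fun t : ℝ => a n * (t : ℂ) ^ n := by fun_prop
      exact (h3.continuousAt.mul h2).continuousWithinAt
    · intro n
      refine Eventually.of_forall fun t ht => ?_
      rw [Set.uIoc_of_le hε.le] at ht
      rw [norm_mul, norm_mul, norm_pow, Complex.norm_cpow_eq_rpow_re_of_pos ht.1,
        Complex.norm_real, Real.norm_of_nonneg ht.1.le, Complex.sub_re, Complex.one_re]
      have := Real.rpow_nonneg ht.1.le (s.re - 1)
      have := ht.2
      have := ht.1.le
      gcongr
    · exact Eventually.of_forall fun t _ => hsum.mul_right _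
    · simp only [tsum_mul_right]
      exact (intervalIntegral.intervalIntegrable_rpow' (by linarith)).const_mul _
    · refine Eventually.of_forall fun t ht => ?_
      rw [Set.uIoc_of_le hε.le] at ht
      refine (ha t ?_).mul_right _
      rw [mem_ball_zero_iff, Complex.norm_real, Real.norm_of_nonneg ht.1.le]
      exact ht.2.trans_lt hε'
  have hcirc : HasSum (fun n : ℕ => (Complex.exp (2 * Real.pi * Complex.I * s) - 1) *
      (a n * (ε : ℂ) ^ ((n : ℂ) + s) / ((n : ℂ) + s)))
      (∫ u in (0 : ℝ)..2 * Real.pi, f (ε * Complex.exp (Complex.I * u)) *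
      (Complex.exp ((s - 1) * ((Real.log ε : ℝ) + Complex.I * u)) *
        (Complex.I * ε * Complex.exp (Complex.I * u)))) := by
    have hmem : ∀ u : ℝ, (ε : ℂ) * Complex.exp (Complex.I * u) ∈ Metric.ball (0 : ℂ) ε' := by
      intro u
      rw [mem_ball_zero_iff, norm_mul, mul_comm Complex.I, Complex.norm_exp_ofReal_mul_I, mul_one,
        Complex.norm_real, Real.norm_of_nonneg hε.le]
      exact hε'
    have h1 := intervalIntegral.hasSum_integral_of_dominated_convergence (μ := volume)
      (a := 0) (b := 2 * Real.pi) (F := fun (n : ℕ) (u : ℝ) =>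
        (a n * (ε * Complex.exp (Complex.I * u)) ^ n) *
        (Complex.exp ((s - 1) * ((Real.log ε : ℝ) + Complex.I * u)) *
        (Complex.I * ε * Complex.exp (Complex.I * u))))
      (f := fun u : ℝ => f (ε * Complex.exp (Complex.I * u)) *
        (Complex.exp ((s - 1) * ((Real.log ε : ℝ) + Complex.I * u)) *
        (Complex.I * ε * Complex.exp (Complex.I * u))))
      (fun n u => ‖a n‖ * ε ^ n * ‖Complex.exp ((s - 1) * ((Real.log ε : ℝ) + Complex.I * u)) *
        (Complex.I * ε * Complex.exp (Complex.I * u))‖) ?_ ?_ ?_ ?_ ?_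
    · refine h1.congr_fun fun n => ?_
      have h2 : ∀ u : ℝ, (a n * (ε * Complex.exp (Complex.I * u)) ^ n) *
          (Complex.exp ((s - 1) * ((Real.log ε : ℝ) + Complex.I * u)) *
          (Complex.I * ε * Complex.exp (Complex.I * u))) =
          (a n * (ε : ℂ) ^ ((n : ℂ) + s) * Complex.I) *
            Complex.exp (Complex.I * ((n : ℂ) + s) * u) := by
        intro u
        have e1 : (ε * Complex.exp (Complex.I * u)) ^ n =
            Complex.exp (n * (Real.log ε : ℝ)) * Complex.exp (n * (Complex.I * u)) := by
          rw [mul_pow, Complex.exp_nat_mul, Complex.exp_nat_mul, hlog]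
        have e2 : (ε : ℂ) ^ ((n : ℂ) + s) = Complex.exp ((Real.log ε : ℝ) * ((n : ℂ) + s)) := by
          rw [Complex.cpow_def_of_ne_zero hεc, Complex.ofReal_log hε.le]
        have e3 : Complex.I * (ε : ℂ) * Complex.exp (Complex.I * u) =
            Complex.I * (Complex.exp (Real.log ε : ℝ) * Complex.exp (Complex.I * u)) := by
          rw [hlog]; ring
        rw [e1, e2, e3]
        calc _ = a n * Complex.I * (Complex.exp (n * (Real.log ε : ℝ)) *
              Complex.exp (n * (Complex.I * u)) *
              (Complex.exp ((s - 1) * ((Real.log ε : ℝ) + Complex.I * u)) *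
              (Complex.exp (Real.log ε : ℝ) * Complex.exp (Complex.I * u)))) := by ring
          _ = a n * Complex.I * (Complex.exp ((Real.log ε : ℝ) * ((n : ℂ) + s)) *
              Complex.exp (Complex.I * ((n : ℂ) + s) * u)) := by
              simp only [← Complex.exp_add]
              congr 2
              ring
          _ = _ := by ring
      have hI : Complex.I * ((n : ℂ) + s) ≠ 0 := mul_ne_zero Complex.I_ne_zero (hne n)
      have h3 : Complex.exp (Complex.I * ((n : ℂ) + s) * ((2 * Real.pi : ℝ) : ℂ)) =
          Complex.exp (2 * Real.pi * Complex.I * s) := by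
        rw [show Complex.I * ((n : ℂ) + s) * ((2 * Real.pi : ℝ) : ℂ) =
          2 * Real.pi * Complex.I * s + n * (2 * Real.pi * Complex.I) by push_cast; ring,
          Complex.exp_add, Complex.exp_nat_mul_two_pi_mul_I, mul_one]
      simp only [h2]
      rw [intervalIntegral.integral_const_mul, integral_exp_mul_complex hI, h3, Complex.ofReal_zero,
        mul_zero, Complex.exp_zero]
      have := hne n
      have := Complex.I_ne_zero
      field_simp
    · intro n
      refine Continuous.aestronglyMeasurable ?_
      fun_prop
    · intro n
      refine Eventually.of_forall fun u _ => le_of_eq ?_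
      rw [norm_mul, norm_mul, norm_pow, norm_mul (ε : ℂ), mul_comm Complex.I (u : ℂ),
        Complex.norm_exp_ofReal_mul_I, mul_one, Complex.norm_real, Real.norm_of_nonneg hε.le]
    · exact Eventually.of_forall fun u _ => hsum.mul_right _
    · simp only [tsum_mul_right]
      refine Continuous.intervalIntegrable ?_ _ _
      fun_prop
    · exact Eventually.of_forall fun u _ => (ha _ (hmem u)).mul_right _
  exact hcirc.unique (hseg.mul_left _)

theorem norm_mul_cpow_sub_one {t : ℝ} (ht : 0 < t) (z s : ℂ) :
    ‖z * (t : ℂ) ^ (s - 1)‖ = ‖z‖ * t ^ (s.re - 1) := by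
  rw [norm_mul, Complex.norm_cpow_eq_rpow_re_of_pos ht, Complex.sub_re, Complex.one_re]

theorem integrableOn_mul_cpow {ε' : ℝ} (hε' : 0 < ε') {f : ℂ → ℂ}
    (hf : DifferentiableOn ℂ f (halfStrip ε')) {C a : ℝ} (ha : 0 < a)
    (hC : ∀ z ∈ halfStrip ε', ‖f z‖ ≤ C * Real.exp (-a * z.re)) {s : ℂ} (hs : 0 < s.re) :
    IntegrableOn (fun t : ℝ => f t * (t : ℂ) ^ (s - 1)) (Set.Ioi 0) := by
  refine Integrable.mono' ((integrableOn_rpow_mul_exp hs ha).const_mul C) ?_ ?_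
  · refine ContinuousOn.aestronglyMeasurable (fun t ht => ?_) measurableSet_Ioi
    have h1 : ContinuousAt (fun t : ℝ => (t : ℂ) ^ (s - 1)) t :=
      (continuousAt_cpow_const (Or.inl (by simpa using ht))).comp
        Complex.continuous_ofReal.continuousAt
    have h2 : ContinuousAt (fun t : ℝ => f t) t :=
      ((hf.differentiableAt ((isOpen_halfStrip ε').mem_nhds
        (ofReal_mem_halfStrip hε' (le_of_lt ht)))).continuousAt).comp
        Complex.continuous_ofReal.continuousAt
    exact (h2.mul h1).continuousWithinAt
  · refine (ae_restrict_mem measurableSet_Ioi).mono fun t ht => ?_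
    rw [norm_mul_cpow_sub_one ht]
    have h1 := hC t (ofReal_mem_halfStrip hε' (le_of_lt ht))
    rw [Complex.ofReal_re] at h1
    have := Real.rpow_nonneg (le_of_lt ht) (s.re - 1)
    calc _ ≤ C * Real.exp (-a * t) * t ^ (s.re - 1) := by gcongr
      _ = _ := by rw [neg_mul]; ring

/-- The incoming leg has sign -1 and the outgoing leg the factor e^{2πis}, so together they give
(e^{2πis} - 1) times the integral over (ε, ∞). The circle contributes the same multiple of the
missing part (0, ε]. -/
theorem hankel_integral_eq {ε ε' : ℝ} (hε : 0 < ε) (hε' : ε < ε') {f : ℂ → ℂ}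
    (hf : DifferentiableOn ℂ f (halfStrip ε')) {C a : ℝ} (ha : 0 < a)
    (hC : ∀ z ∈ halfStrip ε', ‖f z‖ ≤ C * Real.exp (-a * z.re)) {s : ℂ} (hs : 0 < s.re) :
    ∫ u, f (hankelPath ε u) *
      (Complex.exp ((s - 1) * hankelLog ε u) * hankelVelocity ε u) =
      (Complex.exp (2 * Real.pi * Complex.I * s) - 1) *
        ∫ t in Set.Ioi (0 : ℝ), f t * (t : ℂ) ^ (s - 1) := by
  have hpi := Real.two_pi_pos
  have hint := integrableOn_mul_cpow (hε.trans hε') hf ha hC hs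
  have hball : DifferentiableOn ℂ f (Metric.ball 0 ε') :=
    hf.mono fun z hz => mem_halfStrip_of_norm_lt (by simpa using hz)
  have hintε : IntegrableOn (fun t : ℝ => f t * (t : ℂ) ^ (s - 1)) (Set.Ioi ε) :=
    hint.mono_set (Set.Ioi_subset_Ioi hε.le)
  have hexp : ∀ t : ℝ, ε < t → Complex.exp ((s - 1) * (Real.log t : ℝ)) = (t : ℂ) ^ (s - 1) := by
    intro t ht
    have ht0 : 0 < t := hε.trans ht
    have : (t : ℂ) ≠ 0 := by exact_mod_cast ht0.ne'
    rw [Complex.cpow_def_of_ne_zero this, Complex.ofReal_log ht0.le, mul_comm]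
  have key := integrable_and_integral_legs (ε := ε)
    (F := fun u => f (hankelPath ε u) *
      (Complex.exp ((s - 1) * hankelLog ε u) * hankelVelocity ε u))
    (A := fun t => -(f t * (t : ℂ) ^ (s - 1)))
    (B := fun u => f (ε * Complex.exp (Complex.I * u)) *
      (Complex.exp ((s - 1) * ((Real.log ε : ℝ) + Complex.I * u)) *
        (Complex.I * ε * Complex.exp (Complex.I * u))))
    (D := fun t => Complex.exp (2 * Real.pi * Complex.I * s) * (f t * (t : ℂ) ^ (s - 1)))
    (fun u hu => ?_) (fun u hu hu2 => ?_) (fun u hu => ?_) hintε.neg ?_ (hintε.const_mul _)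
  · rw [key.2, integral_neg, integral_const_mul, integral_Icc_eq_integral_Ioc,
      ← intervalIntegral.integral_of_le hpi.le, circle_integral_eq hε hε' hball hs,
      intervalIntegral.integral_of_le hε.le]
    rw [← Set.Ioc_union_Ioi_eq_Ioi hε.le, setIntegral_union (Set.Ioc_disjoint_Ioi le_rfl)
      measurableSet_Ioi (hint.mono_set Set.Ioc_subset_Ioi_self) hintε]
    ring
  · have h1 : ε < ε - u := by linarith
    simp only [hankelPath, hankelLog, hankelVelocity, if_pos hu]
    rw [hexp _ h1]
    ring
  · simp only [hankelPath, hankelLog, hankelVelocity, if_neg hu.not_gt, if_pos hu2]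
  · have h0 : ¬ u < 0 := by linarith
    have h1 : ε < ε + (u - 2 * Real.pi) := by linarith
    simp only [hankelPath, hankelLog, hankelVelocity, if_neg h0, if_neg hu.not_ge]
    rw [mul_add, Complex.exp_add, hexp _ h1]
    have h2 : Complex.exp ((s - 1) * (2 * Real.pi * Complex.I)) =
        Complex.exp (2 * Real.pi * Complex.I * s) := by
      rw [show (s - 1) * (2 * Real.pi * Complex.I) =
        2 * Real.pi * Complex.I * s - 2 * Real.pi * Complex.I by ring, Complex.exp_sub,
        Complex.exp_two_pi_mul_I, div_one]
    rw [h2]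
    ring
  · refine ContinuousOn.integrableOn_compact isCompact_Icc (Continuous.continuousOn ?_)
    have h1 : Continuous fun u : ℝ => f (ε * Complex.exp (Complex.I * u)) := by
      refine continuous_iff_continuousAt.2 fun u => ?_
      have hmem : (ε : ℂ) * Complex.exp (Complex.I * u) ∈ Metric.ball (0 : ℂ) ε' := by
        rw [mem_ball_zero_iff, norm_mul, mul_comm Complex.I, Complex.norm_exp_ofReal_mul_I, mul_one,
          Complex.norm_real, Real.norm_of_nonneg hε.le]
        exact hε'
      have h2 : Continuous fun u : ℝ => (ε : ℂ) * Complex.exp (Complex.I * u) := by fun_prop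
      exact ContinuousAt.comp (f := fun u : ℝ => (ε : ℂ) * Complex.exp (Complex.I * u))
        (hball.differentiableAt (Metric.isOpen_ball.mem_nhds hmem)).continuousAt h2.continuousAt
    exact h1.mul (by fun_prop)

/-! ### Contour integrals in several variables -/

/-- The point at the parameter `u` of the Hankel contour (`b = true`) or of the positive real
half-line (`b = false`). -/
noncomputable def ctrPoint (ε : ℝ) (b : Bool) (u : ℝ) : ℂ :=
  if b then hankelPath ε u else ((|u| : ℝ) : ℂ)

/-- The corresponding density. -/
noncomputable def ctrWeight (ε : ℝ) (b : Bool) (s : ℂ) (u : ℝ) : ℂ :=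
  if b then hankelCoeff s * (Complex.exp ((s - 1) * hankelLog ε u) * hankelVelocity ε u)
  else if 0 < u then (Complex.Gamma s)⁻¹ * (u : ℂ) ^ (s - 1) else 0

/-- The exponents for which the contour can be used. -/
def ctrValid (b : Bool) : Set ℂ :=
  if b then {s | ∀ n : ℕ, s ≠ (n : ℂ) + 1} else {s | 0 < s.re}

theorem isOpen_ctrValid (b : Bool) : IsOpen (ctrValid b) := by
  cases b with
  | false => exact isOpen_lt continuous_const Complex.continuous_re
  | true =>
    have h1 : IsClosed (Set.range fun n : ℕ => (n : ℂ) + 1) := by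
      refine Metric.isClosed_of_pairwise_le_dist one_pos ?_
      rintro _ ⟨m, rfl⟩ _ ⟨n, rfl⟩ hne
      rw [dist_eq_norm, add_sub_add_right_eq_sub]
      have h2 : ‖(m : ℂ) - n‖ = |(((m : ℤ) - n : ℤ) : ℝ)| := by
        rw [← Complex.norm_intCast]
        push_cast
        rfl
      rw [h2]
      have h3 : (m : ℤ) - n ≠ 0 := fun h => hne (by
        have : m = n := by omega
        rw [this])
      exact_mod_cast Int.one_le_abs h3
    have h2 : ctrValid true = (Set.range fun n : ℕ => (n : ℂ) + 1)ᶜ := by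
      ext s
      simp only [ctrValid, if_true, Set.mem_compl_iff, Set.mem_range, not_exists]
      exact forall_congr' fun n => ne_comm
    rw [h2]
    exact h1.isOpen_compl

theorem measurable_hankelPath (ε : ℝ) : Measurable (hankelPath ε) := by
  unfold hankelPath
  refine Measurable.ite measurableSet_Iio (by fun_prop)
    (Measurable.ite measurableSet_Iic (by fun_prop) (by fun_prop))

theorem measurable_hankelLog (ε : ℝ) : Measurable (hankelLog ε) := by
  unfold hankelLog
  refine Measurable.ite measurableSet_Iio (by fun_prop)
    (Measurable.ite measurableSet_Iic (by fun_prop) (by fun_prop))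

theorem measurable_hankelVelocity (ε : ℝ) : Measurable (hankelVelocity ε) := by
  unfold hankelVelocity
  refine Measurable.ite measurableSet_Iio (by fun_prop)
    (Measurable.ite measurableSet_Iic (by fun_prop) (by fun_prop))

theorem measurable_ctrPoint (ε : ℝ) (b : Bool) : Measurable (ctrPoint ε b) := by
  cases b with
  | false =>
    have : ctrPoint ε false = fun u => ((|u| : ℝ) : ℂ) := by
      funext u
      simp [ctrPoint]
    rw [this]
    exact Complex.measurable_ofReal.comp continuous_abs.measurable
  | true => exact measurable_hankelPath ε

theorem measurable_ctrWeight (ε : ℝ) (b : Bool) (s : ℂ) : Measurable (ctrWeight ε b s) := by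
  cases b with
  | false =>
    have : ctrWeight ε false s =
        fun u : ℝ => if 0 < u then (Complex.Gamma s)⁻¹ * (u : ℂ) ^ (s - 1) else 0 := by
      funext u
      simp [ctrWeight]
    rw [this]
    exact Measurable.ite measurableSet_Ioi (by fun_prop) measurable_const
  | true =>
    have h1 := measurable_hankelLog ε
    have h2 := measurable_hankelVelocity ε
    have : ctrWeight ε true s = fun u =>
        hankelCoeff s * (Complex.exp ((s - 1) * hankelLog ε u) * hankelVelocity ε u) := by
      funext u
      simp [ctrWeight]
    rw [this]
    fun_prop

/-- On the half-line the parameter enters as |u|, so the point stays in the strip even for u ≤ 0,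
where the weight is zero. The estimates then hold for every u. -/
theorem ctrPoint_mem_halfStrip {ε ε' : ℝ} (hε : 0 < ε) (hε' : ε < ε') (b : Bool) (u : ℝ) :
    ctrPoint ε b u ∈ halfStrip ε' := by
  cases b with
  | false => exact ofReal_mem_halfStrip (hε.trans hε') (abs_nonneg u)
  | true => exact hankelPath_mem_halfStrip hε hε' u

theorem differentiableAt_ctrWeight {ε : ℝ} {b : Bool} {s : ℂ} (hs : s ∈ ctrValid b) (u : ℝ) :
    DifferentiableAt ℂ (fun s => ctrWeight ε b s u) s := by
  cases b with
  | false =>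
    simp only [ctrWeight, Bool.false_eq_true, if_false]
    by_cases hu : 0 < u
    · simp only [if_pos hu]
      have hu0 : (u : ℂ) ≠ 0 := by exact_mod_cast hu.ne'
      have h1 : DifferentiableAt ℂ (fun s : ℂ => s - 1) s := by fun_prop
      exact (Complex.differentiable_one_div_Gamma s).mul (h1.const_cpow (Or.inl hu0))
    · simp only [if_neg hu]
      exact differentiableAt_const _
  | true =>
    simp only [ctrWeight, if_true]
    exact (differentiableAt_hankelCoeff hs).mul (by fun_prop)

/-- A majorant of the integrands on the Hankel contour. -/
theorem exists_hankel_majorant {ε a A : ℝ} (hε : 0 < ε) (ha : 0 < a) (hA : 0 < A) :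
    ∃ g : ℝ → ℝ, Integrable g ∧ ∀ s : ℂ, ‖s‖ ≤ A → ∀ u,
      ‖Complex.exp ((s - 1) * hankelLog ε u) * hankelVelocity ε u‖ *
        Real.exp (-a * (hankelPath ε u).re) ≤ g u := by
  have hpi := Real.two_pi_pos
  -- On the contour |t| ≥ ε, so passing from the exponent Re s - 1 to A - 1 costs at most the first
  -- factor. The second bounds e^{-θ Im s} for arguments θ up to 2π.
  set C := Real.exp (2 * A * |Real.log ε|) * Real.exp (2 * Real.pi * A) with hC
  have hC0 : 0 < C := by positivity
  have hleg : IntegrableOn (fun t : ℝ => C * (t ^ (A - 1) * Real.exp (-(a * t)))) (Set.Ioi ε) :=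
    ((integrableOn_rpow_mul_exp hA ha).mono_set (Set.Ioi_subset_Ioi hε.le)).const_mul C
  set B := C * (ε ^ (A - 1) * ε) * Real.exp (a * ε) with hB
  have key : ∀ s : ℂ, ‖s‖ ≤ A → ∀ t θ : ℝ, ε ≤ t → |θ| ≤ 2 * Real.pi →
      ‖Complex.exp ((s - 1) * (((Real.log t : ℝ) : ℂ) + Complex.I * θ))‖ ≤ C * t ^ (A - 1) := by
    intro s hs t θ ht hθ
    have ht0 : 0 < t := hε.trans_le ht
    have h1 : ((s - 1) * (((Real.log t : ℝ) : ℂ) + Complex.I * θ)).re =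
        (s.re - 1) * Real.log t - s.im * θ := by
      simp
    have h2 : -(s.im * θ) ≤ 2 * Real.pi * A := by
      refine (neg_le_abs _).trans ?_
      rw [abs_mul, mul_comm]
      exact mul_le_mul hθ ((Complex.abs_im_le_norm s).trans hs) (abs_nonneg _) hpi.le
    have h3 : (s.re - A) * Real.log t ≤ 2 * A * |Real.log ε| := by
      have h4 : Real.log ε ≤ Real.log t := Real.log_le_log hε ht
      have h5 := abs_le.1 ((Complex.abs_re_le_norm s).trans hs)
      have h6 : 0 ≤ A - s.re := by linarith
      have h7 := mul_le_mul_of_nonneg_left h4 h6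
      have h8 := neg_abs_le (Real.log ε)
      have h9 := mul_le_mul_of_nonneg_left h8 h6
      have h10 : (A - s.re) * |Real.log ε| ≤ 2 * A * |Real.log ε| :=
        mul_le_mul_of_nonneg_right (by linarith) (abs_nonneg _)
      linarith
    rw [Complex.norm_exp, h1, hC, Real.rpow_def_of_pos ht0, ← Real.exp_add, ← Real.exp_add,
      Real.exp_le_exp]
    linarith
  refine ⟨fun u => if u < 0 then C * ((ε - u) ^ (A - 1) * Real.exp (-(a * (ε - u)))) else
    if u ≤ 2 * Real.pi then B else C * ((ε + (u - 2 * Real.pi)) ^ (A - 1) *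
      Real.exp (-(a * (ε + (u - 2 * Real.pi))))), ?_, fun s hs u => ?_⟩
  · refine (integrable_and_integral_legs (ε := ε)
      (A := fun t : ℝ => C * (t ^ (A - 1) * Real.exp (-(a * t)))) (B := fun _ => B)
      (D := fun t : ℝ => C * (t ^ (A - 1) * Real.exp (-(a * t))))
      (fun u hu => ?_) (fun u hu hu2 => ?_) (fun u hu => ?_) hleg ?_ hleg).1
    · simp only [if_pos hu]
    · simp only [if_neg hu.not_gt, if_pos hu2]
    · have h0 : ¬ u < 0 := by linarith
      simp only [if_neg h0, if_neg hu.not_ge]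
    · exact continuousOn_const.integrableOn_compact isCompact_Icc
  · rcases lt_or_ge u 0 with hu | hu
    · simp only [hankelPath, hankelLog, hankelVelocity, if_pos hu]
      have h1 := key s hs (ε - u) 0 (by linarith) (by simpa using hpi.le)
      simp only [Complex.ofReal_zero, mul_zero, add_zero] at h1
      rw [norm_mul, norm_neg, norm_one, mul_one, Complex.ofReal_re, neg_mul]
      calc _ ≤ (C * (ε - u) ^ (A - 1)) * Real.exp (-(a * (ε - u))) := by gcongr
        _ = _ := by ring
    rcases le_or_gt u (2 * Real.pi) with hu2 | hu2
    · simp only [hankelPath, hankelLog, hankelVelocity, if_neg hu.not_gt, if_pos hu2]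
      have h1 := key s hs ε u le_rfl (by rwa [abs_of_nonneg hu])
      have h2 : ‖Complex.I * ε * Complex.exp (Complex.I * u)‖ = ε := by
        rw [norm_mul, norm_mul, Complex.norm_I, one_mul, mul_comm Complex.I,
          Complex.norm_exp_ofReal_mul_I, mul_one, Complex.norm_real, Real.norm_of_nonneg hε.le]
      have h3 : -ε ≤ ((ε : ℂ) * Complex.exp (Complex.I * u)).re := by
        have h4 : ‖(ε : ℂ) * Complex.exp (Complex.I * u)‖ = ε := by
          rw [norm_mul, mul_comm Complex.I, Complex.norm_exp_ofReal_mul_I, mul_one,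
            Complex.norm_real, Real.norm_of_nonneg hε.le]
        have h5 := Complex.abs_re_le_norm ((ε : ℂ) * Complex.exp (Complex.I * u))
        rw [h4] at h5
        exact (abs_le.1 h5).1
      rw [norm_mul, h2, hB]
      calc _ ≤ (C * ε ^ (A - 1) * ε) * Real.exp (a * ε) := by
            refine mul_le_mul (mul_le_mul_of_nonneg_right h1 hε.le)
              (Real.exp_le_exp.2 ?_) (Real.exp_pos _).le (by positivity)
            have := mul_le_mul_of_nonneg_left h3 ha.le
            linarith
        _ = _ := by ring
    · have h0 : ¬ u < 0 := by linarith
      simp only [hankelPath, hankelLog, hankelVelocity, if_neg h0, if_neg hu2.not_ge]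
      have h1 := key s hs (ε + (u - 2 * Real.pi)) (2 * Real.pi) (by linarith)
        (by rw [abs_of_pos hpi])
      have h2 : Complex.I * ((2 * Real.pi : ℝ) : ℂ) = 2 * Real.pi * Complex.I := by
        push_cast; ring
      rw [h2] at h1
      rw [norm_mul, norm_one, mul_one, Complex.ofReal_re, neg_mul]
      calc _ ≤ (C * (ε + (u - 2 * Real.pi)) ^ (A - 1)) *
            Real.exp (-(a * (ε + (u - 2 * Real.pi)))) := by gcongr
        _ = _ := by ring

theorem exists_ctrWeight_bound {ε a : ℝ} (hε : 0 < ε) (ha : 0 < a) {b : Bool} {p : ℂ}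
    (hp : p ∈ ctrValid b) : ∃ ρ > 0, ∃ g : ℝ → ℝ, Integrable g ∧ ∀ s ∈ Metric.ball p ρ,
      s ∈ ctrValid b ∧ ∀ u, ‖ctrWeight ε b s u‖ * Real.exp (-a * (ctrPoint ε b u).re) ≤ g u := by
  obtain ⟨ρ₁, hρ₁, H₁⟩ := Metric.isOpen_iff.1 (isOpen_ctrValid b) p hp
  cases b with
  | false =>
    have hp' : 0 < p.re := hp
    obtain ⟨ρ₂, hρ₂, H₂⟩ := Metric.eventually_nhds_iff_ball.1
      (Complex.differentiable_one_div_Gamma.continuous.continuousAt.norm.eventually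
        (gt_mem_nhds (lt_add_one (‖(Complex.Gamma p)⁻¹‖))))
    set C := ‖(Complex.Gamma p)⁻¹‖ + 1 with hC
    refine ⟨min (min ρ₁ ρ₂) (p.re / 2), by positivity, (Set.Ioi 0).indicator fun t =>
      C * (t ^ (p.re / 2 - 1) * Real.exp (-(a * t)) +
        t ^ (3 * p.re / 2 - 1) * Real.exp (-(a * t))), ?_, fun s hs => ⟨H₁ ?_, fun u => ?_⟩⟩
    · rw [integrable_indicator_iff measurableSet_Ioi]
      exact ((integrableOn_rpow_mul_exp (half_pos hp') ha).add
        (integrableOn_rpow_mul_exp (x := 3 * p.re / 2) (by positivity) ha)).const_mul C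
    · exact Metric.ball_subset_ball ((min_le_left _ _).trans (min_le_left _ _)) hs
    · simp only [ctrWeight, ctrPoint, Bool.false_eq_true, if_false]
      rcases lt_or_ge 0 u with hu | hu
      · rw [if_pos hu, Set.indicator_of_mem (Set.mem_Ioi.2 hu), norm_mul_cpow_sub_one hu,
          abs_of_pos hu, Complex.ofReal_re, neg_mul]
        have h2 := (H₂ s (Metric.ball_subset_ball
          ((min_le_left _ _).trans (min_le_right _ _)) hs)).le
        have h3 : |(s - p).re| < p.re / 2 := by
          refine (Complex.abs_re_le_norm _).trans_lt ?_
          rw [← dist_eq_norm]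
          exact (Metric.mem_ball.1 hs).trans_le (min_le_right _ _)
        rw [abs_lt, Complex.sub_re] at h3
        have h4 := Real.rpow_nonneg hu.le (p.re / 2 - 1)
        have h5 := Real.rpow_nonneg hu.le (3 * p.re / 2 - 1)
        have h6 : u ^ (s.re - 1) ≤ u ^ (p.re / 2 - 1) + u ^ (3 * p.re / 2 - 1) := by
          rcases le_or_gt 1 u with h | h
          · have := Real.rpow_le_rpow_of_exponent_le h
              (show s.re - 1 ≤ 3 * p.re / 2 - 1 by linarith)
            linarith
          · have := Real.rpow_le_rpow_of_exponent_ge hu h.le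
              (show p.re / 2 - 1 ≤ s.re - 1 by linarith)
            linarith
        have h7 := Real.rpow_nonneg hu.le (s.re - 1)
        calc _ ≤ (C * (u ^ (p.re / 2 - 1) + u ^ (3 * p.re / 2 - 1))) *
              Real.exp (-(a * u)) := by gcongr
          _ = _ := by ring
      · rw [if_neg hu.not_gt, norm_zero, zero_mul, Set.indicator_of_notMem]
        simpa using hu
  | true =>
    obtain ⟨ρ₂, hρ₂, H₂⟩ := Metric.eventually_nhds_iff_ball.1
      ((differentiableAt_hankelCoeff hp).continuousAt.norm.eventually
        (gt_mem_nhds (lt_add_one ‖hankelCoeff p‖)))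
    obtain ⟨g, hg, H₃⟩ := exists_hankel_majorant hε ha (A := ‖p‖ + 1) (by positivity)
    refine ⟨min (min ρ₁ ρ₂) 1, by positivity, fun u => (‖hankelCoeff p‖ + 1) * g u,
      hg.const_mul _, fun s hs => ⟨H₁ ?_, fun u => ?_⟩⟩
    · exact Metric.ball_subset_ball ((min_le_left _ _).trans (min_le_left _ _)) hs
    · have h2 := (H₂ s (Metric.ball_subset_ball
        ((min_le_left _ _).trans (min_le_right _ _)) hs)).le
      have h3 : ‖s‖ ≤ ‖p‖ + 1 := by
        have h4 : ‖s - p‖ < 1 := by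
          rw [← dist_eq_norm]
          exact (Metric.mem_ball.1 hs).trans_le (min_le_right _ _)
        linarith [norm_le_norm_add_norm_sub' s p]
      simp only [ctrWeight, ctrPoint, if_true]
      rw [norm_mul, mul_assoc]
      exact mul_le_mul h2 (H₃ s h3 u) (by positivity) (by positivity)

/-- Where both contours are allowed, s is not an integer: it has positive real part and is not a
positive integer. There the factor e^{2πis} - 1 from collapsing the Hankel contour cancels against
its normalisation and leaves 1/Γ(s). -/
theorem integral_ctr_eq {ε ε' : ℝ} (hε : 0 < ε) (hε' : ε < ε') {f : ℂ → ℂ}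
    (hf : DifferentiableOn ℂ f (halfStrip ε')) {C a : ℝ} (ha : 0 < a)
    (hC : ∀ z ∈ halfStrip ε', ‖f z‖ ≤ C * Real.exp (-a * z.re)) {s : ℂ} {b c : Bool}
    (hb : s ∈ ctrValid b) (hc : s ∈ ctrValid c) :
    ∫ u, f (ctrPoint ε b u) * ctrWeight ε b s u = ∫ u, f (ctrPoint ε c u) * ctrWeight ε c s u := by
  have key : s ∈ ctrValid true → s ∈ ctrValid false →
      ∫ u, f (ctrPoint ε true u) * ctrWeight ε true s u =
        ∫ u, f (ctrPoint ε false u) * ctrWeight ε false s u := by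
    intro h1 h2
    have hs0 : 0 < s.re := h2
    have hs : ∀ n : ℤ, s ≠ n := by
      intro n hn
      have hn0 : 0 < n := by
        rw [hn] at hs0
        simpa using hs0
      obtain ⟨m, hm⟩ := Int.eq_succ_of_zero_lt hn0
      refine h1 m ?_
      rw [hn, hm]
      push_cast
      rfl
    obtain ⟨h3, h4⟩ := hankelCoeff_eq hs
    have h5 := hankel_integral_eq hε hε' hf ha hC hs0
    have h6 : ∀ u, f (ctrPoint ε true u) * ctrWeight ε true s u = hankelCoeff s *
        (f (hankelPath ε u) * (Complex.exp ((s - 1) * hankelLog ε u) * hankelVelocity ε u)) := by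
      intro u
      simp only [ctrPoint, ctrWeight, if_true]
      ring
    have h7 : ∀ u : ℝ, f (ctrPoint ε false u) * ctrWeight ε false s u =
        (Set.Ioi 0).indicator (fun t : ℝ => (Complex.Gamma s)⁻¹ * (f t * (t : ℂ) ^ (s - 1))) u := by
      intro u
      simp only [ctrPoint, ctrWeight, Bool.false_eq_true, if_false]
      by_cases hu : 0 < u
      · rw [if_pos hu, Set.indicator_of_mem (Set.mem_Ioi.2 hu), abs_of_pos hu]
        ring
      · rw [if_neg hu, mul_zero, Set.indicator_of_notMem (by simpa using hu)]
    simp only [h6, h7]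
    rw [integral_const_mul, h5, h4, integral_indicator measurableSet_Ioi, integral_const_mul]
    have := Complex.Gamma_ne_zero_of_re_pos hs0
    field_simp
  cases b <;> cases c
  · rfl
  · exact (key hc hb).symm
  · exact key hb hc
  · rfl

/-! ### Products of contours and the entire function they define -/

/-- The points all of whose coordinates are in `halfStrip η`. -/
def polyStrip (r : ℕ) (η : ℝ) : Set (Fin r → ℂ) := {t | ∀ k, t k ∈ halfStrip η}

/-- The functions that can be integrated over products of contours. -/
structure StripDecay {r : ℕ} (η C a : ℝ) (Φ : (Fin r → ℂ) → ℂ) : Prop where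
  differentiableAt : ∀ t ∈ polyStrip r η, DifferentiableAt ℂ Φ t
  pos : 0 < a
  bound : ∀ t ∈ polyStrip r η, ‖Φ t‖ ≤ C * ∏ k, Real.exp (-a * (t k).re)

/-- The integrand of `ctrIntegral`. -/
noncomputable def ctrIntegrand {r : ℕ} (Φ : (Fin r → ℂ) → ℂ) (ε : ℝ) (b : Fin r → Bool)
    (s : Fin r → ℂ) (u : Fin r → ℝ) : ℂ :=
  Φ (fun k => ctrPoint ε (b k) (u k)) * ∏ k, ctrWeight ε (b k) (s k) (u k)

/-- The integral over a product of contours. -/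
noncomputable def ctrIntegral {r : ℕ} (Φ : (Fin r → ℂ) → ℂ) (ε : ℝ) (b : Fin r → Bool)
    (s : Fin r → ℂ) : ℂ := ∫ u, ctrIntegrand Φ ε b s u

theorem measurable_comp_of_continuousOn {r : ℕ} {Φ : (Fin r → ℂ) → ℂ} {V : Set (Fin r → ℂ)}
    (hΦ : ContinuousOn Φ V) {X : Type*} [MeasurableSpace X] {P : X → Fin r → ℂ}
    (hP : Measurable P) (hPV : ∀ u, P u ∈ V) : Measurable fun u => Φ (P u) := by
  have h1 : Measurable fun x : V => Φ x := (continuousOn_iff_continuous_domRestrict.1 hΦ).measurable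
  exact h1.comp (hP.subtype_mk (h := hPV))

theorem StripDecay.measurable_ctrIntegrand {r : ℕ} {η C a : ℝ} {Φ : (Fin r → ℂ) → ℂ}
    (hΦ : StripDecay η C a Φ) {ε : ℝ} (hε : 0 < ε) (hη : ε < η) (b : Fin r → Bool)
    (s : Fin r → ℂ) : Measurable (ctrIntegrand Φ ε b s) := by
  refine Measurable.mul ?_ ?_
  · refine measurable_comp_of_continuousOn
      (V := polyStrip r η) (fun t ht => (hΦ.differentiableAt t ht).continuousAt.continuousWithinAt)
      (P := fun (u : Fin r → ℝ) k => ctrPoint ε (b k) (u k)) (measurable_pi_lambda _ fun k => ?_)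
      fun u k => ctrPoint_mem_halfStrip hε hη (b k) (u k)
    exact (measurable_ctrPoint ε (b k)).comp (measurable_pi_apply k)
  · exact Finset.measurable_fun_prod _ fun k _ =>
      (measurable_ctrWeight ε (b k) (s k)).comp (measurable_pi_apply k)

theorem exists_prod_ctrWeight_bound {r : ℕ} {ε a : ℝ} (hε : 0 < ε) (ha : 0 < a)
    {b : Fin r → Bool} {p : Fin r → ℂ} (hp : ∀ k, p k ∈ ctrValid (b k)) :
    ∃ ρ > 0, ∃ g : (Fin r → ℝ) → ℝ, Integrable g ∧ ∀ s ∈ Metric.ball p ρ,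
      (∀ k, s k ∈ ctrValid (b k)) ∧ ∀ u : Fin r → ℝ,
        (∏ k, Real.exp (-a * (ctrPoint ε (b k) (u k)).re)) *
          ‖∏ k, ctrWeight ε (b k) (s k) (u k)‖ ≤ g u := by
  choose ρ hρ g hg H using fun k => exists_ctrWeight_bound hε ha (hp k)
  obtain ⟨ρ₀, hρ₀, hρ₀'⟩ : ∃ ρ₀ > 0, ∀ k, ρ₀ ≤ ρ k := by
    have h1 : ∀ᶠ x in 𝓝[>] (0 : ℝ), ∀ k, x < ρ k :=
      eventually_all.2 fun k => mem_nhdsWithin_of_mem_nhds (gt_mem_nhds (hρ k))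
    obtain ⟨x, hx, hx'⟩ := (h1.and self_mem_nhdsWithin).exists
    exact ⟨x, hx', fun k => (hx k).le⟩
  refine ⟨ρ₀, hρ₀, fun u => ∏ k, g k (u k), Integrable.fintype_prod hg, fun s hs => ?_⟩
  have hsk : ∀ k, s k ∈ Metric.ball (p k) (ρ k) := fun k =>
    Metric.mem_ball.2 ((dist_le_pi_dist s p k).trans_lt (hs.trans_le (hρ₀' k)))
  refine ⟨fun k => (H k _ (hsk k)).1, fun u => ?_⟩
  rw [norm_prod, ← Finset.prod_mul_distrib]
  refine Finset.prod_le_prod (fun k _ => by positivity) fun k _ => ?_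
  rw [mul_comm]
  exact (H k _ (hsk k)).2 _

theorem StripDecay.exists_bound {r : ℕ} {η C a : ℝ} {Φ : (Fin r → ℂ) → ℂ}
    (hΦ : StripDecay η C a Φ) {ε : ℝ} (hε : 0 < ε) (hη : ε < η) {b : Fin r → Bool}
    {p : Fin r → ℂ} (hp : ∀ k, p k ∈ ctrValid (b k)) :
    ∃ ρ > 0, ∃ g : (Fin r → ℝ) → ℝ, Integrable g ∧ ∀ s ∈ Metric.ball p ρ,
      (∀ k, s k ∈ ctrValid (b k)) ∧ ∀ u, ‖ctrIntegrand Φ ε b s u‖ ≤ g u := by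
  obtain ⟨ρ, hρ, g, hg, H⟩ := exists_prod_ctrWeight_bound hε hΦ.pos hp
  refine ⟨ρ, hρ, fun u => |C| * g u, hg.const_mul _, fun s hs => ⟨(H s hs).1, fun u => ?_⟩⟩
  have h1 := hΦ.bound _ fun k => ctrPoint_mem_halfStrip hε hη (b k) (u k)
  have h2 : 0 ≤ ∏ k, Real.exp (-a * (ctrPoint ε (b k) (u k)).re) := by positivity
  rw [ctrIntegrand, norm_mul]
  calc _ ≤ (C * ∏ k, Real.exp (-a * (ctrPoint ε (b k) (u k)).re)) *
        ‖∏ k, ctrWeight ε (b k) (s k) (u k)‖ := by gcongr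
    _ ≤ (|C| * ∏ k, Real.exp (-a * (ctrPoint ε (b k) (u k)).re)) *
        ‖∏ k, ctrWeight ε (b k) (s k) (u k)‖ := by gcongr; exact le_abs_self C
    _ ≤ _ := by
      rw [mul_assoc]
      exact mul_le_mul_of_nonneg_left ((H s hs).2 u) (abs_nonneg C)

theorem StripDecay.integrable_ctrIntegrand {r : ℕ} {η C a : ℝ} {Φ : (Fin r → ℂ) → ℂ}
    (hΦ : StripDecay η C a Φ) {ε : ℝ} (hε : 0 < ε) (hη : ε < η) {b : Fin r → Bool}
    {s : Fin r → ℂ} (hs : ∀ k, s k ∈ ctrValid (b k)) : Integrable (ctrIntegrand Φ ε b s) := by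
  obtain ⟨ρ, hρ, g, hg, H⟩ := hΦ.exists_bound hε hη hs
  exact hg.mono' (hΦ.measurable_ctrIntegrand hε hη b s).aestronglyMeasurable
    (Eventually.of_forall (H s (Metric.mem_ball_self hρ)).2)

theorem StripDecay.differentiableAt_ctrIntegral {r : ℕ} {η C a : ℝ} {Φ : (Fin r → ℂ) → ℂ}
    (hΦ : StripDecay η C a Φ) {ε : ℝ} (hε : 0 < ε) (hη : ε < η) {b : Fin r → Bool}
    {p : Fin r → ℂ} (hp : ∀ k, p k ∈ ctrValid (b k)) :
    DifferentiableAt ℂ (ctrIntegral Φ ε b) p := by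
  obtain ⟨ρ, hρ, g, hg, H⟩ := hΦ.exists_bound hε hη hp
  refine differentiableAt_integral_of_bounded hρ
    (fun s _ => (hΦ.measurable_ctrIntegrand hε hη b s).aestronglyMeasurable) hg
    (fun u s hs => (H s hs).2 u) fun u s hs => ?_
  refine DifferentiableAt.const_mul (differentiableAt_finset_prod _ fun k _ => ?_) _
  have h1 : DifferentiableAt ℂ (fun s : Fin r → ℂ => s k) s := by fun_prop
  exact (differentiableAt_ctrWeight ((H s hs).1 k) (u k)).comp s h1

theorem StripDecay.ctrIntegral_eq_fiber {n : ℕ} {η C a : ℝ} {Φ : (Fin (n + 1) → ℂ) → ℂ}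
    (hΦ : StripDecay η C a Φ) {ε : ℝ} (hε : 0 < ε) (hη : ε < η) {b : Fin (n + 1) → Bool}
    {s : Fin (n + 1) → ℂ} (hs : ∀ k, s k ∈ ctrValid (b k)) (k : Fin (n + 1)) :
    ctrIntegral Φ ε b s = ∫ y : Fin n → ℝ,
      (∏ j, ctrWeight ε (b (k.succAbove j)) (s (k.succAbove j)) (y j)) *
      ∫ x, Φ (k.insertNth (ctrPoint ε (b k) x)
        (fun j => ctrPoint ε (b (k.succAbove j)) (y j))) * ctrWeight ε (b k) (s k) x := by
  have hmp := (volume_preserving_piFinSuccAbove (fun _ : Fin (n + 1) => ℝ) k).symm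
  have hint := hΦ.integrable_ctrIntegrand hε hη hs
  rw [ctrIntegral, ← hmp.integral_comp']
  have hint' := (hmp.integrable_comp_emb (MeasurableEquiv.measurableEmbedding _)).2 hint
  have h1 := integral_prod_symm _ hint'
  refine Eq.trans h1 (integral_congr_ae (Eventually.of_forall fun y => ?_))
  simp only
  rw [← integral_const_mul]
  refine integral_congr_ae (Eventually.of_forall fun x => ?_)
  simp only [Function.comp_apply, MeasurableEquiv.piFinSuccAbove_symm_apply, ctrIntegrand]
  have h2 : (fun i => ctrPoint ε (b i) ((Fin.insertNthEquiv (fun _ => ℝ) k) (x, y) i)) =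
      k.insertNth (α := fun _ => ℂ) (ctrPoint ε (b k) x)
        (fun j => ctrPoint ε (b (k.succAbove j)) (y j)) := by
    funext i
    refine Fin.succAboveCases k ?_ (fun j => ?_) i
    · simp
    · simp
  rw [h2, Fin.prod_univ_succAbove _ k]
  simp only [Fin.insertNthEquiv_apply, Fin.insertNth_apply_same, Fin.insertNth_apply_succAbove]
  ring

/-- By Fubini the k-th variable is integrated innermost. With the other variables frozen, the
integrand satisfies the one-variable hypotheses, so the k-th contour can be exchanged. -/
theorem StripDecay.ctrIntegral_update {r : ℕ} {η C a : ℝ} {Φ : (Fin r → ℂ) → ℂ}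
    (hΦ : StripDecay η C a Φ) {ε : ℝ} (hε : 0 < ε) (hη : ε < η) {b : Fin r → Bool}
    {s : Fin r → ℂ} (hs : ∀ k, s k ∈ ctrValid (b k)) {k : Fin r} {c : Bool}
    (hc : s k ∈ ctrValid c) :
    ctrIntegral Φ ε (Function.update b k c) s = ctrIntegral Φ ε b s := by
  obtain ⟨n, rfl⟩ : ∃ n, r = n + 1 := ⟨r - 1, by have := k.pos; omega⟩
  have hs' : ∀ j, s j ∈ ctrValid (Function.update b k c j) := by
    intro j
    by_cases hj : j = k
    · subst hj; rwa [Function.update_self]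
    · rw [Function.update_of_ne hj]; exact hs j
  rw [hΦ.ctrIntegral_eq_fiber hε hη hs k, hΦ.ctrIntegral_eq_fiber hε hη hs' k]
  refine integral_congr_ae (Eventually.of_forall fun y => ?_)
  simp only [Function.update_self, Function.update_of_ne (Fin.succAbove_ne k _)]
  congr 1
  set q : Fin n → ℂ := fun j => ctrPoint ε (b (k.succAbove j)) (y j) with hq
  have hmem : ∀ z ∈ halfStrip η, k.insertNth (α := fun _ => ℂ) z q ∈ polyStrip (n + 1) η := by
    intro z hz i
    refine Fin.succAboveCases k ?_ (fun j => ?_) i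
    · simpa using hz
    · simpa using ctrPoint_mem_halfStrip hε hη _ _
  refine integral_ctr_eq hε hη (f := fun z => Φ (k.insertNth (α := fun _ => ℂ) z q)) ?_ hΦ.pos
    (C := C * ∏ j, Real.exp (-a * (q j).re)) ?_ hc (hs k)
  · intro z hz
    have h1 : DifferentiableAt ℂ (fun z : ℂ => k.insertNth (α := fun _ => ℂ) z q) z := by
      refine differentiableAt_pi.2 fun i => ?_
      refine Fin.succAboveCases k ?_ (fun j => ?_) i
      · simp only [Fin.insertNth_apply_same]; exact differentiableAt_id
      · simp only [Fin.insertNth_apply_succAbove]; exact differentiableAt_const _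
    exact ((hΦ.differentiableAt _ (hmem z hz)).comp z h1).differentiableWithinAt
  · intro z hz
    refine (hΦ.bound _ (hmem z hz)).trans (le_of_eq ?_)
    rw [Fin.prod_univ_succAbove _ k]
    simp only [Fin.insertNth_apply_same, Fin.insertNth_apply_succAbove]
    ring

theorem StripDecay.ctrIntegral_eq {r : ℕ} {η C a : ℝ} {Φ : (Fin r → ℂ) → ℂ}
    (hΦ : StripDecay η C a Φ) {ε : ℝ} (hε : 0 < ε) (hη : ε < η) {b c : Fin r → Bool}
    {s : Fin r → ℂ} (hb : ∀ k, s k ∈ ctrValid (b k)) (hc : ∀ k, s k ∈ ctrValid (c k)) :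
    ctrIntegral Φ ε b s = ctrIntegral Φ ε c s := by
  -- Switch the contours from b to c one coordinate at a time; t records those already switched.
  have key : ∀ t : Finset (Fin r),
      (∀ k, s k ∈ ctrValid (if k ∈ t then c k else b k)) ∧
        ctrIntegral Φ ε (fun k => if k ∈ t then c k else b k) s = ctrIntegral Φ ε b s := by
    intro t
    induction t using Finset.induction_on with
    | empty => simpa using hb
    | insert k t hk ih =>
      have h1 : (fun j => if j ∈ insert k t then c j else b j) =
          Function.update (fun j => if j ∈ t then c j else b j) k (c k) := by
        funext j
        by_cases hj : j = k
        · subst hj; simp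
        · simp [Finset.mem_insert, hj]
      refine ⟨fun j => ?_, ?_⟩
      · split_ifs
        · exact hc j
        · exact hb j
      · rw [h1, hΦ.ctrIntegral_update hε hη ih.1 (hc k), ih.2]
  have := (key Finset.univ).2
  simpa using this.symm

/-- A choice of contours that is valid at `s`. -/
noncomputable def ctrChoice {r : ℕ} (s : Fin r → ℂ) (k : Fin r) : Bool := decide ((s k).re ≤ 0)

theorem ctrChoice_valid {r : ℕ} (s : Fin r → ℂ) (k : Fin r) : s k ∈ ctrValid (ctrChoice s k) := by
  by_cases h : (s k).re ≤ 0
  · simp only [ctrChoice, h, decide_true, ctrValid, if_true]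
    intro n hn
    rw [hn] at h
    simp at h
    have : (0 : ℝ) ≤ n := Nat.cast_nonneg n
    linarith
  · simp only [ctrChoice, h, decide_false, ctrValid, Bool.false_eq_true, if_false]
    exact not_le.1 h

/-- The entire function given by integrals over products of contours. -/
noncomputable def entireIntegral {r : ℕ} (Φ : (Fin r → ℂ) → ℂ) (ε : ℝ) (s : Fin r → ℂ) : ℂ :=
  ctrIntegral Φ ε (ctrChoice s) s

theorem StripDecay.entireIntegral_eq {r : ℕ} {η C a : ℝ} {Φ : (Fin r → ℂ) → ℂ}
    (hΦ : StripDecay η C a Φ) {ε : ℝ} (hε : 0 < ε) (hη : ε < η) {b : Fin r → Bool}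
    {s : Fin r → ℂ} (hb : ∀ k, s k ∈ ctrValid (b k)) :
    entireIntegral Φ ε s = ctrIntegral Φ ε b s :=
  hΦ.ctrIntegral_eq hε hη (ctrChoice_valid s) hb

/-- The choice of contours jumps with s, but validity of a fixed choice is an open condition and the
integral does not depend on the choice. Near p the choice made at p can therefore be kept. -/
theorem StripDecay.differentiable_entireIntegral {r : ℕ} {η C a : ℝ} {Φ : (Fin r → ℂ) → ℂ}
    (hΦ : StripDecay η C a Φ) {ε : ℝ} (hε : 0 < ε) (hη : ε < η) :
    Differentiable ℂ (entireIntegral Φ ε) := by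
  intro p
  refine (hΦ.differentiableAt_ctrIntegral hε hη (ctrChoice_valid p)).congr_of_eventuallyEq ?_
  have h1 : ∀ᶠ s in 𝓝 p, ∀ k, s k ∈ ctrValid (ctrChoice p k) :=
    eventually_all.2 fun k => (continuous_apply k).continuousAt.eventually
      ((isOpen_ctrValid _).mem_nhds (ctrChoice_valid p k))
  filter_upwards [h1] with s hs using hΦ.entireIntegral_eq hε hη hs

/-- The entire function does not depend on `ε`. -/
theorem StripDecay.entireIntegral_eq_entireIntegral {r : ℕ} {η C a : ℝ} {Φ : (Fin r → ℂ) → ℂ}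
    (hΦ : StripDecay η C a Φ) {ε ε₁ : ℝ} (hε : 0 < ε) (hη : ε < η) (hε₁ : 0 < ε₁)
    (hη₁ : ε₁ < η) : entireIntegral Φ ε = entireIntegral Φ ε₁ := by
  refine Differentiable.eq_of_eventuallyEq (hΦ.differentiable_entireIntegral hε hη)
    (hΦ.differentiable_entireIntegral hε₁ hη₁) (v := fun _ => 1) ?_
  -- Near (1, …, 1) every contour may be taken to be a half-line, where ε does not occur.
  have h1 : ∀ᶠ s in 𝓝 (fun _ : Fin r => (1 : ℂ)), ∀ k, s k ∈ ctrValid false :=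
    eventually_all.2 fun k => (continuous_apply k).continuousAt.eventually
      ((isOpen_ctrValid false).mem_nhds (show (1 : ℂ) ∈ ctrValid false by simp [ctrValid]))
  filter_upwards [h1] with s hs
  rw [hΦ.entireIntegral_eq hε hη (b := fun _ => false) hs,
    hΦ.entireIntegral_eq hε₁ hη₁ (b := fun _ => false) hs]
  simp only [ctrIntegral, ctrIntegrand, ctrPoint, ctrWeight, Bool.false_eq_true, if_false]

/-! ### The limit `c → 1` -/

/-- The argument `γ_j (t_j + ⋯ + t_r)` of the `j`-th kernel. -/
noncomputable def kerArg {r : ℕ} (γ t : Fin r → ℂ) (j : Fin r) : ℂ :=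
  γ j * ∑ k ∈ Finset.Ici j, t k

/-- The limit as `c → 1` of the product of the kernels, divided by `(1 - c)^r`. -/
noncomputable def kerLimit {r : ℕ} (γ t : Fin r → ℂ) : ℂ := ∏ j, limKernel (kerArg γ t j)

/-- Exponential decay of the products of kernels, with constants independent of `c`. -/
structure KernelDecay {r : ℕ} (γ : Fin r → ℂ) (η C a : ℝ) : Prop where
  radius_pos : 0 < η
  rate_pos : 0 < a
  expQuot_ne_zero : ∀ t ∈ polyStrip r η, ∀ j, expQuot (kerArg γ t j) ≠ 0
  norm_kerLimit_le : ∀ t ∈ polyStrip r η, ‖kerLimit γ t‖ ≤ C * ∏ k, Real.exp (-a * (t k).re)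
  norm_prod_desKernel_le : ∀ t ∈ polyStrip r η, ∀ c ∈ Set.Icc (1 / 2 : ℝ) 2,
    ‖∏ j, desKernel c (kerArg γ t j)‖ ≤ |c - 1| ^ r * (C * ∏ k, Real.exp (-a * (t k).re))

theorem sum_mem_halfStrip {r : ℕ} {η η' : ℝ} (hη : 0 < η) (h : r * η ≤ η') {t : Fin r → ℂ}
    (ht : t ∈ polyStrip r η) (j : Fin r) : ∑ k ∈ Finset.Ici j, t k ∈ halfStrip η' := by
  have hne : (Finset.Ici j).Nonempty := ⟨j, Finset.mem_Ici.2 le_rfl⟩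
  have hcard : ((Finset.Ici j).card : ℝ) * η ≤ η' := by
    refine le_trans (mul_le_mul_of_nonneg_right ?_ hη.le) h
    exact_mod_cast (Finset.card_le_univ _).trans (Fintype.card_fin r).le
  constructor
  · rw [Complex.re_sum]
    have h1 : ∑ _k ∈ Finset.Ici j, (-η) < ∑ k ∈ Finset.Ici j, (t k).re :=
      Finset.sum_lt_sum_of_nonempty hne fun k _ => (ht k).1
    rw [Finset.sum_const, nsmul_eq_mul] at h1
    linarith
  · rw [Complex.im_sum]
    have h1 : ∑ k ∈ Finset.Ici j, |(t k).im| < ∑ _k ∈ Finset.Ici j, η :=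
      Finset.sum_lt_sum_of_nonempty hne fun k _ => (ht k).2
    rw [Finset.sum_const, nsmul_eq_mul] at h1
    exact (Finset.abs_sum_le_sum_abs _ _).trans_lt (h1.trans_le hcard)

/-- The first kernel depends on t_1 + ⋯ + t_r, so its decay alone yields a decaying exponential in
every variable. The other kernels need only be bounded, which holds because the real parts of their
partial sums are bounded below on the strip. -/
theorem exists_kernelDecay (n : ℕ) {γ : Fin (n + 1) → ℂ} (hγ : ∀ j, 0 < (γ j).re) :
    ∃ η C a : ℝ, KernelDecay γ η C a := by
  choose η' C a hη' hC ha H₁ H₂ using fun j => exists_desKernel_bound (hγ j)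
  obtain ⟨η, hη, hle⟩ : ∃ η > 0, ∀ j, ((n + 1 : ℕ) : ℝ) * η ≤ η' j := by
    have h1 : ∀ᶠ x in 𝓝[>] (0 : ℝ), ∀ j, ((n + 1 : ℕ) : ℝ) * x < η' j := by
      refine eventually_all.2 fun j => mem_nhdsWithin_of_mem_nhds ?_
      have h2 : ContinuousAt (fun x : ℝ => ((n + 1 : ℕ) : ℝ) * x) 0 := by fun_prop
      exact h2.eventually (gt_mem_nhds (by simpa using hη' j))
    obtain ⟨x, hx, hx'⟩ := (h1.and self_mem_nhdsWithin).exists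
    exact ⟨x, hx', fun j => (hx j).le⟩
  have hmem : ∀ t ∈ polyStrip (n + 1) η, ∀ j, ∑ k ∈ Finset.Ici j, t k ∈ halfStrip (η' j) :=
    fun t ht j => sum_mem_halfStrip hη (hle j) ht j
  have hprod : ∀ t ∈ polyStrip (n + 1) η,
      ∏ j, (C j * Real.exp (-a j * (∑ k ∈ Finset.Ici j, t k).re)) ≤
        (C 0 * ∏ j : Fin n, (C j.succ * Real.exp (a j.succ * η' j.succ))) *
          ∏ k, Real.exp (-a 0 * (t k).re) := by
    intro t ht
    rw [Fin.prod_univ_succ]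
    have h0 : Finset.Ici (0 : Fin (n + 1)) = Finset.univ := by
      ext k
      simp
    have h1 : Real.exp (-a 0 * (∑ k ∈ Finset.Ici 0, t k).re) =
        ∏ k, Real.exp (-a 0 * (t k).re) := by
      rw [h0, ← Real.exp_sum, Complex.re_sum, Finset.mul_sum]
    have h2 : ∏ j : Fin n, (C j.succ *
        Real.exp (-a j.succ * (∑ k ∈ Finset.Ici j.succ, t k).re)) ≤
        ∏ j : Fin n, (C j.succ * Real.exp (a j.succ * η' j.succ)) := by
      refine Finset.prod_le_prod (fun j _ => mul_nonneg (hC _).le (Real.exp_pos _).le)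
        fun j _ => mul_le_mul_of_nonneg_left (Real.exp_le_exp.2 ?_) (hC _).le
      have h3 := (hmem t ht j.succ).1
      have h4 := mul_le_mul_of_nonneg_left h3.le (ha j.succ).le
      linarith
    have h5 : 0 ≤ C 0 * ∏ k, Real.exp (-a 0 * (t k).re) :=
      mul_nonneg (hC 0).le (Finset.prod_nonneg fun k _ => (Real.exp_pos _).le)
    rw [h1]
    refine (mul_le_mul_of_nonneg_left h2 h5).trans (le_of_eq ?_)
    ring
  refine ⟨η, C 0 * ∏ j : Fin n, (C j.succ * Real.exp (a j.succ * η' j.succ)), a 0,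
    hη, ha 0, fun t ht j => (H₁ j _ (hmem t ht j)).1, fun t ht => ?_, fun t ht c hc => ?_⟩
  · refine le_trans ?_ (hprod t ht)
    rw [kerLimit, norm_prod]
    exact Finset.prod_le_prod (fun j _ => norm_nonneg _) fun j _ => (H₁ j _ (hmem t ht j)).2
  · refine le_trans ?_ (mul_le_mul_of_nonneg_left (hprod t ht) (by positivity))
    rw [norm_prod]
    refine (Finset.prod_le_prod (fun j _ => norm_nonneg _)
      fun j _ => H₂ j _ (hmem t ht j) c hc).trans (le_of_eq ?_)
    rw [Finset.prod_mul_distrib, Finset.prod_const, Finset.card_univ, Fintype.card_fin]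

theorem KernelDecay.stripDecay {r : ℕ} {γ : Fin r → ℂ} {η C a : ℝ} (h : KernelDecay γ η C a) :
    StripDecay η C a (kerLimit γ) where
  differentiableAt t ht := by
    refine differentiableAt_finset_prod _ fun j _ => ?_
    have h1 : DifferentiableAt ℂ (fun t : Fin r → ℂ => kerArg γ t j) t := by
      unfold kerArg
      fun_prop
    exact (differentiableAt_limKernel (h.expQuot_ne_zero t ht j)).comp t h1
  pos := h.rate_pos
  bound := h.norm_kerLimit_le

theorem measurable_desKernel (c : ℝ) : Measurable (desKernel c) := by
  unfold desKernel
  exact Measurable.ite (measurableSet_singleton 0) measurable_const (by fun_prop)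

theorem measurable_desIntegrand {r : ℕ} (γ s : Fin r → ℂ) (ε c : ℝ) :
    Measurable (desIntegrand γ s ε c) := by
  have h0 : ∀ k : Fin r, Measurable fun u : Fin r → ℝ => hankelPath ε (u k) := fun k =>
    (measurable_hankelPath ε).comp (measurable_pi_apply k)
  refine Measurable.mul (Finset.measurable_fun_prod _ fun j _ => ?_)
    (Finset.measurable_fun_prod _ fun k _ => ?_)
  · exact (measurable_desKernel c).comp
      ((Finset.measurable_fun_sum _ fun k _ => h0 k).const_mul _)
  · have h1 := (measurable_hankelLog ε).comp (measurable_pi_apply (X := fun _ : Fin r => ℝ) k)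
    have h2 := (measurable_hankelVelocity ε).comp
      (measurable_pi_apply (X := fun _ : Fin r => ℝ) k)
    exact ((h1.const_mul _).cexp).mul h2

theorem KernelDecay.exists_desIntegrand_bound {r : ℕ} {γ : Fin r → ℂ} {η C a : ℝ}
    (h : KernelDecay γ η C a) {ε : ℝ} (hε : 0 < ε) (hη : ε < η) (s : Fin r → ℂ) :
    ∃ g : (Fin r → ℝ) → ℝ, Integrable g ∧ ∀ c ∈ Set.Icc (1 / 2 : ℝ) 2, ∀ u,
      ‖desIntegrand γ s ε c u‖ ≤ |c - 1| ^ r * g u := by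
  choose g hg H using fun k : Fin r =>
    exists_hankel_majorant hε h.rate_pos (A := ‖s k‖ + 1) (by positivity)
  refine ⟨fun u => |C| * ∏ k, g k (u k), (Integrable.fintype_prod hg).const_mul _,
    fun c hc u => ?_⟩
  have h1 := h.norm_prod_desKernel_le (fun k => hankelPath ε (u k))
    (fun k => hankelPath_mem_halfStrip hε hη (u k)) c hc
  have h2 : (∏ k, Real.exp (-a * (hankelPath ε (u k)).re)) *
      ‖∏ k, (Complex.exp ((s k - 1) * hankelLog ε (u k)) * hankelVelocity ε (u k))‖ ≤
      ∏ k, g k (u k) := by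
    rw [norm_prod, ← Finset.prod_mul_distrib]
    refine Finset.prod_le_prod (fun k _ => by positivity) fun k _ => ?_
    rw [mul_comm]
    exact H k (s k) (by linarith) (u k)
  rw [desIntegrand, norm_mul]
  refine (mul_le_mul_of_nonneg_right h1 (norm_nonneg _)).trans ?_
  rw [mul_assoc, mul_assoc]
  refine mul_le_mul_of_nonneg_left ?_ (by positivity)
  refine (mul_le_mul_of_nonneg_right (le_abs_self C) (by positivity)).trans ?_
  exact mul_le_mul_of_nonneg_left h2 (abs_nonneg C)

/-- Dominated convergence: the factor |c - 1|^r in the bound on the kernels cancels the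
normalisation (c - 1)^{-r} and leaves a majorant independent of c. -/
theorem KernelDecay.integrable_and_tendsto_desApprox {r : ℕ} {γ : Fin r → ℂ} {η C a : ℝ}
    (h : KernelDecay γ η C a) {ε : ℝ} (hε : 0 < ε) (hη : ε < η) {s : Fin r → ℂ}
    (hs : ∀ k, ∀ n : ℕ, s k ≠ (n : ℂ) + 1) :
    (∀ᶠ c in 𝓝[≠] (1 : ℝ), Integrable (desIntegrand γ s ε c)) ∧
      Tendsto (fun c : ℝ => desApprox γ s ε c) (𝓝[≠] 1)
        (𝓝 (entireIntegral (kerLimit γ) ε s)) := by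
  obtain ⟨g, hg, H⟩ := h.exists_desIntegrand_bound hε hη s
  have hIcc : ∀ᶠ c in 𝓝[≠] (1 : ℝ), c ∈ Set.Icc (1 / 2 : ℝ) 2 :=
    mem_nhdsWithin_of_mem_nhds (Icc_mem_nhds (by norm_num) (by norm_num))
  have hne : ∀ᶠ c in 𝓝[≠] (1 : ℝ), c ≠ 1 := self_mem_nhdsWithin
  refine ⟨?_, ?_⟩
  · filter_upwards [hIcc] with c hc
    exact (hg.const_mul (|c - 1| ^ r)).mono' (measurable_desIntegrand γ s ε c).aestronglyMeasurable
      (Eventually.of_forall (H c hc))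
  · have hvalid : ∀ k, s k ∈ ctrValid ((fun _ => true : Fin r → Bool) k) := hs
    rw [h.stripDecay.entireIntegral_eq hε hη hvalid]
    set K : ℂ := ∏ k, hankelCoeff (s k) with hK
    have h1 : ∀ c : ℝ, desApprox γ s ε c =
        ∫ u, (-1) ^ r / ((c : ℂ) - 1) ^ r * K * desIntegrand γ s ε c u := by
      intro c
      have h2 : ∏ k, hankelFactor (s k) = K :=
        Finset.prod_congr rfl fun k _ => hankelFactor_eq (hs k)
      rw [desApprox, h2, integral_const_mul]
    simp only [h1, ctrIntegral]
    refine tendsto_integral_filter_of_dominated_convergence (fun u => ‖K‖ * g u)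
      (Eventually.of_forall fun c =>
        ((measurable_desIntegrand γ s ε c).const_mul _).aestronglyMeasurable) ?_
      (hg.const_mul _) (Eventually.of_forall fun u => ?_)
    · filter_upwards [hIcc, hne] with c hc hc1
      refine Eventually.of_forall fun u => ?_
      have h3 : 0 < |c - 1| := abs_pos.2 (sub_ne_zero.2 hc1)
      have h4 : ‖((c : ℂ) - 1)‖ = |c - 1| := by
        rw [← Complex.ofReal_one, ← Complex.ofReal_sub, Complex.norm_real, Real.norm_eq_abs]
      have h5 := H c hc u
      rw [norm_mul, norm_mul, norm_div, norm_pow, norm_pow, norm_neg, norm_one, one_pow, h4]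
      calc _ ≤ 1 / |c - 1| ^ r * ‖K‖ * (|c - 1| ^ r * g u) :=
            mul_le_mul_of_nonneg_left h5 (by positivity)
        _ = _ := by
            have : |c - 1| ^ r ≠ 0 := by positivity
            field_simp
    · have h6 : ∀ c : ℝ, (-1) ^ r / ((c : ℂ) - 1) ^ r * K * desIntegrand γ s ε c u =
          (∏ j, (-desKernel c (kerArg γ (fun k => hankelPath ε (u k)) j) / ((c : ℂ) - 1))) *
            ∏ k, ctrWeight ε true (s k) (u k) := by
        intro c
        simp only [ctrWeight, if_true]
        rw [Finset.prod_mul_distrib, ← hK, Finset.prod_div_distrib, Finset.prod_const,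
          Finset.card_univ, Fintype.card_fin, Finset.prod_neg, Finset.card_univ, Fintype.card_fin,
          desIntegrand]
        simp only [kerArg]
        ring
      simp only [h6, ctrIntegrand]
      refine Tendsto.mul_const _ (tendsto_finsetProd _ fun j _ => ?_)
      exact tendsto_desKernel (h.expQuot_ne_zero _
        (fun k => hankelPath_mem_halfStrip hε hη (u k)) j)

theorem KernelDecay.isDesingularizedZeta {r : ℕ} {γ : Fin r → ℂ} {η C a : ℝ}
    (h : KernelDecay γ η C a) :
    IsDesingularizedZeta γ (entireIntegral (kerLimit γ) (η / 2)) := by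
  have hη2 : 0 < η / 2 := half_pos h.radius_pos
  have hη3 : η / 2 < η := half_lt_self h.radius_pos
  refine ⟨h.stripDecay.differentiable_entireIntegral hη2 hη3, ?_⟩
  filter_upwards [Ioo_mem_nhdsGT h.radius_pos] with ε hε s hs
  rw [h.stripDecay.entireIntegral_eq_entireIntegral hη2 hη3 hε.1 hε.2]
  exact h.integrable_and_tendsto_desApprox hε.1 hε.2 hs

/-- For a common small ε both functions are the same limit near the origin, where no coordinate is a
positive integer. Entire functions that agree there are equal. -/
theorem IsDesingularizedZeta.unique {r : ℕ} {γ : Fin r → ℂ} {Z Z' : (Fin r → ℂ) → ℂ}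
    (h : IsDesingularizedZeta γ Z) (h' : IsDesingularizedZeta γ Z') : Z = Z' := by
  obtain ⟨ε, hε, hε'⟩ := (h.2.and h'.2).exists
  refine Differentiable.eq_of_eventuallyEq h.1 h'.1 (v := fun _ => 0) ?_
  have h1 : ∀ᶠ s in 𝓝 (fun _ : Fin r => (0 : ℂ)), ∀ k, s k ∈ ctrValid true :=
    eventually_all.2 fun k => (continuous_apply k).continuousAt.eventually
      ((isOpen_ctrValid true).mem_nhds (show (0 : ℂ) ∈ ctrValid true from fun n hn =>
        Nat.cast_add_one_ne_zero n hn.symm))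
  filter_upwards [h1] with s hs
  exact tendsto_nhds_unique (hε s hs).2 (hε' s hs).2

/-! ### The polynomial `𝒢` -/

/-- The total degree in the variables `v_j`. -/
def vDegree (r : ℕ) : (Fin r → ℕ) × (Fin r → ℤ) →+ ℤ where
  toFun p := ∑ j, p.2 j
  map_zero' := by simp
  map_add' p q := by simp [Finset.sum_add_distrib]

/-- Grade by the total degree in v: u_kv_k has degree 1 and each v_j⁻¹ degree -1, so every factor of
𝒢, and hence 𝒢, is homogeneous of degree 0. The convention v_0⁻¹ = 0 is harmless, as 0 lies in every
graded piece. -/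
theorem vDegree_eq_zero_of_mem_support {r : ℕ} {p : (Fin r → ℕ) × (Fin r → ℤ)}
    (hp : p ∈ (desCoeff r).support) : ∑ j, p.2 j = 0 := by
  have hmem : desPoly r ∈ AddMonoidAlgebra.gradeBy ℤ (vDegree r) 0 := by
    have hone : (1 : ULaurent r) ∈ AddMonoidAlgebra.gradeBy ℤ (vDegree r) 0 :=
      SetLike.one_mem_graded _
    have hu : ∀ k : Fin r, uVar k ∈ AddMonoidAlgebra.gradeBy ℤ (vDegree r) 0 := fun k => by
      have := AddMonoidAlgebra.single_mem_gradeBy (R := ℤ) (vDegree r)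
        ((Pi.single k 1, 0) : (Fin r → ℕ) × (Fin r → ℤ)) 1
      simpa [vDegree, uVar] using this
    have hv : ∀ k : Fin r, vVar k ∈ AddMonoidAlgebra.gradeBy ℤ (vDegree r) 1 := fun k => by
      have := AddMonoidAlgebra.single_mem_gradeBy (R := ℤ) (vDegree r)
        ((0, Pi.single k 1) : (Fin r → ℕ) × (Fin r → ℤ)) 1
      simpa [vDegree, vVar] using this
    have hi : ∀ k : Fin r, vInv k ∈ AddMonoidAlgebra.gradeBy ℤ (vDegree r) (-1) := fun k => by
      have := AddMonoidAlgebra.single_mem_gradeBy (R := ℤ) (vDegree r)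
        ((0, Pi.single k (-1)) : (Fin r → ℕ) × (Fin r → ℤ)) 1
      simpa [vDegree, vInv] using this
    have hfac : ∀ j : Fin r, 1 - (∑ k ∈ Finset.Ici j, uVar k * vVar k) * (vInv j - vInvPrev j) ∈
        AddMonoidAlgebra.gradeBy ℤ (vDegree r) 0 := by
      intro j
      have h1 : ∑ k ∈ Finset.Ici j, uVar k * vVar k ∈
          AddMonoidAlgebra.gradeBy ℤ (vDegree r) (0 + 1) :=
        Submodule.sum_mem _ fun k _ => SetLike.mul_mem_graded (hu k) (hv k)
      have h2 : vInv j - vInvPrev j ∈ AddMonoidAlgebra.gradeBy ℤ (vDegree r) (-1) := by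
        refine Submodule.sub_mem _ (hi j) ?_
        unfold vInvPrev
        split_ifs
        · exact Submodule.zero_mem _
        · exact hi _
      exact Submodule.sub_mem _ hone (SetLike.mul_mem_graded h1 h2)
    unfold desPoly
    refine Finset.prod_induction _ (fun x => x ∈ AddMonoidAlgebra.gradeBy ℤ (vDegree r) 0)
      (fun a b ha hb => ?_) hone fun j _ => hfac j
    have := SetLike.mul_mem_graded ha hb
    rwa [add_zero] at this
  exact (AddMonoidAlgebra.mem_gradeBy_iff ℤ _ _ _).1 hmem hp

/-- The value of `𝒢` at `u_k = t_k N_k`, `v_k = N_k⁻¹`. -/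
theorem sum_desCoeff_mul {r : ℕ} (t : Fin r → ℂ) {N : Fin r → ℂ} (hN : ∀ k, N k ≠ 0) :
    ∑ p ∈ (desCoeff r).support, (desCoeff r p : ℂ) *
      ∏ k, ((t k * N k) ^ p.1 k * N k ^ (-p.2 k)) =
    ∏ j : Fin r, (1 - (∑ k ∈ Finset.Ici j, t k) * (N j - if (j : ℕ) = 0 then 0 else
      N ⟨(j : ℕ) - 1, lt_of_le_of_lt (Nat.sub_le _ _) j.isLt⟩)) := by
  -- The character of the exponent monoid with u_k ↦ t_kN_k and v_k ↦ N_k⁻¹; the integer exponents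
  -- require N_k ≠ 0. Its linear extension evaluates 𝒢.
  set φ : Multiplicative ((Fin r → ℕ) × (Fin r → ℤ)) →* ℂ :=
    { toFun := fun p => ∏ k, ((t k * N k) ^ p.toAdd.1 k * N k ^ (-p.toAdd.2 k))
      map_one' := by simp
      map_mul' := fun p q => by
        rw [← Finset.prod_mul_distrib]
        refine Finset.prod_congr rfl fun k _ => ?_
        simp only [toAdd_mul, Prod.fst_add, Prod.snd_add, Pi.add_apply, pow_add, neg_add,
          zpow_add₀ (hN k)]
        ring } with hφ
  set Λ := AddMonoidAlgebra.lift ℤ ℂ ((Fin r → ℕ) × (Fin r → ℤ)) φ with hΛ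
  have hsingle : ∀ (p : (Fin r → ℕ) × (Fin r → ℤ)), Λ (AddMonoidAlgebra.single p 1) =
      ∏ k, ((t k * N k) ^ p.1 k * N k ^ (-p.2 k)) := by
    intro p
    rw [hΛ, AddMonoidAlgebra.lift_single, one_smul]
    rfl
  have hu : ∀ k, Λ (uVar k) = t k * N k := by
    intro k
    rw [uVar, hsingle, Finset.prod_eq_single k]
    · simp
    · intro j _ hj
      simp [Pi.single_eq_of_ne hj]
    · simp
  have hv : ∀ k, Λ (vVar k) = (N k)⁻¹ := by
    intro k
    rw [vVar, hsingle, Finset.prod_eq_single k]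
    · simp
    · intro j _ hj
      simp [Pi.single_eq_of_ne hj]
    · simp
  have hi : ∀ k, Λ (vInv k) = N k := by
    intro k
    rw [vInv, hsingle, Finset.prod_eq_single k]
    · simp
    · intro j _ hj
      simp [Pi.single_eq_of_ne hj]
    · simp
  have h1 : Λ (desPoly r) = ∑ p ∈ (desCoeff r).support, (desCoeff r p : ℂ) *
      ∏ k, ((t k * N k) ^ p.1 k * N k ^ (-p.2 k)) := by
    rw [hΛ, AddMonoidAlgebra.lift_apply]
    refine Finset.sum_congr rfl fun p _ => ?_
    exact zsmul_eq_mul _ _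
  rw [← h1, desPoly, map_prod]
  refine Finset.prod_congr rfl fun j _ => ?_
  rw [map_sub, map_one, map_mul, map_sum, map_sub, hi]
  congr 2
  · refine Finset.sum_congr rfl fun k _ => ?_
    rw [map_mul, hu, hv, mul_assoc, mul_inv_cancel₀ (hN k), mul_one]
  · congr 1
    unfold vInvPrev
    split_ifs
    · exact map_zero _
    · exact hi _

/-- Consecutive partial sums differ by one summand. The convention v_0⁻¹ = 0 corresponds to the
empty partial sum. -/
theorem ezSum_sub_ezSum_prev {r : ℕ} (γ : Fin r → ℂ) (m : Fin r → ℕ) (j : Fin r) :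
    (ezSum γ m j - if (j : ℕ) = 0 then 0 else
      ezSum γ m ⟨(j : ℕ) - 1, lt_of_le_of_lt (Nat.sub_le _ _) j.isLt⟩) =
      ((m j : ℂ) + 1) * γ j := by
  have h0 : Finset.Iic j = insert j (Finset.Iio j) := by
    ext i
    simp [le_iff_eq_or_lt]
  rw [ezSum, h0, Finset.sum_insert (by simp)]
  have h1 : ∑ i ∈ Finset.Iio j, ((m i : ℂ) + 1) * γ i = if (j : ℕ) = 0 then 0 else
      ezSum γ m ⟨(j : ℕ) - 1, lt_of_le_of_lt (Nat.sub_le _ _) j.isLt⟩ := by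
    split_ifs with hj
    · refine Finset.sum_eq_zero fun i hi => ?_
      rw [Finset.mem_Iio, Fin.lt_def] at hi
      omega
    · rw [ezSum]
      refine Finset.sum_congr ?_ fun _ _ => rfl
      ext i
      simp only [Finset.mem_Iio, Finset.mem_Iic, Fin.lt_def, Fin.le_def]
      omega
  rw [h1]
  ring

/-- Interchanging the sums over i ≤ k regroups the exponents of the geometric expansions by the
variables t_k, so that the exponential factors over k. -/
theorem sum_mul_kerArg {r : ℕ} (γ t : Fin r → ℂ) (m : Fin r → ℕ) :
    ∑ j, ((m j : ℂ) + 1) * kerArg γ t j = ∑ k, t k * ezSum γ m k := by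
  simp only [kerArg, ezSum, Finset.mul_sum]
  rw [Finset.sum_comm' (t' := Finset.univ) (s' := fun k => Finset.Iic k) (by simp)]
  refine Finset.sum_congr rfl fun k _ => Finset.sum_congr rfl fun i _ => ?_
  ring

/-- The expansion of the limit kernel on the product of the positive real half-lines. -/
theorem hasSum_kerLimit {r : ℕ} {γ : Fin r → ℂ} (hγ : ∀ j, 0 < (γ j).re) {t : Fin r → ℝ}
    (ht : ∀ k, 0 < t k) :
    HasSum (fun m : Fin r → ℕ => ∑ p ∈ (desCoeff r).support, (desCoeff r p : ℂ) *
      ∏ k, ((t k * ezSum γ m k) ^ p.1 k * ezSum γ m k ^ (-p.2 k) *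
        Complex.exp (-(t k * ezSum γ m k)))) (kerLimit γ fun k => (t k : ℂ)) := by
  have hpos : ∀ j, 0 < (kerArg γ (fun k => (t k : ℂ)) j).re := by
    intro j
    rw [kerArg, ← Complex.ofReal_sum, Complex.re_mul_ofReal]
    exact mul_pos (hγ j) (Finset.sum_pos (fun k _ => ht k) ⟨j, Finset.mem_Ici.2 le_rfl⟩)
  have h1 := fun j => hasSum_limKernel (hpos j)
  have h2 := (summable_norm_and_hasSum_pi_prod
    (fun j (n : ℕ) => (1 - ((n : ℂ) + 1) * kerArg γ (fun k => (t k : ℂ)) j) *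
      Complex.exp (-(((n : ℂ) + 1) * kerArg γ (fun k => (t k : ℂ)) j)))
    (fun j => (h1 j).summable.norm)).2
  have h3 : ∏ j, ∑' n : ℕ, (1 - ((n : ℂ) + 1) * kerArg γ (fun k => (t k : ℂ)) j) *
      Complex.exp (-(((n : ℂ) + 1) * kerArg γ (fun k => (t k : ℂ)) j)) =
      kerLimit γ fun k => (t k : ℂ) := Finset.prod_congr rfl fun j _ => (h1 j).tsum_eq
  rw [h3] at h2
  refine h2.congr_fun fun m => ?_
  have hN : ∀ k, ezSum γ m k ≠ 0 := fun k hk => by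
    have := ezSum_re_pos hγ m k
    rw [hk] at this
    exact lt_irrefl _ this
  rw [Finset.prod_mul_distrib, ← Complex.exp_sum, Finset.sum_neg_distrib, sum_mul_kerArg,
    ← Finset.sum_neg_distrib, Complex.exp_sum]
  simp only [Finset.prod_mul_distrib (g := fun k => Complex.exp (-(t k * ezSum γ m k))),
    ← mul_assoc]
  -- After the common exponential is factored out, the sum over p is the value of 𝒢, whose j-th
  -- factor is 1 - m_jγ_j(t_j + ⋯ + t_r).
  rw [← Finset.sum_mul, sum_desCoeff_mul (fun k => (t k : ℂ)) hN]
  congr 1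
  refine Finset.prod_congr rfl fun j _ => ?_
  rw [ezSum_sub_ezSum_prev, kerArg]
  ring

/-! ### Integration of the general term -/

/-- The one-dimensional integrand that arises from the expansion of the limit kernel. -/
noncomputable def halfLineTerm (ε : ℝ) (w N : ℂ) (l : ℕ) (q : ℤ) (u : ℝ) : ℂ :=
  ctrWeight ε false w u * (((|u| : ℝ) * N) ^ l * N ^ (-q) * Complex.exp (-((|u| : ℝ) * N)))

theorem halfLineTerm_eq_indicator (ε : ℝ) (w N : ℂ) (l : ℕ) (q : ℤ) :
    halfLineTerm ε w N l q = (Set.Ioi (0 : ℝ)).indicator fun t : ℝ =>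
      (Complex.Gamma w)⁻¹ * N ^ l * N ^ (-q) *
        ((t : ℂ) ^ (w + l - 1) * Complex.exp (-(N * t))) := by
  funext u
  simp only [halfLineTerm, ctrWeight, Bool.false_eq_true, if_false]
  by_cases hu : 0 < u
  · have hu0 : (u : ℂ) ≠ 0 := by exact_mod_cast hu.ne'
    rw [if_pos hu, Set.indicator_of_mem (Set.mem_Ioi.2 hu), abs_of_pos hu,
      show w + l - 1 = w - 1 + l by ring, Complex.cpow_add _ _ hu0, Complex.cpow_natCast, mul_pow,
      mul_comm N]
    ring
  · rw [if_neg hu, zero_mul, Set.indicator_of_notMem (by simpa using hu)]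

/-- The power t^l shifts the Mellin exponent to w + l, and Γ(w+l)/Γ(w) is the Pochhammer value. The
integral of the modulus is recorded for the interchange of sum and integral. -/
theorem integrable_and_integral_halfLineTerm (ε : ℝ) {w N : ℂ} (hw : 0 < w.re) (hN : 0 < N.re)
    (l : ℕ) (q : ℤ) :
    Integrable (halfLineTerm ε w N l q) ∧
    ∫ u, halfLineTerm ε w N l q u = (ascPochhammer ℂ l).eval w * N ^ (-(w + q)) ∧
    ∫ u, ‖halfLineTerm ε w N l q u‖ = ‖(Complex.Gamma w)⁻¹‖ * ‖N‖ ^ ((l : ℤ) - q) *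
      (Real.Gamma (w.re + l) * N.re ^ (-(w.re + l))) := by
  have hN0 : N ≠ 0 := fun h => by simp [h] at hN
  have hl : (0 : ℝ) ≤ l := Nat.cast_nonneg l
  have hwl : 0 < w.re + l := by linarith
  have hwl' : 0 < (w + l).re := by simpa using hwl
  have hnorm : ∀ t ∈ Set.Ioi (0 : ℝ), ‖(Complex.Gamma w)⁻¹ * N ^ l * N ^ (-q) *
      ((t : ℂ) ^ (w + l - 1) * Complex.exp (-(N * t)))‖ =
      ‖(Complex.Gamma w)⁻¹‖ * ‖N‖ ^ ((l : ℤ) - q) *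
        (t ^ (w.re + l - 1) * Real.exp (-(N.re * t))) := by
    intro t ht
    rw [norm_mul, norm_cpow_mul_exp ht, norm_mul, norm_mul, norm_pow, norm_zpow,
      sub_eq_add_neg (l : ℤ), zpow_add₀ (norm_ne_zero_iff.2 hN0), zpow_natCast]
    simp only [Complex.add_re, Complex.natCast_re]
    ring
  have hmeas : AEStronglyMeasurable (fun t : ℝ => (Complex.Gamma w)⁻¹ * N ^ l * N ^ (-q) *
      ((t : ℂ) ^ (w + l - 1) * Complex.exp (-(N * t)))) (volume.restrict (Set.Ioi 0)) :=
    Measurable.aestronglyMeasurable (by fun_prop)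
  rw [halfLineTerm_eq_indicator]
  refine ⟨?_, ?_, ?_⟩
  · rw [integrable_indicator_iff measurableSet_Ioi]
    refine ((integrableOn_rpow_mul_exp hwl hN).const_mul
      (‖(Complex.Gamma w)⁻¹‖ * ‖N‖ ^ ((l : ℤ) - q))).mono' hmeas ?_
    exact (ae_restrict_mem measurableSet_Ioi).mono fun t ht => (hnorm t ht).le
  · rw [integral_indicator measurableSet_Ioi, integral_const_mul,
      integral_cpow_mul_exp_neg_mul hwl' hN,
      ← inv_Gamma_mul_Gamma_add (w := w) (K := l) (by linarith),
      show -(w + l) = -(w + q) + q + (-l : ℂ) by ring, Complex.cpow_add _ _ hN0,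
      Complex.cpow_add _ _ hN0, Complex.cpow_intCast, Complex.cpow_neg N l, Complex.cpow_natCast,
      zpow_neg]
    have h1 : N ^ l ≠ 0 := pow_ne_zero _ hN0
    have h2 : N ^ q ≠ 0 := zpow_ne_zero _ hN0
    field_simp
  · simp only [norm_indicator_eq_indicator_norm]
    rw [integral_indicator measurableSet_Ioi, setIntegral_congr_fun measurableSet_Ioi hnorm,
      integral_const_mul, Real.integral_rpow_mul_exp_neg_mul_Ioi hwl hN, one_div,
      Real.inv_rpow hN.le, Real.rpow_neg hN.le, mul_comm (Real.Gamma _)]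

theorem zpow_le_mul_zpow {x y C : ℝ} (hx : 0 < x) (hxy : x ≤ y) (hC : 1 ≤ C) (hyx : y ≤ C * x)
    (e : ℤ) : y ^ e ≤ C ^ e.natAbs * x ^ e := by
  rcases e.natAbs_eq with h | h
  · set n := e.natAbs
    rw [h, zpow_natCast, zpow_natCast, ← mul_pow]
    exact pow_le_pow_left₀ (hx.le.trans hxy) hyx n
  · set n := e.natAbs
    rw [h, zpow_neg, zpow_neg, zpow_natCast, zpow_natCast]
    have h1 : (y ^ n)⁻¹ ≤ (x ^ n)⁻¹ :=
      inv_anti₀ (pow_pos hx n) (pow_le_pow_left₀ hx.le hxy n)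
    exact h1.trans (le_mul_of_one_le_left (by positivity) (one_le_pow₀ hC))

theorem integral_norm_halfLineTerm_le (ε : ℝ) {w N : ℂ} (hw : 0 < w.re) (hN : 0 < N.re) {C : ℝ}
    (hC : 1 ≤ C) (hNC : ‖N‖ ≤ C * N.re) (l : ℕ) (q : ℤ) :
    ∫ u, ‖halfLineTerm ε w N l q u‖ ≤ ‖(Complex.Gamma w)⁻¹‖ * C ^ ((l : ℤ) - q).natAbs *
      Real.Gamma (w.re + l) * N.re ^ (-(w.re + q)) := by
  have hl : (0 : ℝ) ≤ l := Nat.cast_nonneg l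
  have hΓ : 0 < Real.Gamma (w.re + l) := Real.Gamma_pos_of_pos (by linarith)
  rw [(integrable_and_integral_halfLineTerm ε hw hN l q).2.2]
  have h1 := zpow_le_mul_zpow hN (Complex.re_le_norm N) hC hNC ((l : ℤ) - q)
  -- Writing everything in powers of Re N makes the bound a modulus of a zeta term with the real
  -- parameters Re γ_j, for which summability is already available.
  have h2 : N.re ^ (-(w.re + q)) = N.re ^ ((l : ℤ) - q) * N.re ^ (-(w.re + l)) := by
    rw [← Real.rpow_intCast, ← Real.rpow_add hN]
    congr 1
    push_cast
    ring
  rw [h2]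
  calc _ ≤ ‖(Complex.Gamma w)⁻¹‖ * (C ^ ((l : ℤ) - q).natAbs * N.re ^ ((l : ℤ) - q)) *
        (Real.Gamma (w.re + l) * N.re ^ (-(w.re + l))) := by gcongr
    _ = _ := by ring

theorem exists_norm_ezSum_le {r : ℕ} {γ : Fin r → ℂ} (hγ : ∀ j, 0 < (γ j).re) :
    ∃ C : ℝ, 1 ≤ C ∧ ∀ m j, ‖ezSum γ m j‖ ≤ C * (ezSum γ m j).re := by
  obtain ⟨C, hC, h⟩ := exists_ezSum_bounds hγ
  refine ⟨C * C, one_le_mul_of_one_le_of_one_le hC hC, fun m j => (h m j).2.trans ?_⟩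
  have h1 := (div_le_iff₀ (by linarith)).1 (h m j).1
  rw [mul_assoc]
  refine mul_le_mul_of_nonneg_left ?_ (by linarith)
  linarith

theorem norm_ezTerm_re {r : ℕ} {γ : Fin r → ℂ} (hγ : ∀ j, 0 < (γ j).re) (s : Fin r → ℂ)
    (m : Fin r → ℕ) : ‖ezTerm (fun j => ((γ j).re : ℂ)) s m‖ =
      ∏ j, (ezSum γ m j).re ^ (-(s j).re) := by
  rw [ezTerm, norm_prod]
  refine Finset.prod_congr rfl fun j _ => ?_
  have h1 : ∑ i ∈ Finset.Iic j, ((m i : ℂ) + 1) * ((γ i).re : ℂ) = ((ezSum γ m j).re : ℂ) := by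
    rw [ezSum, Complex.re_sum, Complex.ofReal_sum]
    refine Finset.sum_congr rfl fun i _ => ?_
    rw [show (m i : ℂ) + 1 = (((m i : ℝ) + 1 : ℝ) : ℂ) by push_cast; rfl, Complex.re_ofReal_mul,
      Complex.ofReal_mul]
  rw [h1, Complex.norm_cpow_eq_rpow_re_of_pos (ezSum_re_pos hγ m j), Complex.neg_re]

/-- Integration of the general term of the expansion. -/
theorem integral_prod_halfLineTerm {r : ℕ} {γ : Fin r → ℂ} (hγ : ∀ j, 0 < (γ j).re) (ε : ℝ)
    {s : Fin r → ℂ} (hs : ∀ k, 0 < (s k).re) (p : (Fin r → ℕ) × (Fin r → ℤ)) (m : Fin r → ℕ) :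
    Integrable (fun u : Fin r → ℝ =>
      ∏ k, halfLineTerm ε (s k) (ezSum γ m k) (p.1 k) (p.2 k) (u k)) ∧
    ∫ u : Fin r → ℝ, ∏ k, halfLineTerm ε (s k) (ezSum γ m k) (p.1 k) (p.2 k) (u k) =
      (∏ j, (ascPochhammer ℂ (p.1 j)).eval (s j)) * ezTerm γ (fun j => s j + (p.2 j : ℂ)) m := by
  have h := fun k => integrable_and_integral_halfLineTerm ε (hs k) (ezSum_re_pos hγ m k)
    (p.1 k) (p.2 k)
  refine ⟨Integrable.fintype_prod fun k => (h k).1, ?_⟩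
  rw [integral_fintype_prod_volume_eq_prod, ezTerm, ← Finset.prod_mul_distrib]
  exact Finset.prod_congr rfl fun k _ => (h k).2.1

theorem summable_integral_norm_prod_halfLineTerm {r : ℕ} {γ : Fin r → ℂ}
    (hγ : ∀ j, 0 < (γ j).re) (ε : ℝ) {s : Fin r → ℂ} (hs : ∀ k, 0 < (s k).re)
    {p : (Fin r → ℕ) × (Fin r → ℤ)} (hp : (fun j => s j + (p.2 j : ℂ)) ∈ ezRegion r) :
    Summable fun m : Fin r → ℕ => ∫ u : Fin r → ℝ,
      ‖∏ k, halfLineTerm ε (s k) (ezSum γ m k) (p.1 k) (p.2 k) (u k)‖ := by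
  obtain ⟨C, hC, hCN⟩ := exists_norm_ezSum_le hγ
  have hγ' : ∀ j, 0 < (((γ j).re : ℂ)).re := fun j => by simpa using hγ j
  refine Summable.of_nonneg_of_le (fun m => integral_nonneg fun u => norm_nonneg _) (fun m => ?_)
    ((summable_norm_ezTerm hγ' hp).mul_left (∏ k, (‖(Complex.Gamma (s k))⁻¹‖ *
      C ^ ((p.1 k : ℤ) - p.2 k).natAbs * Real.Gamma ((s k).re + p.1 k))))
  simp only [norm_prod]
  rw [integral_fintype_prod_volume_eq_prod (fun k (x : ℝ) =>
    ‖halfLineTerm ε (s k) (ezSum γ m k) (p.1 k) (p.2 k) x‖), norm_ezTerm_re hγ,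
    ← Finset.prod_mul_distrib]
  refine Finset.prod_le_prod (fun k _ => integral_nonneg fun x => norm_nonneg _) fun k _ => ?_
  have := integral_norm_halfLineTerm_le ε (hs k) (ezSum_re_pos hγ m k) hC (hCN m k) (p.1 k) (p.2 k)
  simpa using this

/-- Insert the series for the limit kernel and integrate term by term; the integrals of the moduli
are summable because each shifted argument lies in the region of absolute convergence. -/
theorem ctrIntegral_kerLimit_eq {r : ℕ} {γ : Fin r → ℂ} (hγ : ∀ j, 0 < (γ j).re) (ε : ℝ)
    {F : (Fin r → ℂ) → ℂ} (hF : IsMultipleZeta γ F) {s : Fin r → ℂ} (hs : ∀ k, 0 < (s k).re)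
    (hp : ∀ p ∈ (desCoeff r).support, (fun j => s j + (p.2 j : ℂ)) ∈ ezRegion r) :
    ctrIntegral (kerLimit γ) ε (fun _ => false) s =
      ∑ p ∈ (desCoeff r).support, (desCoeff r p : ℂ) *
        (∏ j, (ascPochhammer ℂ (p.1 j)).eval (s j)) * F (fun j => s j + (p.2 j : ℂ)) := by
  set G : (Fin r → ℕ) → (Fin r → ℝ) → ℂ := fun m u => ∑ p ∈ (desCoeff r).support,
    (desCoeff r p : ℂ) * ∏ k, halfLineTerm ε (s k) (ezSum γ m k) (p.1 k) (p.2 k) (u k) with hG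
  have hGi : ∀ m, Integrable (G m) := fun m => integrable_finsetSum _ fun p _ =>
    (integral_prod_halfLineTerm hγ ε hs p m).1.const_mul _
  have hGs : Summable fun m => ∫ u, ‖G m u‖ := by
    refine Summable.of_nonneg_of_le (fun m => integral_nonneg fun u => norm_nonneg _) (fun m => ?_)
      (summable_sum fun p (hps : p ∈ (desCoeff r).support) =>
        (summable_integral_norm_prod_halfLineTerm hγ ε hs (hp p hps)).mul_left
          ‖(desCoeff r p : ℂ)‖)
    have h1 : ∀ p ∈ (desCoeff r).support, Integrable fun u : Fin r → ℝ => ‖(desCoeff r p : ℂ)‖ *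
        ‖∏ k, halfLineTerm ε (s k) (ezSum γ m k) (p.1 k) (p.2 k) (u k)‖ := fun p _ =>
      (integral_prod_halfLineTerm hγ ε hs p m).1.norm.const_mul _
    simp only [← integral_const_mul]
    rw [← integral_finsetSum _ h1]
    refine integral_mono (hGi m).norm (integrable_finsetSum _ h1) fun u => ?_
    refine (norm_sum_le _ _).trans (le_of_eq ?_)
    exact Finset.sum_congr rfl fun p _ => norm_mul _ _
  have h1 := hasSum_integral_of_summable_integral_norm hGi hGs
  have h2 : ∀ m, ∫ u, G m u = ∑ p ∈ (desCoeff r).support, (desCoeff r p : ℂ) *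
      (∏ j, (ascPochhammer ℂ (p.1 j)).eval (s j)) *
        ezTerm γ (fun j => s j + (p.2 j : ℂ)) m := by
    intro m
    rw [hG, integral_finsetSum _ fun p _ =>
      (integral_prod_halfLineTerm hγ ε hs p m).1.const_mul _]
    refine Finset.sum_congr rfl fun p _ => ?_
    rw [integral_const_mul, (integral_prod_halfLineTerm hγ ε hs p m).2, mul_assoc]
  simp only [h2] at h1
  have h3 : HasSum (fun m => ∑ p ∈ (desCoeff r).support, (desCoeff r p : ℂ) *
      (∏ j, (ascPochhammer ℂ (p.1 j)).eval (s j)) * ezTerm γ (fun j => s j + (p.2 j : ℂ)) m)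
      (∑ p ∈ (desCoeff r).support, (desCoeff r p : ℂ) *
        (∏ j, (ascPochhammer ℂ (p.1 j)).eval (s j)) * F (fun j => s j + (p.2 j : ℂ))) :=
    hasSum_sum fun p hps => (hF.2 _ (hp p hps)).mul_left _
  rw [h3.unique h1, ctrIntegral]
  refine integral_congr_ae (Eventually.of_forall fun u => ?_)
  have h4 : ∀ m, G m u = (∏ k, ctrWeight ε false (s k) (u k)) *
      ∑ p ∈ (desCoeff r).support, (desCoeff r p : ℂ) *
        ∏ k, (((|u k| : ℝ) * ezSum γ m k) ^ p.1 k * ezSum γ m k ^ (-p.2 k) *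
          Complex.exp (-((|u k| : ℝ) * ezSum γ m k))) := by
    intro m
    rw [hG, Finset.mul_sum]
    refine Finset.sum_congr rfl fun p _ => ?_
    simp only [halfLineTerm]
    rw [Finset.prod_mul_distrib]
    ring
  simp only [h4, ctrIntegrand]
  rw [tsum_mul_left, mul_comm]
  -- The expansion holds only when all coordinates are positive; otherwise some half-line weight is
  -- zero and both sides vanish.
  by_cases hu : ∀ k, 0 < u k
  · congr 1
    have := (hasSum_kerLimit hγ (t := fun k => |u k|) fun k => abs_pos.2 (hu k).ne').tsum_eq
    rw [this]
    simp [ctrPoint]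
  · obtain ⟨k, hk⟩ := not_forall.1 hu
    have h5 : ∏ k, ctrWeight ε false (s k) (u k) = 0 :=
      Finset.prod_eq_zero (Finset.mem_univ k) (by simp [ctrWeight, hk])
    rw [h5, zero_mul, zero_mul]

/-! ### The identity of meromorphic functions -/

theorem holomorphicNear_comp_add_iff {r : ℕ} {F : (Fin r → ℂ) → ℂ} {s q : Fin r → ℂ} :
    HolomorphicNear (fun z => F (z + q)) s ↔ HolomorphicNear F (s + q) := by
  have h1 : ∀ z, DifferentiableAt ℂ (fun z => F (z + q)) z ↔ DifferentiableAt ℂ F (z + q) :=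
    fun z => differentiableAt_comp_add_right q
  simp only [HolomorphicNear, h1]
  rw [← map_add_right_nhds_zero s, ← map_add_right_nhds_zero (s + q), eventually_map,
    eventually_map]
  simp only [add_assoc]

theorem dense_setOf_forall_holomorphicNear {r : ℕ} {F : (Fin r → ℂ) → ℂ}
    (hF : ∀ p, MeromorphicNear F p) (T : Finset (Fin r → ℂ)) :
    Dense {s : Fin r → ℂ | ∀ q ∈ T, HolomorphicNear F (s + q)} := by
  have h1 : {s : Fin r → ℂ | ∀ q ∈ T, HolomorphicNear F (s + q)} =
      ⋂ q ∈ (T : Set (Fin r → ℂ)), {s | HolomorphicNear F (s + q)} := by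
    ext s
    simp
  rw [h1]
  refine dense_biInter_of_isOpen (fun q _ => ?_) T.countable_toSet fun q _ => ?_
  · exact (isOpen_setOf_holomorphicNear F).preimage (continuous_add_const q)
  · exact (dense_setOf_holomorphicNear hF).preimage (isOpenMap_add_right q)

theorem exists_ball_shift_mem_ezRegion {r : ℕ} (T : Finset (Fin r → ℤ)) :
    ∃ v : Fin r → ℂ, ∀ᶠ s in 𝓝 v, (∀ k, 0 < (s k).re) ∧
      ∀ m ∈ T, (fun j => s j + (m j : ℂ)) ∈ ezRegion r := by
  obtain ⟨B, hB⟩ : ∃ B : ℕ, ∀ m ∈ T, ∀ j, -(B : ℤ) ≤ m j := by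
    refine ⟨∑ m ∈ T, ∑ j, (m j).natAbs, fun m hm j => ?_⟩
    have h1 : (m j).natAbs ≤ ∑ j, (m j).natAbs :=
      Finset.single_le_sum (f := fun j => (m j).natAbs) (fun _ _ => Nat.zero_le _)
        (Finset.mem_univ j)
    have h2 : ∑ j, (m j).natAbs ≤ ∑ m ∈ T, ∑ j, (m j).natAbs :=
      Finset.single_le_sum (f := fun m : Fin r → ℤ => ∑ j, (m j).natAbs)
        (fun _ _ => Nat.zero_le _) hm
    omega
  -- No shift lowers a coordinate by more than B, so near this point every shifted coordinate has
  -- real part above 1, and a tail of r - j of them exceeds r - j.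
  refine ⟨fun _ => (B : ℂ) + 2, ?_⟩
  have h1 : ∀ᶠ s in 𝓝 (fun _ : Fin r => (B : ℂ) + 2), ∀ k, (B : ℝ) + 1 < (s k).re := by
    refine eventually_all.2 fun k => ?_
    have h2 : ContinuousAt (fun s : Fin r → ℂ => (s k).re) fun _ => (B : ℂ) + 2 :=
      (Complex.continuous_re.comp (continuous_apply k)).continuousAt
    refine h2.eventually (lt_mem_nhds ?_)
    simp
  filter_upwards [h1] with s hs
  have hB0 : (0 : ℝ) ≤ B := Nat.cast_nonneg B
  refine ⟨fun k => by linarith [hs k], fun m hm => mem_ezRegion_iff.2 fun j => ?_⟩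
  have h2 : ∑ _i ∈ Finset.Ici j, (1 : ℝ) < ∑ i ∈ Finset.Ici j, (s i + (m i : ℂ)).re := by
    refine Finset.sum_lt_sum_of_nonempty ⟨j, Finset.mem_Ici.2 le_rfl⟩ fun i _ => ?_
    have h3 : -(B : ℝ) ≤ (m i : ℝ) := by exact_mod_cast hB m hm i
    simp only [Complex.add_re, Complex.intCast_re]
    linarith [hs i]
  rw [Finset.sum_const, Fin.card_Ici, nsmul_eq_mul, mul_one, Nat.cast_sub j.isLt.le] at h2
  exact h2

theorem MeromorphicNear.comp_add {r : ℕ} {F : (Fin r → ℂ) → ℂ} (hF : ∀ p, MeromorphicNear F p)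
    (q p : Fin r → ℂ) : MeromorphicNear (fun z => F (z + q)) p :=
  MeromorphicNear.comp (L := fun z => z + q) (hF _) (by fun_prop) (isOpenMap_add_right q)

theorem mainTheorem3 (r : ℕ) (hr : 1 ≤ r) (γ : Fin r → ℂ) (hγ : ∀ j, 0 < (γ j).re) :
    -- the desingularized function exists, and it is entire and unique
    (∃! Z : (Fin r → ℂ) → ℂ, IsDesingularizedZeta γ Z) ∧
    -- the multiple zeta-function has a meromorphic continuation to `ℂ^r`
    (∃ F : (Fin r → ℂ) → ℂ, IsMultipleZeta γ F) ∧
    -- only exponents `m` with sum `0` occur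
    (∀ p ∈ (desCoeff r).support, ∑ j, p.2 j = 0) ∧
    -- the identity of meromorphic functions on `ℂ^r`
    ∀ Z F : (Fin r → ℂ) → ℂ, IsDesingularizedZeta γ Z → IsMultipleZeta γ F →
      Dense {s : Fin r → ℂ | ∀ p ∈ (desCoeff r).support,
        HolomorphicNear F (fun j => s j + (p.2 j : ℂ))} ∧
      ∀ s : Fin r → ℂ,
        (∀ p ∈ (desCoeff r).support, HolomorphicNear F (fun j => s j + (p.2 j : ℂ))) →
        Z s = ∑ p ∈ (desCoeff r).support, (desCoeff r p : ℂ) *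
          (∏ j, (ascPochhammer ℂ (p.1 j)).eval (s j)) * F (fun j => s j + (p.2 j : ℂ)) := by
  obtain ⟨n, rfl⟩ : ∃ n, r = n + 1 := ⟨r - 1, by omega⟩
  obtain ⟨η, C, a, hK⟩ := exists_kernelDecay n hγ
  have hZ₀ := hK.isDesingularizedZeta
  refine ⟨⟨_, hZ₀, fun Z hZ => hZ.unique hZ₀⟩, exists_isMultipleZeta n hγ,
    fun p hp => vDegree_eq_zero_of_mem_support hp, fun Z F hZ hF => ⟨?_, fun s hs => ?_⟩⟩
  · refine (dense_setOf_forall_holomorphicNear hF.1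
      ((desCoeff (n + 1)).support.image fun p j => (p.2 j : ℂ))).mono fun s hs p hp => ?_
    exact hs _ (Finset.mem_image_of_mem _ hp)
  · rw [hZ.unique hZ₀]
    set Z₀ := entireIntegral (kerLimit γ) (η / 2)
    have hη2 : 0 < η / 2 := half_pos hK.radius_pos
    have hη3 : η / 2 < η := half_lt_self hK.radius_pos
    set P : (Fin (n + 1) → ℕ) × (Fin (n + 1) → ℤ) → (Fin (n + 1) → ℂ) → ℂ := fun p s =>
      (desCoeff (n + 1) p : ℂ) * ∏ j, (ascPochhammer ℂ (p.1 j)).eval (s j)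
    have hP : ∀ p, Differentiable ℂ (P p) := fun p s => by
      refine DifferentiableAt.const_mul (differentiableAt_finset_prod _ fun j _ => ?_) _
      have h1 : DifferentiableAt ℂ (fun s : Fin (n + 1) → ℂ => s j) s := by fun_prop
      exact ((ascPochhammer ℂ (p.1 j)).differentiable (s j)).comp s h1
    have hPh : ∀ p z, HolomorphicNear (P p) z := fun p z => Eventually.of_forall (hP p)
    have hZh : ∀ z, HolomorphicNear (fun s => -Z₀ s) z := fun z =>
      Eventually.of_forall fun w => (hZ₀.1 w).neg
    -- The difference of the two sides is meromorphic and vanishes on an open set, hence at every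
    -- point near which it is holomorphic. That includes each s at which all the shifted
    -- zeta-functions are holomorphic.
    set Q : (Fin (n + 1) → ℂ) → ℂ := fun s => (∑ p ∈ (desCoeff (n + 1)).support,
      P p s * F (fun j => s j + (p.2 j : ℂ))) + -Z₀ s
    have hQ : ∀ z, MeromorphicNear Q z := fun z =>
      (MeromorphicNear.sum _ fun p _ => (hPh p z).meromorphicNear.mul
        (MeromorphicNear.comp_add hF.1 (fun j => (p.2 j : ℂ)) z)).add (hZh z).meromorphicNear
    obtain ⟨v, hv⟩ := exists_ball_shift_mem_ezRegion
      ((desCoeff (n + 1)).support.image fun p => p.2)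
    have hQv : ∀ᶠ s in 𝓝 v, Q s = 0 := by
      filter_upwards [hv] with s hs
      have h1 := ctrIntegral_kerLimit_eq hγ (η / 2) hF hs.1
        fun p hp => hs.2 _ (Finset.mem_image_of_mem _ hp)
      have h2 : Z₀ s = _ := hK.stripDecay.entireIntegral_eq hη2 hη3 (b := fun _ => false) hs.1
      exact add_neg_eq_zero.2 (h1.symm.trans h2.symm)
    have hQs : HolomorphicNear Q s := by
      have h1 : ∀ p ∈ (desCoeff (n + 1)).support,
          HolomorphicNear (fun s => P p s * F (fun j => s j + (p.2 j : ℂ))) s := fun p hp =>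
        (hPh p s).mul (holomorphicNear_comp_add_iff.2 (hs p hp))
      have h2 : ∀ᶠ z in 𝓝 s, ∀ p ∈ (desCoeff (n + 1)).support,
          DifferentiableAt ℂ (fun s => P p s * F (fun j => s j + (p.2 j : ℂ))) z :=
        (Finset.eventually_all _).2 h1
      filter_upwards [h2] with z hz
      exact (DifferentiableAt.fun_sum hz).add (hZ₀.1 z).neg
    exact (add_neg_eq_zero.1 (eq_zero_of_meromorphicNear_of_eq_zero_on_open hQ hQv hQs)).symm
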